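/- \textbf{Setting.} Let $0<\underline\theta<\bar\theta$, and let $f$ be an integrable density, strictly positive on $[\underline\theta,\bar\theta]$, with cdf $F(\theta)=\int_{\underline\theta}^{\theta}f$, $F(\bar\theta)=1$. Let $R:[\underline\theta,\bar\theta]\to[0,\infty)$ be concave and non-decreasing, and let $w^A,w^B\in\mathbb R$. Put $$W(\theta)=\Big(w^A-w^B\big(\theta-\tfrac{1-F(\theta)}{f(\theta)}\big)\Big)f(\theta),\qquad \mathcal W(\theta)=\int_{\underline\theta}^{\theta}W(z)\,dz,$$ let $\bar{\mathcal W}$ be the least concave majorant of $\mathcal W$ on $[\underline\theta,\bar\theta]$ and $\bar W=\bar{\mathcal W}'$. Derivatives of concave functions are left derivatives. The \emph{original program} maximizes $\int_{\underline\theta}^{\bar\theta}a(\theta)W(\theta)\,d\theta+w^B\underline u$ over $a:[\underline\theta,\bar\theta]\to\mathbb R_+$ and $\underline u\ge 0$ subject to: $a$ non-increasing; $\underline u+\int_{\underline\theta}^{\theta}a\le R(\theta)$ for all $\theta$ (IR); $-a(\theta)\theta+\underline u+\int_{\underline\theta}^{\theta}a\ge 0$ for all $\theta$. The \emph{relaxed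 program} maximizes $\int a\bar W+w^B\underline u$ subject to $a$ non-increasing, (IR), and $-a(\underline\theta)\underline\theta+\underline u\ge0$. Let $S(w^A,w^B)=\max\{w^An^A+w^Bn^B\}$ over all pairs $(n^A,n^B)=(\int af,\int bf)$ with $a,b\ge0$ on $[\underline\theta,\bar\theta]$, $\theta a(\theta)+b(\theta)\le\theta a(\theta')+b(\theta')$ and $\theta a(\theta)+b(\theta)\le R(\theta)$ for all $\theta,\theta'$. Let $\underline\theta^*$ and $\bar\theta^*$ be the smallest and the largest maximizer of $\mathcal W$ on $[\underline\theta,\bar\theta]$. Extend $R$ by $R(\theta)=R(\bar\theta)$ for $\theta>\bar\theta$. When $R(\underline\theta)>0$ let $\check\theta=\max\{\theta\ge\underline\theta: R(\theta)/\theta\ge R(\underline\theta)/\underline\theta\}$. With $h(\theta)=\theta\bar W(\theta)-w^B\underline\theta-\bar{\mathcal W}(\theta)$ let $$\bar\theta^{\#}=\sup\big(\{\theta\in(\underline\theta,\bar\theta):h(\theta)\ge0\}\cup\{\underline\theta\}\big),\qquad \underline\theta^{\#}=\inf\big(\{\theta\in(\underline\theta,\bar\theta):h(\theta)\le0\}\cup\{\bar\theta\}\big),$$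 and $m=\max\{\check\theta,\bar\theta^{\#}\}$. Say that $(a,\underline u)$ has \emph{threshold form} with cutoff $\tilde\theta$ if $\underline u=\underline\theta R(\tilde\theta)/\tilde\theta$; $a=\underline u/\underline\theta$ on $[\underline\theta,\min\{\tilde\theta,\underline\theta^*\}]$; $a=R'$ on $(\tilde\theta,\underline\theta^*]$; $a$ is non-increasing on $[\underline\theta^*,\bar\theta^*]$, and on $(\underline\theta^*,\bar\theta^*]$ it is non-negative and satisfies (IR); $a=0$ on $(\bar\theta^*,\bar\theta]$. \textbf{Theorem.} (1) The maxima in the original program, in the relaxed program and in $S(w^A,w^B)$ are attained and are equal. (2) Suppose $w^A,w^B\le0$. Then the value of the relaxed program is $0$, attained at $a\equiv0$, $\underline u=0$; if $w^A,w^B<0$ this is the only solution. If $w^A=0$ or $w^B=0$, and $R(\underline\theta)>0$, then every $\tilde\theta\ge\max\{\check\theta,\underline\theta^*\}$ maximizes over $\theta\ge\check\theta$ the function $$\tfrac{R(\theta)}{\theta}\bar{\mathcal W}(\min\{\theta,\underline\theta^*\})+\int_{\min\{\theta,\underline\theta^*\}}^{\underline\theta^*}\bar W(z)R'(z)\,dz+w^B\underline\theta\tfrac{R(\theta)}{\theta}.$$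 (3) Suppose $w^A>0$ or $w^B>0$. Then $\bar\theta^{\#}\le\underline\theta^*$. If moreover $R(\underline\theta)>0$, then: (a) the value of the relaxed program is $$\tfrac{R(m)}{m}\Big(\bar{\mathcal W}(\min\{m,\underline\theta^*\})+w^B\underline\theta\Big)+\int_{\min\{m,\underline\theta^*\}}^{\underline\theta^*}\bar W(z)R'(z)\,dz;$$ (b) every $(a,\underline u)$ of threshold form with a cutoff $\tilde\theta\in[\max\{\check\theta,\underline\theta^{\#}\},\max\{\check\theta,\bar\theta^{\#}\}]$ solves the relaxed program; (c) conversely, up to null sets and up to redistribution of $a$ inside intervals on which $\bar{\mathcal W}$ is affine, these are all solutions. Precisely, $(a,\underline u)$ solves the relaxed program if and only if it is feasible and there are such a $\tilde\theta$ and an $a_0$ with $(a_0,\underline u)$ of threshold form with cutoff $\tilde\theta$, such that $a=a_0$ on $(\underline\theta^*,\bar\theta]$ and, for those $\theta\in[\underline\theta,\underline\theta^*]$ that are not interior to an interval on which $\bar{\mathcal W}$ is affine, $\int_{\underline\theta}^{\theta}a=\int_{\underline\theta}^{\theta}a_0$ for all such $\theta$ and $a(\theta)=a_0(\theta)$ for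 almost all such $\theta$. In particular $a=a_0$ almost everywhere if $\bar{\mathcal W}$ is strictly concave on $[\underline\theta,\underline\theta^*]$. (4) Let $(\tilde a,\underline u)$ be any solution of the relaxed program. Let $a^*(\theta)=\frac1{y-x}\int_x^y\tilde a$ if $\theta$ lies in a maximal open interval $(x,y)\subseteq(\underline\theta,\bar\theta)$ on which $\mathcal W<\bar{\mathcal W}$, and $a^*(\theta)=\tilde a(\theta)$ otherwise. Then $(a^*,\underline u)$ solves the original program. -/

import Mathlib

open Set MeasureTheory

noncomputable section

/-- Left derivative of a real function. -/
def leftDeriv (g : ℝ → ℝ) (x : ℝ) : ℝ := derivWithin g (Iio x) x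

/-- Concave upper envelope of `g` on `s`: the pointwise least concave majorant of `g` on `s`. -/
def concaveEnvelope (s : Set ℝ) (g : ℝ → ℝ) (x : ℝ) : ℝ :=
  sInf {y | ∃ h : ℝ → ℝ, ConcaveOn ℝ s h ∧ (∀ z ∈ s, g z ≤ h z) ∧ y = h x}

/-- Data of the inner program: types in `[lo, hi]` with density `f`, reservation workload `R`,
weights `wA`, `wB`. (Data only; `f` and `R` matter only on `[lo, hi]`.) -/
structure InnerProgram where
  lo : ℝ
  hi : ℝ
  f : ℝ → ℝ
  R : ℝ → ℝ
  wA : ℝ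
  wB : ℝ

namespace InnerProgram

variable (P : InnerProgram)

/-- The type interval. -/
def types : Set ℝ := Icc P.lo P.hi

/-- The cdf, on `[lo, hi]`. -/
def F (θ : ℝ) : ℝ := ∫ z in P.lo..θ, P.f z

/-! ### The mechanism-design program and its support function -/

/-- A mechanism `(a, b)` that is non-negative, incentive compatible and individually rational. -/
structure FeasibleMechanism (a b : ℝ → ℝ) : Prop where
  nonneg : ∀ θ ∈ P.types, 0 ≤ a θ ∧ 0 ≤ b θ
  ic : ∀ θ ∈ P.types, ∀ θ' ∈ P.types, θ * a θ + b θ ≤ θ * a θ' + b θ'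
  ir : ∀ θ ∈ P.types, θ * a θ + b θ ≤ P.R θ

/-- The set of aggregate allocations `(E[a], E[b])` induced by feasible mechanisms. -/
def incentiveFeasible : Set (ℝ × ℝ) :=
  {n | ∃ a b : ℝ → ℝ, P.FeasibleMechanism a b ∧
    n = (∫ θ in P.lo..P.hi, a θ * P.f θ, ∫ θ in P.lo..P.hi, b θ * P.f θ)}

/-- The values whose maximum is the support function of the incentive-feasible set
at `(wA, wB)`. -/
def supportValues : Set ℝ :=
  {v | ∃ n ∈ P.incentiveFeasible, v = P.wA * n.1 + P.wB * n.2}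

/-! ### The original and the relaxed program -/

/-- The virtual weight `W`. -/
def W (θ : ℝ) : ℝ := (P.wA - P.wB * (θ - (1 - P.F θ) / P.f θ)) * P.f θ

/-- The primitive `𝒲` of `W`. -/
def calW (θ : ℝ) : ℝ := ∫ z in P.lo..θ, P.W z

/-- The concave envelope of `𝒲` on the type interval. -/
def calWbar (θ : ℝ) : ℝ := concaveEnvelope P.types P.calW θ

/-- The (left) derivative of the concave envelope; used only at points of `(lo, hi]`. -/
def Wbar (θ : ℝ) : ℝ := leftDeriv P.calWbar θ

/-- `∫ a w + wB u`. -/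
def objective (w : ℝ → ℝ) (a : ℝ → ℝ) (u : ℝ) : ℝ :=
  (∫ θ in P.lo..P.hi, a θ * w θ) + P.wB * u

/-- Workload of type `θ`: `u + ∫_{lo}^θ a`. -/
def workload (a : ℝ → ℝ) (u θ : ℝ) : ℝ := u + ∫ z in P.lo..θ, a z

/-- Constraints of the original program; the task-`B` allocation of every type is
non-negative. -/
structure OriginalFeasible (a : ℝ → ℝ) (u : ℝ) : Prop where
  a_nonneg : ∀ θ ∈ P.types, 0 ≤ a θ
  u_nonneg : 0 ≤ u
  ic : AntitoneOn a P.types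
  ir : ∀ θ ∈ P.types, P.workload a u θ ≤ P.R θ
  nn : ∀ θ ∈ P.types, 0 ≤ -(a θ * θ) + P.workload a u θ

/-- Constraints of the relaxed program; non-negativity of task `B` is imposed at `lo` only. -/
structure RelaxedFeasible (a : ℝ → ℝ) (u : ℝ) : Prop where
  a_nonneg : ∀ θ ∈ P.types, 0 ≤ a θ
  u_nonneg : 0 ≤ u
  ic : AntitoneOn a P.types
  ir : ∀ θ ∈ P.types, P.workload a u θ ≤ P.R θ
  nn : 0 ≤ -(a P.lo * P.lo) + u

/-- Attainable values of the original program. -/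
def originalValues : Set ℝ :=
  {v | ∃ (a : ℝ → ℝ) (u : ℝ), P.OriginalFeasible a u ∧ v = P.objective P.W a u}

/-- Attainable values of the relaxed program. -/
def relaxedValues : Set ℝ :=
  {v | ∃ (a : ℝ → ℝ) (u : ℝ), P.RelaxedFeasible a u ∧ v = P.objective P.Wbar a u}

/-- `(a, u)` solves the original program. -/
def IsOriginalSolution (a : ℝ → ℝ) (u : ℝ) : Prop :=
  P.OriginalFeasible a u ∧ ∀ a' u', P.OriginalFeasible a' u' →
    P.objective P.W a' u' ≤ P.objective P.W a u

/-- `(a, u)` solves the relaxed program. -/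
def IsRelaxedSolution (a : ℝ → ℝ) (u : ℝ) : Prop :=
  P.RelaxedFeasible a u ∧ ∀ a' u', P.RelaxedFeasible a' u' →
    P.objective P.Wbar a' u' ≤ P.objective P.Wbar a u

/-! ### Cutoffs -/

/-- `R` extended to `[lo, ∞)` by the constant `R hi` beyond `hi`. -/
def Rext (θ : ℝ) : ℝ := P.R (min θ P.hi)

/-- The maximizers of `𝒲` on the type interval. -/
def argmaxW : Set ℝ := {θ | θ ∈ P.types ∧ IsMaxOn P.calW P.types θ}

/-- The smallest maximizer of `𝒲`. -/
def starLow : ℝ := sInf P.argmaxW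

/-- The largest maximizer of `𝒲`. -/
def starHigh : ℝ := sSup P.argmaxW

/-- The largest `θ ≥ lo` with `R θ / θ ≥ R lo / lo`. -/
def check : ℝ := sSup {θ | P.lo ≤ θ ∧ P.R P.lo / P.lo ≤ P.Rext θ / θ}

/-- `θ W̄(θ) - wB lo - 𝒲̄(θ)`. It is non-increasing on `(lo, hi)`. -/
def tangentGap (θ : ℝ) : ℝ := θ * P.Wbar θ - P.wB * P.lo - P.calWbar θ

/-- The last point where `tangentGap` is non-negative, or `lo` if there is none. Since
`tangentGap` is non-increasing, neither this nor `sharpLow` depends on which one-sided derivative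
is taken at a kink, or on the two endpoints. -/
def sharpHigh : ℝ := sSup ({θ | θ ∈ Ioo P.lo P.hi ∧ 0 ≤ P.tangentGap θ} ∪ {P.lo})

/-- The first point where `tangentGap` is non-positive, or `hi` if there is none. -/
def sharpLow : ℝ := sInf ({θ | θ ∈ Ioo P.lo P.hi ∧ P.tangentGap θ ≤ 0} ∪ {P.hi})

/-- The interval of optimal cutoffs. -/
def cutoffs : Set ℝ := Icc (max P.check P.sharpLow) (max P.check P.sharpHigh)

/-- Objective of the one-dimensional problem of choosing the cutoff `θ ≥ check`. -/
def cutoffObjective (θ : ℝ) : ℝ :=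
  P.Rext θ / θ * P.calWbar (min θ P.starLow)
    + (∫ z in (min θ P.starLow)..P.starLow, P.Wbar z * leftDeriv P.R z)
    + P.wB * P.lo * (P.Rext θ / θ)

/-- `(a, u)` has the threshold form with cutoff `t`. On `(starLow, starHigh]`, where `W̄ = 0`,
`a` is an arbitrary non-negative non-increasing continuation of `a` that respects the
reservation workload. -/
structure ThresholdForm (t : ℝ) (a : ℝ → ℝ) (u : ℝ) : Prop where
  u_eq : u = P.lo * P.Rext t / t
  initial : ∀ θ ∈ Icc P.lo (min t P.starLow), a θ = u / P.lo
  middle : ∀ θ ∈ Ioc t P.starLow, a θ = leftDeriv P.R θ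
  free_antitone : AntitoneOn a (Icc P.starLow P.starHigh)
  free_nonneg : ∀ θ ∈ Ioc P.starLow P.starHigh, 0 ≤ a θ
  free_ir : ∀ θ ∈ Ioc P.starLow P.starHigh, P.workload a u θ ≤ P.R θ
  final : ∀ θ ∈ Ioc P.starHigh P.hi, a θ = 0

/-- `θ` is an interior point of a subinterval of `[lo, hi]` on which `𝒲̄` is affine. -/
def LocallyAffine (θ : ℝ) : Prop :=
  ∃ x y m c : ℝ, P.lo ≤ x ∧ x < θ ∧ θ < y ∧ y ≤ P.hi ∧ ∀ z ∈ Icc x y, P.calWbar z = m * z + c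

/-! ### Ironing -/

/-- `𝒲 < 𝒲̄` on the non-empty open interval `(x, y)` within `(lo, hi)`. -/
def Gap (x y : ℝ) : Prop :=
  P.lo ≤ x ∧ x < y ∧ y ≤ P.hi ∧ ∀ θ ∈ Ioo x y, P.calW θ < P.calWbar θ

/-- `(x, y)` is a maximal open interval on which `𝒲 < 𝒲̄`. -/
def IsIroningInterval (x y : ℝ) : Prop :=
  P.Gap x y ∧ ∀ x' y', x' ≤ x → y ≤ y' → P.Gap x' y' → x' = x ∧ y' = y

open Classical in
/-- The ironed allocation: the average of `a` on each ironing interval, and `a` elsewhere. -/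
def ironed (a : ℝ → ℝ) (θ : ℝ) : ℝ :=
  if h : ∃ p : ℝ × ℝ, P.IsIroningInterval p.1 p.2 ∧ θ ∈ Ioo p.1 p.2 then
    (∫ z in h.choose.1..h.choose.2, a z) / (h.choose.2 - h.choose.1)
  else a θ

end InnerProgram

end

noncomputable section

/-! ### Concave functions on the line -/

section Concave

variable {S : Set ℝ} {K : ℝ → ℝ} {x y z : ℝ}

/-! The proof has two halves. Ironing reduces the original program to the relaxed one, and a
linear-programming dual with an explicit multiplier solves the relaxed one.

Ironing. Incentive compatibility determines `b` from `a` and the rent of the lowest type, so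
mechanisms and pairs `(a, u)` are interchangeable (`supportValues_eq`), and both programs have the
same feasible set (`originalFeasible_iff`). By the layer-cake formula `integral_mul_antitone`, the
two objectives differ by the integral of `𝒲̄ - 𝒲` over the level cuts of `a`
(`objective_Wbar_sub_W`). This is non-negative, and it is zero when `a` is constant on every gap,
since then no cut falls into a gap. Averaging `a` over the gaps keeps it feasible, and it keeps the
relaxed value because `𝒲̄` is affine on gaps (`concaveEnvelope_affine_of_lt`). For non-positive
weights, ironing also writes the relaxed value as `wA` and `wB` times non-negative aggregates, which
settles that case.

Duality. A feasible workload lies below `R` and below the ray from the origin of slope `u / lo`.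
Given a cutoff `t` and a number `τ`, `objective_eq` rewrites the objective: `τ` is split off from
`W̄` before the cutoff, `W̄` is decomposed into its level sets between the cutoff and `starLow`, and
it is left alone after `starLow`, where it is non-positive. The bound `dualValue` then exceeds the
objective by four non-negative slack terms (`dualValue_sub_objective`). For `t` in `cutoffs` a
suitable `τ` exists (`exists_isMultiplier`): it is the slope of a supporting line of `𝒲̄` at `t`
through the point `(0, -wB * lo)`, unless `t` is the corner `check`. A threshold form with cutoff
`t` makes all four slacks vanish.

Converse. Every solution makes the four slacks vanish (`slackness`). Its `u` determines a cutoff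
`t`, and comparison with the multipliers at the two ends of `cutoffs` puts `t` between them
(`mem_cutoffs_of_isRelaxedSolution`). The individual rationality constraint binds at almost all
level cuts of `W̄`, and these accumulate at every point that is not interior to an affine piece.
This fixes the workload there (`workload_eq_min`), and differentiation fixes `a`. -/

theorem ConcaveOn.hasDerivWithinAt_leftDeriv (hK : ConcaveOn ℝ S K) (hx : x ∈ interior S) :
    HasDerivWithinAt K (leftDeriv K x) (Iio x) x := by
  have h := (hK.neg.differentiableWithinAt_Iio_of_mem_interior hx).neg
  simp only [Pi.neg_def, neg_neg] at h
  exact h.hasDerivWithinAt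

theorem ConcaveOn.hasDerivWithinAt_rightDeriv (hK : ConcaveOn ℝ S K) (hx : x ∈ interior S) :
    HasDerivWithinAt K (derivWithin K (Ioi x) x) (Ioi x) x := by
  have h := (hK.neg.differentiableWithinAt_Ioi_of_mem_interior hx).neg
  simp only [Pi.neg_def, neg_neg] at h
  exact h.hasDerivWithinAt

theorem ConcaveOn.leftDeriv_mul_le (hK : ConcaveOn ℝ S K) (hx : x ∈ S) (hy : y ∈ interior S)
    (hxy : x < y) : leftDeriv K y * (y - x) ≤ K y - K x := by
  have h := hK.le_slope_of_hasDerivWithinAt_Iio hx (interior_subset hy) hxy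
    (hK.hasDerivWithinAt_leftDeriv hy)
  rwa [slope_def_field, le_div_iff₀ (sub_pos.2 hxy)] at h

theorem ConcaveOn.le_rightDeriv_mul (hK : ConcaveOn ℝ S K) (hx : x ∈ interior S) (hy : y ∈ S)
    (hxy : x < y) : K y - K x ≤ derivWithin K (Ioi x) x * (y - x) := by
  have h := hK.slope_le_of_hasDerivWithinAt_Ioi (interior_subset hx) hy hxy
    (hK.hasDerivWithinAt_rightDeriv hx)
  rwa [slope_def_field, div_le_iff₀ (sub_pos.2 hxy)] at h

theorem ConcaveOn.rightDeriv_le_leftDeriv (hK : ConcaveOn ℝ S K) (hx : x ∈ interior S) :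
    derivWithin K (Ioi x) x ≤ leftDeriv K x := by
  have h := hK.neg.leftDeriv_le_rightDeriv_of_mem_interior hx
  rw [(hK.hasDerivWithinAt_leftDeriv hx).neg.derivWithin (uniqueDiffWithinAt_Iio x),
    (hK.hasDerivWithinAt_rightDeriv hx).neg.derivWithin (uniqueDiffWithinAt_Ioi x)] at h
  linarith

/-- The left derivative is a supergradient. -/
theorem ConcaveOn.le_add_leftDeriv_mul (hK : ConcaveOn ℝ S K) (hx : x ∈ interior S) (hz : z ∈ S) :
    K z ≤ K x + leftDeriv K x * (z - x) := by
  rcases lt_trichotomy z x with h | rfl | h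
  · linarith [hK.leftDeriv_mul_le hz hx h]
  · simp
  · nlinarith [hK.le_rightDeriv_mul hx hz h, hK.rightDeriv_le_leftDeriv hx]

theorem ConcaveOn.leftDeriv_le_rightDeriv (hK : ConcaveOn ℝ S K) (hx : x ∈ interior S)
    (hy : y ∈ interior S) (hxy : x < y) : leftDeriv K y ≤ derivWithin K (Ioi x) x :=
  le_of_mul_le_mul_right ((hK.leftDeriv_mul_le (interior_subset hx) hy hxy).trans
    (hK.le_rightDeriv_mul hx (interior_subset hy) hxy)) (sub_pos.2 hxy)

theorem ConcaveOn.antitoneOn_leftDeriv (hK : ConcaveOn ℝ S K) :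
    AntitoneOn (leftDeriv K) (interior S) := by
  intro x hx y hy hxy
  rcases hxy.eq_or_lt with rfl | hxy
  · rfl
  · exact (hK.leftDeriv_le_rightDeriv hx hy hxy).trans (hK.rightDeriv_le_leftDeriv hx)

/-- The right derivative is antitone, so it is continuous off a countable set. At a continuity point
the left derivative is at most the right derivatives at earlier points, hence at most their limit.
-/
theorem ConcaveOn.ae_rightDeriv_eq_leftDeriv {p q : ℝ} (hK : ConcaveOn ℝ (Icc p q) K) :
    ∀ᵐ x, x ∈ Ioo p q → derivWithin K (Ioi x) x = leftDeriv K x := by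
  have hanti : AntitoneOn (fun x => derivWithin K (Ioi x) x) (Ioo p q) := by
    intro x hx y hy hxy
    rw [← interior_Icc] at hx hy
    rcases hxy.eq_or_lt with rfl | hxy
    · rfl
    · exact (hK.rightDeriv_le_leftDeriv hy).trans (hK.leftDeriv_le_rightDeriv hx hy hxy)
  have hc := hanti.countable_not_continuousWithinAt
  have : ∀ᵐ x, x ∉ {x | x ∈ Ioo p q ∧
      ¬ ContinuousWithinAt (fun x => derivWithin K (Ioi x) x) (Ioo p q) x} :=
    (measure_eq_zero_iff_ae_notMem).1 (hc.measure_zero volume)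
  filter_upwards [this] with x hx hxI
  have hcont : ContinuousAt (fun x => derivWithin K (Ioi x) x) x := by
    by_contra hcon
    exact hx ⟨hxI, fun h => hcon (h.continuousAt (Ioo_mem_nhds hxI.1 hxI.2))⟩
  have hxI' : x ∈ interior (Icc p q) := by rwa [interior_Icc]
  refine le_antisymm (hK.rightDeriv_le_leftDeriv hxI') ?_
  refine ge_of_tendsto (hcont.tendsto.mono_left (nhdsWithin_le_nhds (s := Iio x))) ?_
  filter_upwards [Ioo_mem_nhdsLT hxI.1] with y hy
  refine hK.leftDeriv_le_rightDeriv ?_ hxI' hy.2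
  rw [interior_Icc]
  exact ⟨hy.1, hy.2.trans hxI.2⟩

/-- The derivative may be unbounded at both end points. It has a constant sign on either side of a
maximizer `c`, and a derivative of constant sign of a continuous function is integrable. -/
theorem ConcaveOn.intervalIntegrable_rightDeriv {p q : ℝ} (hpq : p ≤ q)
    (hK : ConcaveOn ℝ (Icc p q) K) (hcont : ContinuousOn K (Icc p q)) :
    IntervalIntegrable (fun x => derivWithin K (Ioi x) x) volume p q := by
  obtain ⟨c, hc, hmax⟩ := isCompact_Icc.exists_isMaxOn (nonempty_Icc.2 hpq) hcont
  have hder : ∀ x ∈ Ioo p q, HasDerivWithinAt K (derivWithin K (Ioi x) x) (Ioi x) x :=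
    fun x hx => hK.hasDerivWithinAt_rightDeriv (by rwa [interior_Icc])
  have h1 : IntervalIntegrable (fun x => derivWithin K (Ioi x) x) volume p c := by
    rw [intervalIntegrable_iff_integrableOn_Ioc_of_le hc.1]
    refine intervalIntegral.integrableOn_deriv_right_of_nonneg
      (hcont.mono (Icc_subset_Icc_right hc.2))
      (fun x hx => hder x ⟨hx.1, hx.2.trans_le hc.2⟩) fun x hx => ?_
    have hxI : x ∈ Ioo p q := ⟨hx.1, hx.2.trans_le hc.2⟩
    have h := hK.le_rightDeriv_mul (by rwa [interior_Icc]) hc hx.2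
    have h2 : K x ≤ K c := hmax (Ioo_subset_Icc_self hxI)
    exact nonneg_of_mul_nonneg_left (by linarith) (sub_pos.2 hx.2)
  have h2 : IntervalIntegrable (fun x => derivWithin K (Ioi x) x) volume c q := by
    rw [intervalIntegrable_iff_integrableOn_Ioc_of_le hc.2]
    have := intervalIntegral.integrableOn_deriv_right_of_nonneg (a := c) (b := q)
      (g := fun x => - K x) (g' := fun x => - derivWithin K (Ioi x) x)
      (hcont.mono (Icc_subset_Icc_left hc.1)).neg
      (fun x hx => (hder x ⟨hc.1.trans_lt hx.1, hx.2⟩).neg) fun x hx => ?_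
    · simpa using this.neg
    have hxI : x ∈ Ioo p q := ⟨hc.1.trans_lt hx.1, hx.2⟩
    have hxI' : x ∈ interior (Icc p q) := by rwa [interior_Icc]
    have h := hK.leftDeriv_mul_le hc hxI' hx.1
    have h2 : K x ≤ K c := hmax (Ioo_subset_Icc_self hxI)
    have h3 : leftDeriv K x ≤ 0 := nonpos_of_mul_nonpos_left (by linarith) (sub_pos.2 hx.1)
    linarith [hK.rightDeriv_le_leftDeriv hxI']
  exact h1.trans h2

theorem ConcaveOn.intervalIntegrable_leftDeriv {p q : ℝ} (hpq : p ≤ q)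
    (hK : ConcaveOn ℝ (Icc p q) K) (hcont : ContinuousOn K (Icc p q)) :
    IntervalIntegrable (leftDeriv K) volume p q := by
  refine (hK.intervalIntegrable_rightDeriv hpq hcont).congr_ae ?_
  rw [uIoc_of_le hpq, ← restrict_Ioo_eq_restrict_Ioc, Filter.EventuallyEq,
    ae_restrict_iff' measurableSet_Ioo]
  exact hK.ae_rightDeriv_eq_leftDeriv

theorem ConcaveOn.integral_leftDeriv {p q : ℝ} (hpq : p ≤ q)
    (hK : ConcaveOn ℝ (Icc p q) K) (hcont : ContinuousOn K (Icc p q)) :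
    ∫ x in p..q, leftDeriv K x = K q - K p := by
  rw [← intervalIntegral.integral_eq_sub_of_hasDeriv_right_of_le hpq hcont
    (fun x hx => hK.hasDerivWithinAt_rightDeriv (by rwa [interior_Icc]))
    (hK.intervalIntegrable_rightDeriv hpq hcont)]
  rw [intervalIntegral.integral_of_le hpq, intervalIntegral.integral_of_le hpq,
    ← restrict_Ioo_eq_restrict_Ioc]
  refine setIntegral_congr_ae measurableSet_Ioo ?_
  filter_upwards [hK.ae_rightDeriv_eq_leftDeriv] with x hx hxI using (hx hxI).symm

end Concave

/-! ### Integration lemmas -/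

/-- Integration by parts for primitives of integrable functions. -/
theorem integral_primitive_mul {a f : ℝ → ℝ} {p q : ℝ} (ha : IntervalIntegrable a volume p q)
    (hf : IntervalIntegrable f volume p q) :
    ∫ x in p..q, (∫ z in p..x, a z) * f x =
      (∫ x in p..q, a x) * (∫ x in p..q, f x) - ∫ x in p..q, a x * ∫ z in p..x, f z := by
  -- Primitives are absolutely continuous with almost everywhere derivative equal to the integrand,
  -- so neither factor has to be continuous.
  have hA := ha.absolutelyContinuousOnInterval_intervalIntegral (c := p) (by simp)
  have hF := hf.absolutelyContinuousOnInterval_intervalIntegral (c := p) (by simp)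
  have h := hA.integral_mul_deriv_eq_deriv_mul hF
  simp only [intervalIntegral.integral_same, zero_mul, sub_zero] at h
  have e1 : ∫ x in p..q, (∫ z in p..x, a z) * f x =
      ∫ x in p..q, (∫ z in p..x, a z) * deriv (fun x => ∫ z in p..x, f z) x := by
    refine intervalIntegral.integral_congr_ae ?_
    filter_upwards [hf.ae_hasDerivAt_integral] with x hx hxI
    rw [(hx (uIoc_subset_uIcc hxI) p (by simp)).deriv]
  have e2 : ∫ x in p..q, a x * (∫ z in p..x, f z) =
      ∫ x in p..q, deriv (fun x => ∫ z in p..x, a z) x * (∫ z in p..x, f z) := by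
    refine intervalIntegral.integral_congr_ae ?_
    filter_upwards [ha.ae_hasDerivAt_integral] with x hx hxI
    rw [(hx (uIoc_subset_uIcc hxI) p (by simp)).deriv]
  rw [e1, e2, h]

/-- The endpoint of the initial interval of `(p, q)` on which the antitone function `φ` exceeds
`s`. -/
def levelCut (p q : ℝ) (φ : ℝ → ℝ) (s : ℝ) : ℝ := sSup ({z | z ∈ Ioo p q ∧ s < φ z} ∪ {p})

section LevelCut

variable {p q s : ℝ} {φ : ℝ → ℝ}

theorem bddAbove_levelCut (hpq : p ≤ q) : BddAbove ({z | z ∈ Ioo p q ∧ s < φ z} ∪ {p}) :=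
  ⟨q, by rintro z (hz | rfl); exacts [hz.1.2.le, hpq]⟩

theorem levelCut_mem (hpq : p ≤ q) : levelCut p q φ s ∈ Icc p q :=
  ⟨le_csSup (bddAbove_levelCut hpq) (by simp),
    csSup_le ⟨p, by simp⟩ (by rintro z (hz | rfl); exacts [hz.1.2.le, hpq])⟩

theorem lt_of_lt_levelCut (hφ : AntitoneOn φ (Ioo p q)) {z : ℝ} (hz : z ∈ Ioo p q)
    (h : z < levelCut p q φ s) : s < φ z := by
  obtain ⟨y, hy | rfl, hzy⟩ := exists_lt_of_lt_csSup ⟨p, by simp⟩ h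
  · exact hy.2.trans_le (hφ hz hy.1 hzy.le)
  · exact absurd hz.1 hzy.not_gt

theorem le_levelCut (hpq : p ≤ q) {z : ℝ} (hz : z ∈ Ioo p q) (h : s < φ z) :
    z ≤ levelCut p q φ s := le_csSup (bddAbove_levelCut hpq) (Or.inl ⟨hz, h⟩)

theorem levelCut_le_of_le (hφ : AntitoneOn φ (Ioo p q)) {z : ℝ} (hz : z ∈ Ioo p q)
    (h : φ z ≤ s) : levelCut p q φ s ≤ z := by
  by_contra! hcon
  exact absurd (lt_of_lt_levelCut hφ hz hcon) h.not_gt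

theorem antitone_levelCut (hpq : p ≤ q) : Antitone (levelCut p q φ) := by
  intro s s' hs
  refine csSup_le_csSup (bddAbove_levelCut hpq) ⟨p, by simp⟩ ?_
  rintro z (hz | hz)
  exacts [Or.inl ⟨hz.1, hs.trans_lt hz.2⟩, Or.inr hz]

/-- Layer-cake formula for the integral of a product with a bounded antitone function. -/
theorem integral_mul_antitone {g : ℝ → ℝ} {M : ℝ} (hpq : p ≤ q) (hM : 0 ≤ M)
    (hφ : AntitoneOn φ (Ioo p q)) (hφM : ∀ x ∈ Ioo p q, φ x ∈ Icc 0 M)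
    (hg : IntervalIntegrable g volume p q) :
    ∫ x in p..q, g x * φ x = ∫ s in 0..M, ∫ z in p..(levelCut p q φ s), g z := by
  -- An antitone extension to the whole line is measurable, so the region under its graph is a
  -- measurable subset of the plane and Fubini applies.
  obtain ⟨ψ, hψ, hψφ⟩ := hφ.exists_antitone_extension
    ⟨0, by rintro _ ⟨x, hx, rfl⟩; exact (hφM x hx).1⟩
    ⟨M, by rintro _ ⟨x, hx, rfl⟩; exact (hφM x hx).2⟩
  have hgI : Integrable g (volume.restrict (Ioo p q)) := by
    rw [intervalIntegrable_iff_integrableOn_Ioo_of_le hpq] at hg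
    exact hg
  have hmeas : MeasurableSet {w : ℝ × ℝ | w.2 < ψ w.1} :=
    measurableSet_lt measurable_snd (hψ.measurable.comp measurable_fst)
  have hint : Integrable (Function.uncurry fun x s => g x * {w : ℝ × ℝ | w.2 < ψ w.1}.indicator
      (fun _ => (1 : ℝ)) (x, s)) ((volume.restrict (Ioo p q)).prod (volume.restrict (Ioo 0 M))) := by
    have h1 : Integrable (fun w : ℝ × ℝ => g w.1 * (1 : ℝ))
        ((volume.restrict (Ioo p q)).prod (volume.restrict (Ioo 0 M))) :=
      hgI.mul_prod (integrable_const 1)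
    refine (h1.indicator hmeas).congr (Filter.Eventually.of_forall fun w => ?_)
    by_cases hw : w.2 < ψ w.1 <;> simp [Function.uncurry, indicator, hw]
  have hswap := integral_integral_swap hint
  rw [intervalIntegral.integral_of_le hpq, intervalIntegral.integral_of_le hM,
    ← restrict_Ioo_eq_restrict_Ioc, ← restrict_Ioo_eq_restrict_Ioc]
  refine Eq.trans ?_ (hswap.trans ?_)
  · refine setIntegral_congr_fun measurableSet_Ioo fun x hx => ?_
    have hx' := hφM x hx
    rw [integral_const_mul]
    congr 1
    have : (fun s => {w : ℝ × ℝ | w.2 < ψ w.1}.indicator (fun _ => (1 : ℝ)) (x, s)) =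
        (Iio (φ x)).indicator (fun _ => 1) := by
      funext s
      simp [indicator, hψφ hx]
    rw [this, setIntegral_indicator measurableSet_Iio]
    have : Ioo 0 M ∩ Iio (φ x) = Ioo 0 (φ x) := by
      ext s
      simp only [mem_inter_iff, mem_Ioo, mem_Iio]
      constructor
      · rintro ⟨⟨h1, -⟩, h2⟩; exact ⟨h1, h2⟩
      · rintro ⟨h1, h2⟩; exact ⟨⟨h1, h2.trans_le hx'.2⟩, h2⟩
    rw [this]
    simp [hx'.1]
  · refine setIntegral_congr_fun measurableSet_Ioo fun s hs => ?_
    have hc := levelCut_mem (φ := φ) (s := s) hpq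
    rw [intervalIntegral.integral_of_le hc.1, ← restrict_Ioo_eq_restrict_Ioc,
      ← integral_indicator measurableSet_Ioo, ← integral_indicator measurableSet_Ioo]
    refine integral_congr_ae ?_
    -- Only at the cut itself is it undetermined whether `φ` exceeds `s`; that point is null.
    filter_upwards [compl_mem_ae_iff.2 (measure_singleton (μ := volume) (levelCut p q φ s))]
      with x hx
    by_cases hxI : x ∈ Ioo p q
    · rw [indicator_of_mem hxI]
      rcases lt_or_gt_of_ne hx with h | h
      · have := lt_of_lt_levelCut hφ hxI h
        rw [indicator_of_mem (show x ∈ Ioo p (levelCut p q φ s) from ⟨hxI.1, h⟩),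
          indicator_of_mem (by simpa [hψφ hxI] using this), mul_one]
      · have : ¬ s < φ x := fun hcon => absurd (le_levelCut hpq hxI hcon) h.not_ge
        rw [indicator_of_notMem (show x ∉ Ioo p (levelCut p q φ s) from fun hh => absurd hh.2 h.not_gt),
          indicator_of_notMem (by simpa [hψφ hxI] using this), mul_zero]
    · rw [indicator_of_notMem hxI, indicator_of_notMem]
      exact fun hh => hxI ⟨hh.1, hh.2.trans_le hc.2⟩

end LevelCut

/-! ### Components of open subsets of the line -/

/-- The connected component of a point of an open set, cut off by two points outside of it. -/
theorem IsOpen.exists_component {O : Set ℝ} (hO : IsOpen O) {p q θ : ℝ} (hp : p ∉ O) (hq : q ∉ O)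
    (hθ : θ ∈ O) (hpθ : p ≤ θ) (hθq : θ ≤ q) :
    ∃ x y, p ≤ x ∧ y ≤ q ∧ θ ∈ Ioo x y ∧ Ioo x y ⊆ O ∧ x ∉ O ∧ y ∉ O := by
  have hc1 : IsClosed (Icc p θ ∩ Oᶜ) := isClosed_Icc.inter hO.isClosed_compl
  have hc2 : IsClosed (Icc θ q ∩ Oᶜ) := isClosed_Icc.inter hO.isClosed_compl
  have hb1 : BddAbove (Icc p θ ∩ Oᶜ) := bddAbove_Icc.mono inter_subset_left
  have hb2 : BddBelow (Icc θ q ∩ Oᶜ) := bddBelow_Icc.mono inter_subset_left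
  have hx := hc1.csSup_mem ⟨p, ⟨le_rfl, hpθ⟩, hp⟩ hb1
  have hy := hc2.csInf_mem ⟨q, ⟨hθq, le_rfl⟩, hq⟩ hb2
  have hxθ : sSup (Icc p θ ∩ Oᶜ) < θ := lt_of_le_of_ne hx.1.2 fun h =>
    hx.2 (mem_of_eq_of_mem h hθ)
  have hθy : θ < sInf (Icc θ q ∩ Oᶜ) := lt_of_le_of_ne hy.1.1 fun h =>
    hy.2 (mem_of_eq_of_mem h.symm hθ)
  refine ⟨_, _, hx.1.1, hy.1.2, ⟨hxθ, hθy⟩, fun z hz => ?_, hx.2, hy.2⟩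
  by_contra hzO
  rcases le_total z θ with h | h
  · exact absurd (le_csSup hb1 ⟨⟨hx.1.1.trans hz.1.le, h⟩, hzO⟩) hz.1.not_ge
  · exact absurd (csInf_le hb2 ⟨⟨h, hz.2.le.trans hy.1.2⟩, hzO⟩) hz.2.not_ge

/-- Two components of a set that meet are equal. -/
theorem component_unique {O : Set ℝ} {x y x' y' θ : ℝ} (hθ : θ ∈ Ioo x y) (hθ' : θ ∈ Ioo x' y')
    (h : Ioo x y ⊆ O) (hx : x ∉ O) (hy : y ∉ O) (h' : Ioo x' y' ⊆ O) (hx' : x' ∉ O)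
    (hy' : y' ∉ O) : x = x' ∧ y = y' := by
  constructor
  · refine le_antisymm ?_ ?_
    · by_contra! hcon
      exact hx (h' ⟨hcon, hθ.1.trans hθ'.2⟩)
    · by_contra! hcon
      exact hx' (h ⟨hcon, hθ'.1.trans hθ.2⟩)
  · refine le_antisymm ?_ ?_
    · by_contra! hcon
      exact hy' (h ⟨hθ.1.trans hθ'.2, hcon⟩)
    · by_contra! hcon
      exact hy (h' ⟨hθ'.1.trans hθ.2, hcon⟩)

/-- A function that vanishes off an open set and has integral zero on each of its components has
integral zero. -/
theorem integral_eq_zero_of_components {O : Set ℝ} (hO : IsOpen O) {p q : ℝ} (hpq : p ≤ q)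
    (hp : p ∉ O) (hq : q ∉ O) {g : ℝ → ℝ} (hg : IntervalIntegrable g volume p q)
    (h0 : ∀ᵐ x, x ∈ Ioo p q → x ∉ O → g x = 0)
    (hI : ∀ x y, p ≤ x → x < y → y ≤ q → Ioo x y ⊆ O → x ∉ O → y ∉ O → ∫ z in x..y, g z = 0) :
    ∫ z in p..q, g z = 0 := by
  set T : Set (ℝ × ℝ) := {t | p ≤ t.1 ∧ t.1 < t.2 ∧ t.2 ≤ q ∧ Ioo t.1 t.2 ⊆ O ∧ t.1 ∉ O ∧ t.2 ∉ O}
  have hdisj : T.PairwiseDisjoint fun t => Ioo t.1 t.2 := by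
    intro t ht t' ht' hne
    refine Set.disjoint_left.2 fun θ hθ hθ' => hne ?_
    obtain ⟨-, -, -, h1, h2, h3⟩ := ht
    obtain ⟨-, -, -, h1', h2', h3'⟩ := ht'
    obtain ⟨e1, e2⟩ := component_unique hθ hθ' h1 h2 h3 h1' h2' h3'
    exact Prod.ext e1 e2
  -- Countability of the components permits summing the integral over them.
  have hcount : T.Countable := hdisj.countable_of_isOpen (fun _ _ => isOpen_Ioo)
    fun t ht => nonempty_Ioo.2 ht.2.1
  have hU : ⋃ t : T, Ioo t.1.1 t.1.2 = Ioo p q ∩ O := by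
    ext θ
    simp only [mem_iUnion, Subtype.exists, exists_prop]
    constructor
    · rintro ⟨t, ht, hθ⟩
      exact ⟨⟨ht.1.trans_lt hθ.1, hθ.2.trans_le ht.2.2.1⟩, ht.2.2.2.1 hθ⟩
    · rintro ⟨hθ, hθO⟩
      obtain ⟨x, y, hx, hy, hxy, h1, h2, h3⟩ := hO.exists_component hp hq hθO hθ.1.le hθ.2.le
      exact ⟨(x, y), ⟨hx, hxy.1.trans hxy.2, hy, h1, h2, h3⟩, hxy⟩
  have hgI : IntegrableOn g (Ioo p q) := (intervalIntegrable_iff_integrableOn_Ioo_of_le hpq).1 hg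
  have := hcount.to_subtype
  have hsum := hasSum_integral_iUnion (μ := volume) (f := g) (s := fun t : T => Ioo t.1.1 t.1.2)
    (fun _ => measurableSet_Ioo) (fun t t' hne => hdisj t.2 t'.2 fun h => hne (Subtype.ext h))
    (by rw [hU]; exact hgI.mono_set inter_subset_left)
  have hz : ∀ t : T, ∫ x in Ioo t.1.1 t.1.2, g x = 0 := by
    rintro ⟨t, ht⟩
    rw [← hI t.1 t.2 ht.1 ht.2.1 ht.2.2.1 ht.2.2.2.1 ht.2.2.2.2.1 ht.2.2.2.2.2,
      intervalIntegral.integral_of_le ht.2.1.le, restrict_Ioo_eq_restrict_Ioc]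
  simp only [hz, hU] at hsum
  rw [intervalIntegral.integral_of_le hpq, ← restrict_Ioo_eq_restrict_Ioc,
    ← integral_inter_add_sdiff hO.measurableSet hgI, hsum.unique hasSum_zero, zero_add]
  refine setIntegral_eq_zero_of_ae_eq_zero ?_
  filter_upwards [h0] with x hx hxm using hx hxm.1 hxm.2

/-! ### Integrals controlled on open intervals -/

section Ioo

variable {p q : ℝ} {f g : ℝ → ℝ}

theorem integral_congr_Ioo (hpq : p ≤ q) (h : ∀ x ∈ Ioo p q, f x = g x) :
    ∫ x in p..q, f x = ∫ x in p..q, g x := by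
  rw [intervalIntegral.integral_of_le hpq, intervalIntegral.integral_of_le hpq,
    ← restrict_Ioo_eq_restrict_Ioc]
  exact setIntegral_congr_fun measurableSet_Ioo h

theorem integral_nonneg_Ioo (hpq : p ≤ q) (h : ∀ x ∈ Ioo p q, 0 ≤ f x) :
    0 ≤ ∫ x in p..q, f x := by
  rw [intervalIntegral.integral_of_le hpq, ← restrict_Ioo_eq_restrict_Ioc]
  exact setIntegral_nonneg measurableSet_Ioo h

theorem ae_eq_zero_of_integral_eq_zero_Ioo (hpq : p ≤ q) (hf : IntervalIntegrable f volume p q)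
    (h : ∀ x ∈ Ioo p q, 0 ≤ f x) (h0 : ∫ x in p..q, f x = 0) :
    ∀ᵐ x, x ∈ Ioo p q → f x = 0 := by
  rw [intervalIntegral.integral_of_le hpq, ← restrict_Ioo_eq_restrict_Ioc,
    setIntegral_eq_zero_iff_of_nonneg_ae ((ae_restrict_iff' measurableSet_Ioo).2
      (Filter.Eventually.of_forall h))
    ((intervalIntegrable_iff_integrableOn_Ioo_of_le hpq).1 hf)] at h0
  exact (ae_restrict_iff' measurableSet_Ioo).1 h0

theorem exists_mem_Ioo_of_ae {Q : ℝ → Prop} (hpq : p < q) (h : ∀ᵐ x, x ∈ Ioo p q → Q x) :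
    ∃ x ∈ Ioo p q, Q x := by
  by_contra! hcon
  have hsub : Ioo p q ⊆ {x | ¬ (x ∈ Ioo p q → Q x)} := fun x hx hxQ => hcon x hx (hxQ hx)
  have h0 : volume (Ioo p q) = 0 := measure_mono_null hsub (ae_iff.1 h)
  rw [Real.volume_Ioo, ENNReal.ofReal_eq_zero] at h0
  linarith

theorem AntitoneOn.intervalIntegrable_mul (hpq : p ≤ q) (hf : AntitoneOn f (Icc p q))
    (hg : IntervalIntegrable g volume p q) :
    IntervalIntegrable (fun x => f x * g x) volume p q := by
  rw [intervalIntegrable_iff_integrableOn_Icc_of_le hpq] at hg ⊢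
  refine Integrable.bdd_mul (c := max |f p| |f q|) hg
    (hf.integrableOn_isCompact isCompact_Icc).aestronglyMeasurable ?_
  refine (ae_restrict_iff' measurableSet_Icc).2 (Filter.Eventually.of_forall fun x hx => ?_)
  rw [Real.norm_eq_abs, max_comm]
  exact abs_le_max_abs_abs (hf hx (right_mem_Icc.2 hpq) hx.2) (hf (left_mem_Icc.2 hpq) hx hx.1)

end Ioo

/-- A function whose increments over `[x, y]` are at most `(a x - a y) * (y - x)` is constant. -/
theorem eq_of_abs_sub_le {D a : ℝ → ℝ} {p q : ℝ} (hpq : p ≤ q)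
    (hD : ∀ x ∈ Icc p q, ∀ y ∈ Icc p q, x ≤ y → |D y - D x| ≤ (a x - a y) * (y - x)) :
    D q = D p := by
  -- Bisection: the two halves have half the length while the increments of `a` add up, so each
  -- round halves the bound.
  have key : ∀ n : ℕ, ∀ x ∈ Icc p q, ∀ y ∈ Icc p q, x ≤ y →
      |D y - D x| ≤ (a x - a y) * (y - x) * (1 / 2) ^ n := by
    intro n
    induction n with
    | zero => intro x hx y hy hxy; simpa using hD x hx y hy hxy
    | succ n ih =>
      intro x hx y hy hxy
      have hm : (x + y) / 2 ∈ Icc p q := ⟨by linarith [hx.1, hy.1], by linarith [hx.2, hy.2]⟩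
      have h1 := ih x hx _ hm (by linarith)
      have h2 := ih _ hm y hy (by linarith)
      have h3 := abs_sub_le (D y) (D ((x + y) / 2)) (D x)
      have e1 : (x + y) / 2 - x = (y - x) / 2 := by ring
      have e2 : y - (x + y) / 2 = (y - x) / 2 := by ring
      rw [e1] at h1
      rw [e2] at h2
      rw [pow_succ]
      linarith
  have hlim : Filter.Tendsto (fun n : ℕ => (a p - a q) * (q - p) * (1 / 2 : ℝ) ^ n) Filter.atTop
      (nhds ((a p - a q) * (q - p) * 0)) :=
    (tendsto_pow_atTop_nhds_zero_of_lt_one (by norm_num) (by norm_num)).const_mul _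
  have h0 := ge_of_tendsto' hlim fun n =>
    key n p (left_mem_Icc.2 hpq) q (right_mem_Icc.2 hpq) hpq
  rw [mul_zero] at h0
  exact sub_eq_zero.1 (abs_nonpos_iff.1 h0)

/-! ### The concave envelope of a continuous function on a compact interval -/

section Envelope

variable {l h : ℝ} {G : ℝ → ℝ}

theorem concaveOn_affine (S : Set ℝ) (hS : Convex ℝ S) (σ m : ℝ) :
    ConcaveOn ℝ S fun z => σ * z + m := by
  refine ⟨hS, fun x _ y _ a b _ _ hab => le_of_eq ?_⟩
  simp only [smul_eq_mul]
  linear_combination m * hab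

theorem concaveEnvelope_le {S : Set ℝ} {H : ℝ → ℝ} (hH : ConcaveOn ℝ S H)
    (hGH : ∀ z ∈ S, G z ≤ H z) {x : ℝ} (hx : x ∈ S) : concaveEnvelope S G x ≤ H x :=
  csInf_le ⟨G x, by rintro _ ⟨H', -, h', rfl⟩; exact h' x hx⟩ ⟨H, hH, hGH, rfl⟩

/-- Makes the set in `concaveEnvelope` non-empty; on an empty set `sInf` would take its default
value `0`. -/
theorem exists_concave_majorant (hG : ContinuousOn G (Icc l h)) :
    ∃ H : ℝ → ℝ, ConcaveOn ℝ (Icc l h) H ∧ ∀ z ∈ Icc l h, G z ≤ H z := by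
  obtain ⟨C, hC⟩ := isCompact_Icc.bddAbove_image hG
  exact ⟨fun _ => C, concaveOn_const C (convex_Icc l h), fun z hz => hC (mem_image_of_mem G hz)⟩

theorem le_concaveEnvelope_of {c x : ℝ} (hG : ContinuousOn G (Icc l h))
    (hc : ∀ H : ℝ → ℝ, ConcaveOn ℝ (Icc l h) H → (∀ z ∈ Icc l h, G z ≤ H z) → c ≤ H x) :
    c ≤ concaveEnvelope (Icc l h) G x := by
  obtain ⟨H, hH⟩ := exists_concave_majorant hG
  exact le_csInf ⟨H x, H, hH.1, hH.2, rfl⟩ (by rintro _ ⟨H', h1, h2, rfl⟩; exact hc H' h1 h2)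

theorem le_concaveEnvelope {x : ℝ} (hG : ContinuousOn G (Icc l h)) (hx : x ∈ Icc l h) :
    G x ≤ concaveEnvelope (Icc l h) G x :=
  le_concaveEnvelope_of hG fun _ _ h2 => h2 x hx

theorem concaveOn_concaveEnvelope (hG : ContinuousOn G (Icc l h)) :
    ConcaveOn ℝ (Icc l h) (concaveEnvelope (Icc l h) G) := by
  refine ⟨convex_Icc l h, fun x hx y hy a b ha hb hab => ?_⟩
  refine le_concaveEnvelope_of hG fun H hH hGH => le_trans ?_ (hH.2 hx hy ha hb hab)
  simp only [smul_eq_mul]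
  gcongr
  exacts [concaveEnvelope_le hH hGH hx, concaveEnvelope_le hH hGH hy]

theorem concaveEnvelope_le_affine {σ m x : ℝ} (hGm : ∀ z ∈ Icc l h, G z ≤ σ * z + m)
    (hx : x ∈ Icc l h) : concaveEnvelope (Icc l h) G x ≤ σ * x + m :=
  concaveEnvelope_le (concaveOn_affine _ (convex_Icc l h) σ m) hGm hx

/-- Near `e` continuity suffices, and at distance at least `δ` a steep enough cone exceeds the upper
bound `B`. At an end point of the interval the cone is a line, hence a concave majorant almost
touching `G`. -/
theorem exists_le_add_mul_abs (hG : ContinuousOn G (Icc l h)) {e ε : ℝ} (he : e ∈ Icc l h)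
    (hε : 0 < ε) : ∃ C, ∀ z ∈ Icc l h, G z ≤ G e + ε + C * |z - e| := by
  obtain ⟨B, hB⟩ := isCompact_Icc.bddAbove_image hG
  obtain ⟨δ, hδ, hδ'⟩ := Metric.continuousWithinAt_iff.1 (hG e he) ε hε
  have hBe : G e ≤ B := hB (mem_image_of_mem G he)
  refine ⟨(B - G e) / δ, fun z hz => ?_⟩
  have h0 : 0 ≤ (B - G e) / δ := div_nonneg (by linarith) hδ.le
  rcases lt_or_ge |z - e| δ with hlt | hge
  · have := hδ' hz (by rwa [Real.dist_eq])
    rw [Real.dist_eq] at this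
    have := (abs_lt.1 this).2
    have := mul_nonneg h0 (abs_nonneg (z - e))
    linarith
  · have h1 : (B - G e) / δ * δ ≤ (B - G e) / δ * |z - e| := mul_le_mul_of_nonneg_left hge h0
    rw [div_mul_cancel₀ _ hδ.ne'] at h1
    linarith [hB (mem_image_of_mem G hz)]

theorem concaveEnvelope_left_le (hG : ContinuousOn G (Icc l h)) (hlh : l ≤ h) {ε : ℝ}
    (hε : 0 < ε) : ∃ C, ∀ z ∈ Icc l h, concaveEnvelope (Icc l h) G z ≤ G l + ε + C * (z - l) := by
  obtain ⟨C, hC⟩ := exists_le_add_mul_abs hG (left_mem_Icc.2 hlh) hε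
  refine ⟨C, fun z hz => ?_⟩
  have := concaveEnvelope_le_affine (G := G) (σ := C) (m := G l + ε - C * l) (fun z hz => ?_) hz
  · linarith
  · have := hC z hz
    rw [abs_of_nonneg (by linarith [hz.1])] at this
    linarith

theorem concaveEnvelope_right_le (hG : ContinuousOn G (Icc l h)) (hlh : l ≤ h) {ε : ℝ}
    (hε : 0 < ε) : ∃ C, ∀ z ∈ Icc l h, concaveEnvelope (Icc l h) G z ≤ G h + ε + C * (h - z) := by
  obtain ⟨C, hC⟩ := exists_le_add_mul_abs hG (right_mem_Icc.2 hlh) hε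
  refine ⟨C, fun z hz => ?_⟩
  have := concaveEnvelope_le_affine (G := G) (σ := -C) (m := G h + ε + C * h) (fun z hz => ?_) hz
  · linarith
  · have := hC z hz
    rw [abs_of_nonpos (by linarith [hz.2])] at this
    linarith

theorem concaveEnvelope_left (hG : ContinuousOn G (Icc l h)) (hlh : l ≤ h) :
    concaveEnvelope (Icc l h) G l = G l := by
  refine le_antisymm (le_of_forall_pos_le_add fun ε hε => ?_)
    (le_concaveEnvelope hG (left_mem_Icc.2 hlh))
  obtain ⟨C, hC⟩ := concaveEnvelope_left_le hG hlh hε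
  simpa using hC l (left_mem_Icc.2 hlh)

theorem concaveEnvelope_right (hG : ContinuousOn G (Icc l h)) (hlh : l ≤ h) :
    concaveEnvelope (Icc l h) G h = G h := by
  refine le_antisymm (le_of_forall_pos_le_add fun ε hε => ?_)
    (le_concaveEnvelope hG (right_mem_Icc.2 hlh))
  obtain ⟨C, hC⟩ := concaveEnvelope_right_le hG hlh hε
  simpa using hC h (right_mem_Icc.2 hlh)

/-- Concavity alone does not give continuity at an end point. Here cones with apex `E e + ε` bound
`E` from above and the continuous `G` bounds it from below. -/
theorem continuousWithinAt_of_squeeze {E : ℝ → ℝ} {S : Set ℝ} {e : ℝ}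
    (hup : ∀ ε > 0, ∃ C, ∀ z ∈ S, E z ≤ E e + ε + C * |z - e|) (hlow : ∀ z ∈ S, G z ≤ E z)
    (hGc : ContinuousWithinAt G S e) (he : G e = E e) : ContinuousWithinAt E S e := by
  rw [Metric.continuousWithinAt_iff]
  intro ε hε
  obtain ⟨C, hC⟩ := hup (ε / 2) (half_pos hε)
  obtain ⟨δ, hδ, hδ'⟩ := Metric.continuousWithinAt_iff.1 hGc ε hε
  refine ⟨min δ (ε / (2 * (|C| + 1))), lt_min hδ (by positivity), fun {z} hz hd => ?_⟩
  have h1 := hδ' hz (hd.trans_le (min_le_left _ _))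
  have h2 := hd.trans_le (min_le_right _ _)
  rw [Real.dist_eq] at h1 h2 ⊢
  rw [lt_div_iff₀ (by positivity)] at h2
  have h3 : C * |z - e| ≤ |C| * |z - e| := mul_le_mul_of_nonneg_right (le_abs_self C) (abs_nonneg _)
  have := hC z hz
  have := hlow z hz
  rw [abs_lt] at h1 ⊢
  have := abs_nonneg (z - e)
  constructor
  · linarith
  · nlinarith

theorem continuousOn_concaveEnvelope (hG : ContinuousOn G (Icc l h)) (hlh : l ≤ h) :
    ContinuousOn (concaveEnvelope (Icc l h) G) (Icc l h) := by
  intro x hx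
  by_cases hl : x = l
  · subst hl
    refine continuousWithinAt_of_squeeze (G := G) (fun ε hε => ?_)
      (fun z hz => le_concaveEnvelope hG hz) (hG x hx) (concaveEnvelope_left hG hlh).symm
    obtain ⟨C, hC⟩ := concaveEnvelope_left_le hG hlh hε
    refine ⟨C, fun z hz => ?_⟩
    rw [concaveEnvelope_left hG hlh, abs_of_nonneg (by linarith [hz.1])]
    exact hC z hz
  by_cases hr : x = h
  · subst hr
    refine continuousWithinAt_of_squeeze (G := G) (fun ε hε => ?_)
      (fun z hz => le_concaveEnvelope hG hz) (hG x hx) (concaveEnvelope_right hG hlh).symm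
    obtain ⟨C, hC⟩ := concaveEnvelope_right_le hG hlh hε
    refine ⟨C, fun z hz => ?_⟩
    rw [concaveEnvelope_right hG hlh, abs_of_nonpos (by linarith [hz.2]), neg_sub]
    exact hC z hz
  · have hxI : x ∈ interior (Icc l h) := by
      rw [interior_Icc]
      exact ⟨lt_of_le_of_ne hx.1 (Ne.symm hl), lt_of_le_of_ne hx.2 hr⟩
    exact ((concaveOn_concaveEnvelope hG).continuousOn_interior.continuousAt
      (isOpen_interior.mem_nhds hxI)).continuousWithinAt

theorem exists_le_sub_of_lt {A : Set ℝ} (hA : IsCompact A) {σ m : ℝ} (hG : ContinuousOn G A)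
    (hlt : ∀ z ∈ A, G z < σ * z + m) : ∃ δ > 0, ∀ z ∈ A, G z ≤ σ * z + m - δ := by
  rcases A.eq_empty_or_nonempty with rfl | hne
  · exact ⟨1, one_pos, by simp⟩
  obtain ⟨c, hc, hmin⟩ := hA.exists_isMinOn hne (f := fun z => σ * z + m - G z)
    (by fun_prop)
  refine ⟨σ * c + m - G c, by linarith [hlt c hc], fun z hz => ?_⟩
  have : σ * c + m - G c ≤ σ * z + m - G z := hmin hz
  linarith

/-- By compactness there is a slack `δ` on `[l, c]`. It allows the line to be tilted about its point
over `c`: the tilted line still majorizes `G` and is strictly lower before `c`. Any tilt `η > 0`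
with `η * (c - l) ≤ δ` works. -/
theorem concaveEnvelope_lt_affine_left (hG : ContinuousOn G (Icc l h)) {σ m c x : ℝ}
    (hc : c ∈ Icc l h) (hGm : ∀ z ∈ Icc l h, G z ≤ σ * z + m)
    (hlt : ∀ z ∈ Icc l c, G z < σ * z + m) (hx : x ∈ Ico l c) :
    concaveEnvelope (Icc l h) G x < σ * x + m := by
  have hsub : Icc l c ⊆ Icc l h := Icc_subset_Icc_right hc.2
  obtain ⟨δ, hδ, hδ'⟩ := exists_le_sub_of_lt isCompact_Icc (hG.mono hsub) hlt
  have hd : 0 < c - l + 1 := by linarith [hc.1]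
  have hη : 0 < δ / (c - l + 1) := by positivity
  set η := δ / (c - l + 1) with hηdef
  have hηδ : η * (c - l) + η = δ := by rw [hηdef]; field_simp
  have := concaveEnvelope_le_affine (G := G) (l := l) (h := h) (σ := σ + η) (m := m - η * c) (x := x)
    (fun z hz => ?_) ⟨hx.1, hx.2.le.trans hc.2⟩
  · nlinarith [hx.2]
  · rcases le_total z c with h1 | h1
    · have := hδ' z ⟨hz.1, h1⟩
      nlinarith [hz.1]
    · nlinarith [hGm z hz]

theorem concaveEnvelope_lt_affine_right (hG : ContinuousOn G (Icc l h)) {σ m c x : ℝ}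
    (hc : c ∈ Icc l h) (hGm : ∀ z ∈ Icc l h, G z ≤ σ * z + m)
    (hlt : ∀ z ∈ Icc c h, G z < σ * z + m) (hx : x ∈ Ioc c h) :
    concaveEnvelope (Icc l h) G x < σ * x + m := by
  have hsub : Icc c h ⊆ Icc l h := Icc_subset_Icc_left hc.1
  obtain ⟨δ, hδ, hδ'⟩ := exists_le_sub_of_lt isCompact_Icc (hG.mono hsub) hlt
  have hd : 0 < h - c + 1 := by linarith [hc.2]
  have hη : 0 < δ / (h - c + 1) := by positivity
  set η := δ / (h - c + 1) with hηdef
  have hηδ : η * (h - c) + η = δ := by rw [hηdef]; field_simp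
  have := concaveEnvelope_le_affine (G := G) (l := l) (h := h) (σ := σ - η) (m := m + η * c) (x := x)
    (fun z hz => ?_) ⟨hc.1.trans hx.1.le, hx.2⟩
  · nlinarith [hx.1]
  · rcases le_total c z with h1 | h1
    · have := hδ' z ⟨h1, hz.2⟩
      nlinarith [hz.2]
    · nlinarith [hGm z hz]

/-- The concave envelope is affine wherever it exceeds the function. -/
theorem concaveEnvelope_affine_of_lt (hG : ContinuousOn G (Icc l h)) {x y : ℝ} (hx : l ≤ x)
    (hxy : x < y) (hy : y ≤ h) (hgap : ∀ z ∈ Ioo x y, G z < concaveEnvelope (Icc l h) G z) :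
    ∃ σ m, ∀ z ∈ Icc x y, concaveEnvelope (Icc l h) G z = σ * z + m := by
  set E := concaveEnvelope (Icc l h) G with hE
  have hconc := concaveOn_concaveEnvelope hG
  obtain ⟨p, hp⟩ := nonempty_Ioo.2 hxy
  have hpI : p ∈ interior (Icc l h) := by
    rw [interior_Icc]; exact ⟨hx.trans_lt hp.1, hp.2.trans_le hy⟩
  set σ := leftDeriv E p
  set m := E p - σ * p with hm
  have hline : ∀ z ∈ Icc l h, E z ≤ σ * z + m := fun z hz => by
    have := hconc.le_add_leftDeriv_mul hpI hz
    linarith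
  have hGline : ∀ z ∈ Icc l h, G z ≤ σ * z + m := fun z hz =>
    (le_concaveEnvelope hG hz).trans (hline z hz)
  have hgapline : ∀ z ∈ Ioo x y, G z < σ * z + m := fun z hz =>
    (hgap z hz).trans_le (hline z ⟨hx.trans hz.1.le, hz.2.le.trans hy⟩)
  have hpline : E p = σ * p + m := by rw [hm]; ring
  -- A supporting line at `p` meets `E` on both sides of the gap: if it missed `E` on `[l, x]`, then
  -- `G` would be strictly below it up to some `c > p`, and tilting would push `E p` below the line.
  -- Between the two contact points, concavity forces `E` onto the line.
  obtain ⟨u, hu, hux⟩ : ∃ u ∈ Icc l x, E u = σ * u + m := by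
    by_contra! hcon
    obtain ⟨c, hc⟩ := nonempty_Ioo.2 hp.2
    refine absurd hpline (concaveEnvelope_lt_affine_left hG (c := c)
      ⟨hx.trans (hp.1.le.trans hc.1.le), hc.2.le.trans hy⟩ hGline (fun z hz => ?_)
      ⟨hx.trans hp.1.le, hc.1⟩).ne
    rcases le_or_gt z x with h1 | h1
    · have hzI : z ∈ Icc l h := ⟨hz.1, h1.trans (hxy.le.trans hy)⟩
      exact (le_concaveEnvelope hG hzI).trans_lt (lt_of_le_of_ne (hline z hzI) (hcon z ⟨hz.1, h1⟩))
    · exact hgapline z ⟨h1, hz.2.trans_lt hc.2⟩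
  obtain ⟨v, hv, hvy⟩ : ∃ v ∈ Icc y h, E v = σ * v + m := by
    by_contra! hcon
    obtain ⟨c, hc⟩ := nonempty_Ioo.2 hp.1
    refine absurd hpline (concaveEnvelope_lt_affine_right hG (c := c)
      ⟨hx.trans hc.1.le, hc.2.le.trans (hp.2.le.trans hy)⟩ hGline (fun z hz => ?_)
      ⟨hc.2, hp.2.le.trans hy⟩).ne
    rcases lt_or_ge z y with h1 | h1
    · exact hgapline z ⟨hc.1.trans_le hz.1, h1⟩
    · have hzI : z ∈ Icc l h := ⟨(hx.trans hxy.le).trans h1, hz.2⟩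
      exact (le_concaveEnvelope hG hzI).trans_lt (lt_of_le_of_ne (hline z hzI) (hcon z ⟨h1, hz.2⟩))
  refine ⟨σ, m, fun z hz => le_antisymm
    (hline z ⟨hx.trans hz.1, hz.2.trans hy⟩) ?_⟩
  have huI : u ∈ Icc l h := ⟨hu.1, hu.2.trans (hxy.le.trans hy)⟩
  have hvI : v ∈ Icc l h := ⟨(hx.trans hxy.le).trans hv.1, hv.2⟩
  have huz : u ≤ z := hu.2.trans hz.1
  have hzv : z ≤ v := hz.2.trans hv.1
  have huv : 0 < v - u := by linarith [hu.2, hv.1]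
  have h := hconc.2 huI hvI (div_nonneg (sub_nonneg.2 hzv) huv.le)
    (div_nonneg (sub_nonneg.2 huz) huv.le) (by field_simp; ring)
  simp only [smul_eq_mul] at h
  have e1 : (v - z) / (v - u) * u + (z - u) / (v - u) * v = z := by field_simp; ring
  rw [e1, ← hE, hux, hvy] at h
  refine le_trans (le_of_eq ?_) h
  field_simp
  ring

end Envelope

namespace InnerProgram

/-- The standing assumptions on the data. -/
structure Regular (P : InnerProgram) : Prop where
  lo_pos : 0 < P.lo
  lt : P.lo < P.hi
  f_pos : ∀ θ ∈ P.types, 0 < P.f θ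
  f_int : IntervalIntegrable P.f volume P.lo P.hi
  f_one : (∫ θ in P.lo..P.hi, P.f θ) = 1
  R_concave : ConcaveOn ℝ P.types P.R
  R_mono : MonotoneOn P.R P.types
  R_nonneg : 0 ≤ P.R P.lo

namespace Regular

variable {P : InnerProgram}

/-! ### The weight `W`, its primitive and the envelope -/

theorem lo_mem (hP : P.Regular) : P.lo ∈ P.types := left_mem_Icc.2 hP.lt.le

theorem hi_mem (hP : P.Regular) : P.hi ∈ P.types := right_mem_Icc.2 hP.lt.le

theorem uIcc_eq (hP : P.Regular) : uIcc P.lo P.hi = P.types := uIcc_of_le hP.lt.le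

theorem uIcc_subset (hP : P.Regular) {p q : ℝ} (hp : p ∈ P.types) (hq : q ∈ P.types) :
    uIcc p q ⊆ uIcc P.lo P.hi := by
  rw [hP.uIcc_eq]
  exact ordConnected_Icc.uIcc_subset hp hq

theorem continuousOn_F (hP : P.Regular) : ContinuousOn P.F P.types := by
  have := intervalIntegral.continuousOn_primitive_interval' hP.f_int left_mem_uIcc
  rwa [hP.uIcc_eq] at this

theorem W_eq (hP : P.Regular) {θ : ℝ} (hθ : θ ∈ P.types) :
    P.W θ = P.wA * P.f θ - P.wB * (θ * P.f θ) + P.wB * (1 - P.F θ) := by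
  have := (hP.f_pos θ hθ).ne'
  rw [W]
  field_simp
  ring

theorem intervalIntegrable_id_mul_f (hP : P.Regular) :
    IntervalIntegrable (fun θ => θ * P.f θ) volume P.lo P.hi :=
  hP.f_int.continuousOn_mul continuousOn_id

theorem intervalIntegrable_one_sub_F (hP : P.Regular) :
    IntervalIntegrable (fun θ => 1 - P.F θ) volume P.lo P.hi := by
  refine ContinuousOn.intervalIntegrable ?_
  rw [hP.uIcc_eq]
  exact continuousOn_const.sub hP.continuousOn_F

theorem intervalIntegrable_W (hP : P.Regular) : IntervalIntegrable P.W volume P.lo P.hi := by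
  refine IntervalIntegrable.congr (fun θ hθ => (hP.W_eq ?_).symm)
    (((hP.f_int.const_mul P.wA).sub (hP.intervalIntegrable_id_mul_f.const_mul P.wB)).add
      (hP.intervalIntegrable_one_sub_F.const_mul P.wB))
  rw [← hP.uIcc_eq]
  exact uIoc_subset_uIcc hθ

theorem calW_lo : P.calW P.lo = 0 := intervalIntegral.integral_same

theorem continuousOn_calW (hP : P.Regular) : ContinuousOn P.calW P.types := by
  have := intervalIntegral.continuousOn_primitive_interval' hP.intervalIntegrable_W left_mem_uIcc
  rwa [hP.uIcc_eq] at this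

/-- The objective of the original program in terms of the mechanism. -/
theorem objective_W (hP : P.Regular) {a : ℝ → ℝ} (ha : AntitoneOn a P.types) (u : ℝ) :
    P.objective P.W a u = P.wA * (∫ θ in P.lo..P.hi, a θ * P.f θ) +
      P.wB * ∫ θ in P.lo..P.hi, (P.workload a u θ - θ * a θ) * P.f θ := by
  have hle := hP.lt.le
  have haI : IntervalIntegrable a volume P.lo P.hi :=
    AntitoneOn.intervalIntegrable (by rwa [hP.uIcc_eq])
  have i1 := AntitoneOn.intervalIntegrable_mul hle ha hP.f_int
  have i2 := AntitoneOn.intervalIntegrable_mul hle ha hP.intervalIntegrable_id_mul_f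
  have i3 := AntitoneOn.intervalIntegrable_mul hle ha hP.intervalIntegrable_one_sub_F
  have i4 : IntervalIntegrable (fun θ => a θ * P.F θ) volume P.lo P.hi := by
    refine AntitoneOn.intervalIntegrable_mul hle ha (ContinuousOn.intervalIntegrable ?_)
    rw [hP.uIcc_eq]
    exact hP.continuousOn_F
  have i5 : IntervalIntegrable (fun θ => (∫ z in P.lo..θ, a z) * P.f θ) volume P.lo P.hi :=
    hP.f_int.continuousOn_mul (intervalIntegral.continuousOn_primitive_interval' haI left_mem_uIcc)
  have e1 : ∫ θ in P.lo..P.hi, a θ * P.W θ =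
      P.wA * (∫ θ in P.lo..P.hi, a θ * P.f θ) - P.wB * (∫ θ in P.lo..P.hi, a θ * (θ * P.f θ)) +
        P.wB * ((∫ θ in P.lo..P.hi, a θ) - ∫ θ in P.lo..P.hi, a θ * P.F θ) := by
    rw [← intervalIntegral.integral_sub haI i4, ← intervalIntegral.integral_const_mul,
      ← intervalIntegral.integral_const_mul, ← intervalIntegral.integral_const_mul,
      ← intervalIntegral.integral_sub (i1.const_mul _) (i2.const_mul _),
      ← intervalIntegral.integral_add ((i1.const_mul _).sub (i2.const_mul _))
        ((haI.sub i4).const_mul _)]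
    refine integral_congr_Ioo hle fun θ hθ => ?_
    rw [hP.W_eq (Ioo_subset_Icc_self hθ)]
    ring
  have e2 : ∫ θ in P.lo..P.hi, (P.workload a u θ - θ * a θ) * P.f θ =
      u * (∫ θ in P.lo..P.hi, P.f θ) + (∫ θ in P.lo..P.hi, (∫ z in P.lo..θ, a z) * P.f θ) -
        ∫ θ in P.lo..P.hi, a θ * (θ * P.f θ) := by
    rw [← intervalIntegral.integral_const_mul,
      ← intervalIntegral.integral_add (hP.f_int.const_mul _) i5,
      ← intervalIntegral.integral_sub ((hP.f_int.const_mul _).add i5) i2]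
    refine integral_congr_Ioo hle fun θ _ => ?_
    simp only [workload]
    ring
  -- Integration by parts turns the expected rents into the `1 - F` term of the virtual weight.
  have e3 := integral_primitive_mul haI hP.f_int
  rw [objective, e1, e2, e3, hP.f_one]
  simp only [F]
  ring

/-- Evaluates the objective at `a = 1`, `u = lo`, where every workload equals `θ` and no task `B` is
assigned. -/
theorem calW_hi (hP : P.Regular) : P.calW P.hi = P.wA - P.wB * P.lo := by
  have h := hP.objective_W (a := fun _ => 1) antitoneOn_const P.lo
  have e : ∫ θ in P.lo..P.hi, (P.workload (fun _ => 1) P.lo θ - θ * 1) * P.f θ = 0 := by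
    simp [workload]
  simp only [one_mul, e, hP.f_one, objective] at h
  rw [calW]
  linarith

theorem concaveOn_calWbar (hP : P.Regular) : ConcaveOn ℝ P.types P.calWbar :=
  concaveOn_concaveEnvelope hP.continuousOn_calW

theorem continuousOn_calWbar (hP : P.Regular) : ContinuousOn P.calWbar P.types :=
  continuousOn_concaveEnvelope hP.continuousOn_calW hP.lt.le

theorem calW_le_calWbar (hP : P.Regular) {θ : ℝ} (hθ : θ ∈ P.types) : P.calW θ ≤ P.calWbar θ :=
  le_concaveEnvelope hP.continuousOn_calW hθ

theorem calWbar_lo_eq_calW (hP : P.Regular) : P.calWbar P.lo = P.calW P.lo :=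
  concaveEnvelope_left hP.continuousOn_calW hP.lt.le

theorem calWbar_hi_eq_calW (hP : P.Regular) : P.calWbar P.hi = P.calW P.hi :=
  concaveEnvelope_right hP.continuousOn_calW hP.lt.le

theorem calWbar_lo (hP : P.Regular) : P.calWbar P.lo = 0 := hP.calWbar_lo_eq_calW.trans calW_lo

theorem calWbar_hi (hP : P.Regular) : P.calWbar P.hi = P.wA - P.wB * P.lo :=
  hP.calWbar_hi_eq_calW.trans hP.calW_hi

theorem interior_types {θ : ℝ} (hθ : θ ∈ Ioo P.lo P.hi) : θ ∈ interior P.types := by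
  rwa [types, interior_Icc]

theorem calWbar_le_tangent (hP : P.Regular) {θ z : ℝ} (hθ : θ ∈ Ioo P.lo P.hi)
    (hz : z ∈ P.types) : P.calWbar z ≤ P.calWbar θ + P.Wbar θ * (z - θ) :=
  hP.concaveOn_calWbar.le_add_leftDeriv_mul (interior_types hθ) hz

theorem antitoneOn_Wbar (hP : P.Regular) : AntitoneOn P.Wbar (Ioo P.lo P.hi) := by
  have := hP.concaveOn_calWbar.antitoneOn_leftDeriv
  rwa [types, interior_Icc] at this

theorem intervalIntegrable_Wbar (hP : P.Regular) {p q : ℝ} (hp : p ∈ P.types) (hq : q ∈ P.types) :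
    IntervalIntegrable P.Wbar volume p q :=
  (hP.concaveOn_calWbar.intervalIntegrable_leftDeriv hP.lt.le hP.continuousOn_calWbar).mono_set
    (hP.uIcc_subset hp hq)

theorem integral_Wbar (hP : P.Regular) {p q : ℝ} (hp : p ∈ P.types) (hq : q ∈ P.types)
    (hpq : p ≤ q) : ∫ z in p..q, P.Wbar z = P.calWbar q - P.calWbar p := by
  have hsub : Icc p q ⊆ P.types := Icc_subset_Icc hp.1 hq.2
  exact (hP.concaveOn_calWbar.subset hsub (convex_Icc p q)).integral_leftDeriv hpq
    (hP.continuousOn_calWbar.mono hsub)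

/-! ### Allocations -/

theorem intervalIntegrable_of_antitoneOn (hP : P.Regular) {a : ℝ → ℝ} (ha : AntitoneOn a P.types)
    {p q : ℝ} (hp : p ∈ P.types) (hq : q ∈ P.types) : IntervalIntegrable a volume p q :=
  AntitoneOn.intervalIntegrable (ha.mono (by rw [← hP.uIcc_eq]; exact hP.uIcc_subset hp hq))

theorem workload_lo (a : ℝ → ℝ) (u : ℝ) : P.workload a u P.lo = u := by simp [workload]

theorem workload_sub (hP : P.Regular) {a : ℝ → ℝ} (ha : IntervalIntegrable a volume P.lo P.hi)
    (u : ℝ) {p q : ℝ} (hp : p ∈ P.types) (hq : q ∈ P.types) :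
    P.workload a u q - P.workload a u p = ∫ z in p..q, a z := by
  have h1 : IntervalIntegrable a volume P.lo p := ha.mono_set (hP.uIcc_subset hP.lo_mem hp)
  have h2 : IntervalIntegrable a volume p q := ha.mono_set (hP.uIcc_subset hp hq)
  rw [workload, workload, ← intervalIntegral.integral_add_adjacent_intervals h1 h2]
  ring

theorem continuousOn_workload (hP : P.Regular) {a : ℝ → ℝ}
    (ha : IntervalIntegrable a volume P.lo P.hi) (u : ℝ) :
    ContinuousOn (P.workload a u) P.types := by
  have := intervalIntegral.continuousOn_primitive_interval' ha left_mem_uIcc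
  rw [hP.uIcc_eq] at this
  exact continuousOn_const.add this

theorem workload_sub_le (hP : P.Regular) {a : ℝ → ℝ} (ha : AntitoneOn a P.types)
    (u : ℝ) {p q : ℝ} (hp : p ∈ P.types) (hq : q ∈ P.types) (hpq : p ≤ q) :
    P.workload a u q - P.workload a u p ≤ a p * (q - p) := by
  have hsub : Icc p q ⊆ P.types := Icc_subset_Icc hp.1 hq.2
  rw [hP.workload_sub (hP.intervalIntegrable_of_antitoneOn ha hP.lo_mem hP.hi_mem) u hp hq]
  have := intervalIntegral.integral_mono_on hpq (hP.intervalIntegrable_of_antitoneOn ha hp hq)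
    (intervalIntegrable_const (c := a p)) fun x hx => ha hp (hsub hx) hx.1
  simpa [mul_comm] using this

theorem le_workload_sub (hP : P.Regular) {a : ℝ → ℝ} (ha : AntitoneOn a P.types)
    (u : ℝ) {p q : ℝ} (hp : p ∈ P.types) (hq : q ∈ P.types) (hpq : p ≤ q) :
    a q * (q - p) ≤ P.workload a u q - P.workload a u p := by
  have hsub : Icc p q ⊆ P.types := Icc_subset_Icc hp.1 hq.2
  rw [hP.workload_sub (hP.intervalIntegrable_of_antitoneOn ha hP.lo_mem hP.hi_mem) u hp hq]
  have := intervalIntegral.integral_mono_on hpq (intervalIntegrable_const (c := a q))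
    (hP.intervalIntegrable_of_antitoneOn ha hp hq) fun x hx => ha (hsub hx) hq hx.2
  simpa [mul_comm] using this

/-- Non-negativity of task `B` at `lo` implies it at every type. -/
theorem originalFeasible_iff (hP : P.Regular) {a : ℝ → ℝ} {u : ℝ} :
    P.OriginalFeasible a u ↔ P.RelaxedFeasible a u := by
  constructor
  · intro h
    refine ⟨h.a_nonneg, h.u_nonneg, h.ic, h.ir, ?_⟩
    have := h.nn P.lo hP.lo_mem
    rwa [workload_lo] at this
  · intro h
    refine ⟨h.a_nonneg, h.u_nonneg, h.ic, h.ir, fun θ hθ => ?_⟩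
    -- The workload grows by at least `a θ * (θ - lo)`, and `u ≥ a lo * lo ≥ a θ * lo` covers the
    -- rest.
    have h1 := hP.le_workload_sub h.ic u hP.lo_mem hθ hθ.1
    rw [workload_lo] at h1
    have h2 := h.ic hP.lo_mem hθ hθ.1
    have h3 := h.nn
    nlinarith [hP.lo_pos]

theorem _root_.InnerProgram.RelaxedFeasible.le_div {a : ℝ → ℝ} {u : ℝ} (h : P.RelaxedFeasible a u)
    (hP : P.Regular) {θ : ℝ} (hθ : θ ∈ P.types) : a θ ≤ u / P.lo := by
  refine (h.ic hP.lo_mem hθ hθ.1).trans ?_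
  rw [le_div_iff₀ hP.lo_pos]
  linarith [h.nn]

theorem _root_.InnerProgram.RelaxedFeasible.u_le {a : ℝ → ℝ} {u : ℝ} (h : P.RelaxedFeasible a u)
    (hP : P.Regular) : u ≤ P.R P.lo := by
  have := h.ir P.lo hP.lo_mem
  rwa [workload_lo] at this

theorem _root_.InnerProgram.RelaxedFeasible.intervalIntegrable {a : ℝ → ℝ} {u : ℝ}
    (h : P.RelaxedFeasible a u) (hP : P.Regular) {p q : ℝ} (hp : p ∈ P.types) (hq : q ∈ P.types) :
    IntervalIntegrable a volume p q := hP.intervalIntegrable_of_antitoneOn h.ic hp hq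

theorem _root_.InnerProgram.RelaxedFeasible.workload_le {a : ℝ → ℝ} {u : ℝ}
    (h : P.RelaxedFeasible a u) (hP : P.Regular) {θ : ℝ} (hθ : θ ∈ P.types) :
    P.workload a u θ ≤ u / P.lo * θ := by
  have h1 := hP.workload_sub_le h.ic u hP.lo_mem hθ hθ.1
  rw [workload_lo] at h1
  have h2 := mul_le_mul_of_nonneg_right (h.le_div hP hP.lo_mem) (sub_nonneg.2 hθ.1)
  have h3 : u / P.lo * P.lo = u := div_mul_cancel₀ _ hP.lo_pos.ne'
  linarith

theorem zero_feasible (hP : P.Regular) : P.RelaxedFeasible (fun _ => 0) 0 :=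
  ⟨fun _ _ => le_rfl, le_rfl, antitoneOn_const, fun θ hθ => by
    simpa [workload] using hP.R_nonneg.trans (hP.R_mono hP.lo_mem hθ hθ.1), by simp⟩

/-! ### The support function -/

theorem feasibleMechanism_of_originalFeasible (hP : P.Regular) {a : ℝ → ℝ} {u : ℝ}
    (h : P.OriginalFeasible a u) :
    P.FeasibleMechanism a fun θ => P.workload a u θ - θ * a θ := by
  refine ⟨fun θ hθ => ⟨h.a_nonneg θ hθ, by linarith [h.nn θ hθ]⟩, fun θ hθ θ' hθ' => ?_,
    fun θ hθ => by linarith [h.ir θ hθ]⟩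
  rcases le_total θ θ' with hle | hle
  · linarith [hP.le_workload_sub h.ic u hθ hθ' hle]
  · linarith [hP.workload_sub_le h.ic u hθ' hθ hle]

theorem _root_.InnerProgram.FeasibleMechanism.antitoneOn {a b : ℝ → ℝ}
    (h : P.FeasibleMechanism a b) : AntitoneOn a P.types := by
  intro θ hθ θ' hθ' hle
  rcases hle.eq_or_lt with rfl | hlt
  · rfl
  have h1 := h.ic θ hθ θ' hθ'
  have h2 := h.ic θ' hθ' θ hθ
  nlinarith

/-- The envelope formula without derivatives: over `[x, y]` both sides have increments between `a y
* (y - x)` and `a x * (y - x)`, so `eq_of_abs_sub_le` applies to their difference. -/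
theorem _root_.InnerProgram.FeasibleMechanism.workload_eq {a b : ℝ → ℝ}
    (h : P.FeasibleMechanism a b) (hP : P.Regular) {θ : ℝ} (hθ : θ ∈ P.types) :
    P.workload a (P.lo * a P.lo + b P.lo) θ = θ * a θ + b θ := by
  have := eq_of_abs_sub_le (a := a) (p := P.lo) (q := θ)
    (D := fun z => P.workload a (P.lo * a P.lo + b P.lo) z - (z * a z + b z)) hθ.1 ?_
  · simp only [workload_lo] at this
    linarith
  intro x hx y hy hxy
  have hx' : x ∈ P.types := ⟨hx.1, hx.2.trans hθ.2⟩
  have hy' : y ∈ P.types := ⟨hy.1, hy.2.trans hθ.2⟩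
  have h1 := hP.workload_sub_le h.antitoneOn (P.lo * a P.lo + b P.lo) hx' hy' hxy
  have h2 := hP.le_workload_sub h.antitoneOn (P.lo * a P.lo + b P.lo) hx' hy' hxy
  have h3 := h.ic x hx' y hy'
  have h4 := h.ic y hy' x hx'
  rw [abs_le]
  constructor <;> linarith

theorem _root_.InnerProgram.FeasibleMechanism.originalFeasible {a b : ℝ → ℝ}
    (h : P.FeasibleMechanism a b) (hP : P.Regular) :
    P.OriginalFeasible a (P.lo * a P.lo + b P.lo) := by
  refine ⟨fun θ hθ => (h.nonneg θ hθ).1, ?_, h.antitoneOn, fun θ hθ => ?_, fun θ hθ => ?_⟩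
  · have := h.nonneg P.lo hP.lo_mem
    exact add_nonneg (mul_nonneg hP.lo_pos.le this.1) this.2
  · rw [h.workload_eq hP hθ]
    exact h.ir θ hθ
  · rw [h.workload_eq hP hθ]
    linarith [(h.nonneg θ hθ).2]

theorem supportValues_eq (hP : P.Regular) : P.supportValues = P.originalValues := by
  ext v
  constructor
  · rintro ⟨_, ⟨a, b, h, rfl⟩, rfl⟩
    refine ⟨a, _, h.originalFeasible hP, ?_⟩
    rw [hP.objective_W h.antitoneOn]
    congr 2
    refine integral_congr_Ioo hP.lt.le fun θ hθ => ?_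
    rw [h.workload_eq hP (Ioo_subset_Icc_self hθ)]
    ring
  · rintro ⟨a, u, h, rfl⟩
    exact ⟨_, ⟨a, _, hP.feasibleMechanism_of_originalFeasible h, rfl⟩, hP.objective_W h.ic u⟩

end Regular
end InnerProgram

namespace InnerProgram
namespace Regular

variable {P : InnerProgram}

/-! ### Ironing -/

/-- The set on which `𝒲` is below its concave envelope. -/
def _root_.InnerProgram.gapSet (P : InnerProgram) : Set ℝ :=
  {θ | θ ∈ Ioo P.lo P.hi ∧ P.calW θ < P.calWbar θ}

theorem isOpen_gapSet (hP : P.Regular) : IsOpen P.gapSet := by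
  have h1 := (hP.continuousOn_calWbar.sub hP.continuousOn_calW).mono
    (Ioo_subset_Icc_self (a := P.lo) (b := P.hi))
  have h2 := h1.isOpen_inter_preimage isOpen_Ioo (isOpen_Ioi (a := (0 : ℝ)))
  convert h2 using 1
  ext θ
  simp [gapSet]

theorem lo_notMem_gapSet : P.lo ∉ P.gapSet := fun h => lt_irrefl _ h.1.1

theorem hi_notMem_gapSet : P.hi ∉ P.gapSet := fun h => lt_irrefl _ h.1.2

theorem calWbar_eq_calW (hP : P.Regular) {θ : ℝ} (hθ : θ ∈ P.types) (h : θ ∉ P.gapSet) :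
    P.calWbar θ = P.calW θ := by
  rcases hθ.1.eq_or_lt with rfl | h1
  · exact hP.calWbar_lo_eq_calW
  rcases hθ.2.eq_or_lt with rfl | h2
  · exact hP.calWbar_hi_eq_calW
  · exact le_antisymm (not_lt.1 fun hlt => h ⟨⟨h1, h2⟩, hlt⟩) (hP.calW_le_calWbar hθ)

/-- An end point inside the open gap set could be moved outward, so maximal gaps are exactly the
components of `gapSet`. This makes the component lemmas available. -/
theorem isIroningInterval_iff (hP : P.Regular) {x y : ℝ} :
    P.IsIroningInterval x y ↔ P.lo ≤ x ∧ x < y ∧ y ≤ P.hi ∧ Ioo x y ⊆ P.gapSet ∧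
      x ∉ P.gapSet ∧ y ∉ P.gapSet := by
  constructor
  · rintro ⟨⟨h1, h2, h3, h4⟩, hmax⟩
    have hsub : Ioo x y ⊆ P.gapSet :=
      fun θ hθ => ⟨⟨h1.trans_lt hθ.1, hθ.2.trans_le h3⟩, h4 θ hθ⟩
    refine ⟨h1, h2, h3, hsub, fun hx => ?_, fun hy => ?_⟩
    · obtain ⟨x', y', hx', -, hxx, hs, -, -⟩ := hP.isOpen_gapSet.exists_component
        lo_notMem_gapSet hi_notMem_gapSet hx hx.1.1.le hx.1.2.le
      refine hxx.1.ne (hmax x' y hxx.1.le le_rfl ⟨hx', hxx.1.trans h2, h3, fun θ hθ => ?_⟩).1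
      rcases le_or_gt θ x with h | h
      · exact (hs ⟨hθ.1, h.trans_lt hxx.2⟩).2
      · exact h4 θ ⟨h, hθ.2⟩
    · obtain ⟨x', y', -, hy', hyy, hs, -, -⟩ := hP.isOpen_gapSet.exists_component
        lo_notMem_gapSet hi_notMem_gapSet hy hy.1.1.le hy.1.2.le
      refine hyy.2.ne' (hmax x y' le_rfl hyy.2.le ⟨h1, h2.trans hyy.2, hy', fun θ hθ => ?_⟩).2
      rcases lt_or_ge θ y with h | h
      · exact h4 θ ⟨hθ.1, h⟩
      · exact (hs ⟨hyy.1.trans_le h, hθ.2⟩).2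
  · rintro ⟨h1, h2, h3, h4, h5, h6⟩
    refine ⟨⟨h1, h2, h3, fun θ hθ => (h4 hθ).2⟩, fun x' y' hx hy ⟨g1, g2, g3, g4⟩ => ⟨?_, ?_⟩⟩
    · by_contra hne
      have hlt : x' < x := lt_of_le_of_ne hx hne
      exact h5 ⟨⟨g1.trans_lt hlt, h2.trans_le h3⟩, g4 x ⟨hlt, h2.trans_le hy⟩⟩
    · by_contra hne
      have hlt : y < y' := lt_of_le_of_ne hy (Ne.symm hne)
      exact h6 ⟨⟨h1.trans_lt h2, hlt.trans_le g3⟩, g4 y ⟨hx.trans_lt h2, hlt⟩⟩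

theorem exists_ironingInterval (hP : P.Regular) {θ : ℝ} (hθ : θ ∈ P.gapSet) :
    ∃ x y, P.IsIroningInterval x y ∧ θ ∈ Ioo x y := by
  obtain ⟨x, y, hx, hy, hxy, h1, h2, h3⟩ := hP.isOpen_gapSet.exists_component
    lo_notMem_gapSet hi_notMem_gapSet hθ hθ.1.1.le hθ.1.2.le
  exact ⟨x, y, hP.isIroningInterval_iff.2 ⟨hx, hxy.1.trans hxy.2, hy, h1, h2, h3⟩, hxy⟩

theorem ironed_of_mem (hP : P.Regular) (a : ℝ → ℝ) {x y θ : ℝ} (h : P.IsIroningInterval x y)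
    (hθ : θ ∈ Ioo x y) : P.ironed a θ = (∫ z in x..y, a z) / (y - x) := by
  have hex : ∃ p : ℝ × ℝ, P.IsIroningInterval p.1 p.2 ∧ θ ∈ Ioo p.1 p.2 := ⟨(x, y), h, hθ⟩
  rw [ironed, dif_pos hex]
  obtain ⟨-, -, -, h1, h2, h3⟩ := hP.isIroningInterval_iff.1 h
  obtain ⟨-, -, -, h1', h2', h3'⟩ := hP.isIroningInterval_iff.1 hex.choose_spec.1
  -- The interval picked by choice is the given one, since components are disjoint.
  obtain ⟨e1, e2⟩ := component_unique hθ hex.choose_spec.2 h1 h2 h3 h1' h2' h3'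
  rw [← e1, ← e2]

theorem ironed_of_notMem (hP : P.Regular) (a : ℝ → ℝ) {θ : ℝ} (hθ : θ ∉ P.gapSet) :
    P.ironed a θ = a θ := by
  rw [ironed, dif_neg]
  rintro ⟨p, hp, hθp⟩
  exact hθ ((hP.isIroningInterval_iff.1 hp).2.2.2.1 hθp)

section Antitone

variable {a : ℝ → ℝ}

theorem le_ironed (hP : P.Regular) (ha : AntitoneOn a P.types) {x y θ : ℝ}
    (h : P.IsIroningInterval x y) (hθ : θ ∈ Ioo x y) : a y ≤ P.ironed a θ := by
  obtain ⟨h1, h2, h3, -⟩ := hP.isIroningInterval_iff.1 h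
  rw [hP.ironed_of_mem a h hθ, le_div_iff₀ (sub_pos.2 h2)]
  have hx : x ∈ P.types := ⟨h1, h2.le.trans h3⟩
  have hy : y ∈ P.types := ⟨h1.trans h2.le, h3⟩
  rw [← hP.workload_sub (hP.intervalIntegrable_of_antitoneOn ha hP.lo_mem hP.hi_mem) 0 hx hy]
  exact hP.le_workload_sub ha 0 hx hy h2.le

theorem ironed_le (hP : P.Regular) (ha : AntitoneOn a P.types) {x y θ : ℝ}
    (h : P.IsIroningInterval x y) (hθ : θ ∈ Ioo x y) : P.ironed a θ ≤ a x := by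
  obtain ⟨h1, h2, h3, -⟩ := hP.isIroningInterval_iff.1 h
  rw [hP.ironed_of_mem a h hθ, div_le_iff₀ (sub_pos.2 h2)]
  have hx : x ∈ P.types := ⟨h1, h2.le.trans h3⟩
  have hy : y ∈ P.types := ⟨h1.trans h2.le, h3⟩
  rw [← hP.workload_sub (hP.intervalIntegrable_of_antitoneOn ha hP.lo_mem hP.hi_mem) 0 hx hy]
  exact hP.workload_sub_le ha 0 hx hy h2.le

/-- Upper bound for the ironed allocation after a type outside the gap set. -/
theorem ironed_le_of_notMem (hP : P.Regular) (ha : AntitoneOn a P.types) {x θ : ℝ}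
    (hx : x ∈ P.types) (hxg : x ∉ P.gapSet) (hθ : θ ∈ P.types) (hle : x ≤ θ) :
    P.ironed a θ ≤ a x := by
  by_cases hg : θ ∈ P.gapSet
  · obtain ⟨x', y', hI, hm⟩ := hP.exists_ironingInterval hg
    obtain ⟨h1, h2, h3, h4, -⟩ := hP.isIroningInterval_iff.1 hI
    have hxx : x ≤ x' := by
      by_contra! hcon
      exact hxg (h4 ⟨hcon, hle.trans_lt hm.2⟩)
    exact (hP.ironed_le ha hI hm).trans (ha hx ⟨h1, h2.le.trans h3⟩ hxx)
  · rw [hP.ironed_of_notMem a hg]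
    exact ha hx hθ hle

/-- An average over a component lies between the values of `a` at its end points, which ironing
leaves unchanged. -/
theorem antitoneOn_ironed (hP : P.Regular) (ha : AntitoneOn a P.types) :
    AntitoneOn (P.ironed a) P.types := by
  intro θ hθ θ' hθ' hle
  by_cases hg : θ ∈ P.gapSet
  · obtain ⟨x, y, hI, hm⟩ := hP.exists_ironingInterval hg
    obtain ⟨h1, h2, h3, -, -, hy⟩ := hP.isIroningInterval_iff.1 hI
    rcases lt_or_ge θ' y with h | h
    · rw [hP.ironed_of_mem a hI hm, hP.ironed_of_mem a hI ⟨hm.1.trans_le hle, h⟩]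
    · exact (hP.ironed_le_of_notMem ha ⟨h1.trans h2.le, h3⟩ hy hθ' h).trans (hP.le_ironed ha hI hm)
  · rw [hP.ironed_of_notMem a hg]
    exact hP.ironed_le_of_notMem ha hθ hg hθ' hle

theorem integral_ironed (hP : P.Regular) (a : ℝ → ℝ) {x y : ℝ} (h : P.IsIroningInterval x y) :
    ∫ z in x..y, P.ironed a z = ∫ z in x..y, a z := by
  obtain ⟨h1, h2, h3, -⟩ := hP.isIroningInterval_iff.1 h
  rw [integral_congr_Ioo h2.le (g := fun _ => (∫ z in x..y, a z) / (y - x))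
    fun z hz => hP.ironed_of_mem a h hz, intervalIntegral.integral_const, smul_eq_mul,
    mul_div_cancel₀ _ (sub_pos.2 h2).ne']

theorem workload_ironed (hP : P.Regular) (ha : AntitoneOn a P.types) (u : ℝ) {θ : ℝ}
    (hθ : θ ∈ P.types) (hg : θ ∉ P.gapSet) :
    P.workload (P.ironed a) u θ = P.workload a u θ := by
  have i1 := hP.intervalIntegrable_of_antitoneOn ha hP.lo_mem hθ
  have i2 := hP.intervalIntegrable_of_antitoneOn (hP.antitoneOn_ironed ha) hP.lo_mem hθ
  have := integral_eq_zero_of_components hP.isOpen_gapSet hθ.1 lo_notMem_gapSet hg (i2.sub i1)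
    (Filter.Eventually.of_forall fun x _ hx => by simp [hP.ironed_of_notMem a hx])
    fun x y hx hxy hy hs hxg hyg => by
      have hI := hP.isIroningInterval_iff.2 ⟨hx, hxy, hy.trans hθ.2, hs, hxg, hyg⟩
      have hx' : x ∈ P.types := ⟨hx, (hxy.le.trans hy).trans hθ.2⟩
      have hy' : y ∈ P.types := ⟨hx.trans hxy.le, hy.trans hθ.2⟩
      have j1 := hP.intervalIntegrable_of_antitoneOn ha hx' hy'
      have j2 := hP.intervalIntegrable_of_antitoneOn (hP.antitoneOn_ironed ha) hx' hy'
      rw [intervalIntegral.integral_sub j2 j1, hP.integral_ironed a hI, sub_self]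
  rw [intervalIntegral.integral_sub i2 i1] at this
  rw [workload, workload]
  linarith

/-- The workload of an antitone allocation is concave, and ironing replaces it by its chord on each
component. Hence ironing preserves individual rationality. -/
theorem workload_ironed_le (hP : P.Regular) (ha : AntitoneOn a P.types) (u : ℝ) {θ : ℝ}
    (hθ : θ ∈ P.types) : P.workload (P.ironed a) u θ ≤ P.workload a u θ := by
  by_cases hg : θ ∈ P.gapSet
  · obtain ⟨x, y, hI, hm⟩ := hP.exists_ironingInterval hg
    obtain ⟨h1, h2, h3, -, hxg, hyg⟩ := hP.isIroningInterval_iff.1 hI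
    have hx : x ∈ P.types := ⟨h1, h2.le.trans h3⟩
    have hy : y ∈ P.types := ⟨h1.trans h2.le, h3⟩
    have haI := hP.intervalIntegrable_of_antitoneOn ha hP.lo_mem hP.hi_mem
    have haI' := hP.intervalIntegrable_of_antitoneOn (hP.antitoneOn_ironed ha) hP.lo_mem hP.hi_mem
    have e1 := hP.workload_sub haI' u hx hθ
    rw [integral_congr_Ioo hm.1.le (g := fun _ => (∫ z in x..y, a z) / (y - x))
      (fun z hz => hP.ironed_of_mem a hI ⟨hz.1, hz.2.trans hm.2⟩), intervalIntegral.integral_const,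
      smul_eq_mul, ← hP.workload_sub haI u hx hy, hP.workload_ironed ha u hx hxg] at e1
    have e2 := hP.le_workload_sub ha u hx hθ hm.1.le
    have e3 := hP.workload_sub_le ha u hθ hy hm.2.le
    have hxθ := sub_pos.2 hm.1
    have hθy := sub_pos.2 hm.2
    have e4 : (θ - x) * ((P.workload a u y - P.workload a u x) / (y - x)) ≤
        P.workload a u θ - P.workload a u x := by
      rw [← mul_div_assoc, div_le_iff₀ (by linarith)]
      nlinarith [mul_le_mul_of_nonneg_right e2 hθy.le, mul_le_mul_of_nonneg_right e3 hxθ.le]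
    linarith
  · exact (hP.workload_ironed ha u hθ hg).le

theorem Wbar_eq_of_affine {x y σ m : ℝ}
    (h : ∀ z ∈ Icc x y, P.calWbar z = σ * z + m) {θ : ℝ} (hθ : θ ∈ Ioc x y) : P.Wbar θ = σ := by
  have hev : P.calWbar =ᶠ[nhdsWithin θ (Iio θ)] fun z => σ * z + m := by
    filter_upwards [Ioo_mem_nhdsLT hθ.1] with z hz using h z ⟨hz.1.le, hz.2.le.trans hθ.2⟩
  rw [Wbar, leftDeriv, hev.derivWithin_eq (h θ ⟨hθ.1.le, hθ.2⟩)]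
  have : HasDerivAt (fun z => σ * z + m) σ θ := by
    simpa using ((hasDerivAt_id θ).const_mul σ).add_const m
  exact this.hasDerivWithinAt.derivWithin (uniqueDiffWithinAt_Iio θ)

theorem Wbar_eq_on_ironingInterval (hP : P.Regular) {x y : ℝ} (h : P.IsIroningInterval x y) :
    ∃ σ, ∀ z ∈ Ioo x y, P.Wbar z = σ := by
  obtain ⟨h1, h2, h3, h4, -⟩ := hP.isIroningInterval_iff.1 h
  obtain ⟨σ, m, hσ⟩ := concaveEnvelope_affine_of_lt hP.continuousOn_calW h1 h2 h3
    fun z hz => (h4 hz).2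
  exact ⟨σ, fun z hz => Wbar_eq_of_affine hσ ⟨hz.1, hz.2.le⟩⟩

/-- On each component `W̄` is constant, so only the integral of `a` matters there, and averaging
preserves it. -/
theorem integral_ironed_mul_Wbar (hP : P.Regular) (ha : AntitoneOn a P.types) :
    ∫ θ in P.lo..P.hi, P.ironed a θ * P.Wbar θ = ∫ θ in P.lo..P.hi, a θ * P.Wbar θ := by
  have hw := hP.intervalIntegrable_Wbar hP.lo_mem hP.hi_mem
  have i1 := ha.intervalIntegrable_mul hP.lt.le hw
  have i2 := (hP.antitoneOn_ironed ha).intervalIntegrable_mul hP.lt.le hw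
  have := integral_eq_zero_of_components hP.isOpen_gapSet hP.lt.le lo_notMem_gapSet
    hi_notMem_gapSet (i2.sub i1)
    (Filter.Eventually.of_forall fun x _ hx => by simp [hP.ironed_of_notMem a hx])
    fun x y hx hxy hy hs hxg hyg => by
      have hI := hP.isIroningInterval_iff.2 ⟨hx, hxy, hy, hs, hxg, hyg⟩
      have hx' : x ∈ P.types := ⟨hx, hxy.le.trans hy⟩
      have hy' : y ∈ P.types := ⟨hx.trans hxy.le, hy⟩
      obtain ⟨σ, hσ⟩ := hP.Wbar_eq_on_ironingInterval hI
      have j1 := hP.intervalIntegrable_of_antitoneOn ha hx' hy'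
      have j2 := hP.intervalIntegrable_of_antitoneOn (hP.antitoneOn_ironed ha) hx' hy'
      rw [integral_congr_Ioo hxy.le (g := fun z => (P.ironed a z - a z) * σ)
        (fun z hz => by rw [hσ z hz]; ring), intervalIntegral.integral_mul_const,
        intervalIntegral.integral_sub j2 j1, hP.integral_ironed a hI, sub_self, zero_mul]
  rw [intervalIntegral.integral_sub i2 i1] at this
  linarith

/-! ### Comparison of the two objectives -/

/-- The gain from replacing `W` by `W̄`, as an integral over the level sets of `a`. -/
theorem objective_Wbar_sub_W (hP : P.Regular) (ha : AntitoneOn a P.types)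
    (ha0 : ∀ θ ∈ P.types, 0 ≤ a θ) (u : ℝ) :
    P.objective P.Wbar a u - P.objective P.W a u = ∫ s in 0..a P.lo,
      (P.calWbar (levelCut P.lo P.hi a s) - P.calW (levelCut P.lo P.hi a s)) := by
  have hle := hP.lt.le
  have hw := hP.intervalIntegrable_Wbar hP.lo_mem hP.hi_mem
  have hW := hP.intervalIntegrable_W
  have h := integral_mul_antitone (g := fun θ => P.Wbar θ - P.W θ) hle (ha0 _ hP.lo_mem)
    (ha.mono Ioo_subset_Icc_self) (fun x hx => ⟨ha0 x (Ioo_subset_Icc_self hx),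
      ha hP.lo_mem (Ioo_subset_Icc_self hx) hx.1.le⟩) (hw.sub hW)
  have e1 : ∀ s, ∫ z in P.lo..levelCut P.lo P.hi a s, (P.Wbar z - P.W z) =
      P.calWbar (levelCut P.lo P.hi a s) - P.calW (levelCut P.lo P.hi a s) := by
    intro s
    have hc : levelCut P.lo P.hi a s ∈ P.types := levelCut_mem hle
    rw [intervalIntegral.integral_sub (hP.intervalIntegrable_Wbar hP.lo_mem hc)
      (hW.mono_set (hP.uIcc_subset hP.lo_mem hc)), hP.integral_Wbar hP.lo_mem hc hc.1,
      hP.calWbar_lo, sub_zero, calW]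
  simp only [e1] at h
  rw [← h, objective, objective, add_sub_add_right_eq_sub,
    ← intervalIntegral.integral_sub (ha.intervalIntegrable_mul hle hw)
      (ha.intervalIntegrable_mul hle hW)]
  exact intervalIntegral.integral_congr fun x _ => by ring

theorem objective_W_le (hP : P.Regular) (ha : AntitoneOn a P.types)
    (ha0 : ∀ θ ∈ P.types, 0 ≤ a θ) (u : ℝ) :
    P.objective P.W a u ≤ P.objective P.Wbar a u := by
  rw [← sub_nonneg, hP.objective_Wbar_sub_W ha ha0 u]
  exact integral_nonneg_Ioo (ha0 _ hP.lo_mem) fun s _ =>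
    sub_nonneg.2 (hP.calW_le_calWbar (levelCut_mem hP.lt.le))

/-- A cut inside a component would separate values above `s` from values at most `s`, but the ironed
allocation is constant there. -/
theorem levelCut_ironed_notMem (hP : P.Regular) (a : ℝ → ℝ) (ha : AntitoneOn a P.types) (s : ℝ) :
    levelCut P.lo P.hi (P.ironed a) s ∉ P.gapSet := by
  intro hg
  obtain ⟨x, y, hI, hm⟩ := hP.exists_ironingInterval hg
  obtain ⟨h1, h2, h3, -⟩ := hP.isIroningInterval_iff.1 hI
  have hanti := (hP.antitoneOn_ironed ha).mono (Ioo_subset_Icc_self (a := P.lo) (b := P.hi))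
  obtain ⟨z, hz⟩ := nonempty_Ioo.2 hm.1
  obtain ⟨z', hz'⟩ := nonempty_Ioo.2 hm.2
  have h4 := lt_of_lt_levelCut (s := s) hanti
    ⟨h1.trans_lt hz.1, hz.2.trans (hm.2.trans_le h3)⟩ hz.2
  have h5 : P.ironed a z' ≤ s := by
    by_contra! hcon
    exact absurd (le_levelCut hP.lt.le ⟨h1.trans_lt (hm.1.trans hz'.1), hz'.2.trans_le h3⟩ hcon)
      hz'.1.not_ge
  rw [hP.ironed_of_mem a hI ⟨hz.1, hz.2.trans hm.2⟩] at h4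
  rw [hP.ironed_of_mem a hI ⟨hm.1.trans hz'.1, hz'.2⟩] at h5
  linarith

end Antitone

theorem _root_.InnerProgram.RelaxedFeasible.ironed {a : ℝ → ℝ} {u : ℝ} (h : P.RelaxedFeasible a u)
    (hP : P.Regular) : P.RelaxedFeasible (P.ironed a) u := by
  have hanti := hP.antitoneOn_ironed h.ic
  refine ⟨fun θ hθ => ?_, h.u_nonneg, hanti,
    fun θ hθ => (hP.workload_ironed_le h.ic u hθ).trans (h.ir θ hθ), ?_⟩
  · refine le_trans ?_ (hanti hθ hP.hi_mem hθ.2)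
    rw [hP.ironed_of_notMem a hi_notMem_gapSet]
    exact h.a_nonneg _ hP.hi_mem
  · rw [hP.ironed_of_notMem a lo_notMem_gapSet]
    exact h.nn

/-- Ironing attains the relaxed value in the original program. -/
theorem objective_ironed (hP : P.Regular) {a : ℝ → ℝ} {u : ℝ} (h : P.RelaxedFeasible a u) :
    P.objective P.W (P.ironed a) u = P.objective P.Wbar a u := by
  have hI := h.ironed hP
  have h1 := hP.objective_Wbar_sub_W hI.ic hI.a_nonneg u
  have h2 : P.objective P.Wbar (P.ironed a) u = P.objective P.Wbar a u := by
    rw [objective, objective, hP.integral_ironed_mul_Wbar h.ic]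
  rw [integral_congr_Ioo (hI.a_nonneg _ hP.lo_mem) (g := fun _ => (0 : ℝ)) fun s _ => by
    rw [hP.calWbar_eq_calW (levelCut_mem hP.lt.le) (hP.levelCut_ironed_notMem a h.ic s),
      sub_self]] at h1
  simp only [intervalIntegral.integral_zero] at h1
  linarith

theorem isOriginalSolution_ironed (hP : P.Regular) {a : ℝ → ℝ} {u : ℝ}
    (h : P.IsRelaxedSolution a u) : P.IsOriginalSolution (P.ironed a) u := by
  refine ⟨hP.originalFeasible_iff.2 (h.1.ironed hP), fun a' u' h' => ?_⟩
  rw [hP.objective_ironed h.1]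
  exact (hP.objective_W_le h'.ic h'.a_nonneg u').trans (h.2 a' u' (hP.originalFeasible_iff.1 h'))

theorem isGreatest_originalValues (hP : P.Regular) {v : ℝ} (h : IsGreatest P.relaxedValues v) :
    IsGreatest P.originalValues v := by
  obtain ⟨⟨a, u, ha, rfl⟩, hmax⟩ := h
  refine ⟨⟨P.ironed a, u, hP.originalFeasible_iff.2 (ha.ironed hP), (hP.objective_ironed ha).symm⟩,
    ?_⟩
  rintro _ ⟨a', u', h', rfl⟩
  exact (hP.objective_W_le h'.ic h'.a_nonneg u').trans
    (hmax ⟨a', u', hP.originalFeasible_iff.1 h', rfl⟩)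

/-! ### Non-positive weights -/

/-- The relaxed value is the original value of the ironed allocation, hence a combination of two
non-negative aggregate tasks with coefficients `wA` and `wB`. -/
theorem exists_mechanism (hP : P.Regular) {a : ℝ → ℝ} {u : ℝ} (h : P.RelaxedFeasible a u) :
    0 ≤ (∫ θ in P.lo..P.hi, P.ironed a θ * P.f θ) ∧
    0 ≤ (∫ θ in P.lo..P.hi, (P.workload (P.ironed a) u θ - θ * P.ironed a θ) * P.f θ) ∧
    P.objective P.Wbar a u = P.wA * (∫ θ in P.lo..P.hi, P.ironed a θ * P.f θ) +
      P.wB * ∫ θ in P.lo..P.hi, (P.workload (P.ironed a) u θ - θ * P.ironed a θ) * P.f θ := by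
  have hI := h.ironed hP
  have hO := hP.originalFeasible_iff.2 hI
  refine ⟨integral_nonneg_Ioo hP.lt.le fun θ hθ => ?_, integral_nonneg_Ioo hP.lt.le fun θ hθ => ?_,
    by rw [← hP.objective_W hI.ic, hP.objective_ironed h]⟩
  · have hθ := Ioo_subset_Icc_self hθ
    exact mul_nonneg (hI.a_nonneg θ hθ) (hP.f_pos θ hθ).le
  · have hθ := Ioo_subset_Icc_self hθ
    exact mul_nonneg (by linarith [hO.nn θ hθ]) (hP.f_pos θ hθ).le

theorem objective_nonpos (hP : P.Regular) (hA : P.wA ≤ 0) (hB : P.wB ≤ 0) {a : ℝ → ℝ} {u : ℝ}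
    (h : P.RelaxedFeasible a u) : P.objective P.Wbar a u ≤ 0 := by
  obtain ⟨h1, h2, h3⟩ := hP.exists_mechanism h
  rw [h3]
  exact add_nonpos (mul_nonpos_of_nonpos_of_nonneg hA h1) (mul_nonpos_of_nonpos_of_nonneg hB h2)

theorem objective_zero (w : ℝ → ℝ) : P.objective w (fun _ => 0) 0 = 0 := by simp [objective]

theorem isRelaxedSolution_zero (hP : P.Regular) (hA : P.wA ≤ 0) (hB : P.wB ≤ 0) :
    P.IsRelaxedSolution (fun _ => 0) 0 :=
  ⟨hP.zero_feasible, fun a u h => by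
    rw [objective_zero]; exact hP.objective_nonpos hA hB h⟩

theorem isGreatest_relaxedValues_zero (hP : P.Regular) (hA : P.wA ≤ 0) (hB : P.wB ≤ 0) :
    IsGreatest P.relaxedValues 0 :=
  ⟨⟨_, _, hP.zero_feasible, (objective_zero _).symm⟩, by
    rintro _ ⟨a, u, h, rfl⟩; exact hP.objective_nonpos hA hB h⟩

theorem _root_.InnerProgram.RelaxedFeasible.eq_zero {a : ℝ → ℝ} (h : P.RelaxedFeasible a 0)
    (hP : P.Regular) {θ : ℝ} (hθ : θ ∈ P.types) : a θ = 0 :=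
  le_antisymm (by simpa using h.le_div hP hθ) (h.a_nonneg θ hθ)

theorem eq_zero_of_isRelaxedSolution (hP : P.Regular) (hA : P.wA < 0) (hB : P.wB < 0) {a : ℝ → ℝ}
    {u : ℝ} (h : P.IsRelaxedSolution a u) : u = 0 ∧ ∀ θ ∈ P.types, a θ = 0 := by
  obtain ⟨h1, h2, h3⟩ := hP.exists_mechanism h.1
  have h4 := h.2 _ _ hP.zero_feasible
  rw [objective_zero, h3] at h4
  have hI := h.1.ironed hP
  have hO := hP.originalFeasible_iff.2 hI
  have hle := hP.lt.le
  have i1 := hI.ic.intervalIntegrable_mul hle hP.f_int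
  have i2 : IntervalIntegrable (fun θ => (P.workload (P.ironed a) u θ - θ * P.ironed a θ) * P.f θ)
      volume P.lo P.hi := by
    have j1 : IntervalIntegrable (fun θ => P.workload (P.ironed a) u θ * P.f θ)
        volume P.lo P.hi := hP.f_int.continuousOn_mul (by
      rw [hP.uIcc_eq]
      exact hP.continuousOn_workload (hI.intervalIntegrable hP hP.lo_mem hP.hi_mem) u)
    have j2 := hI.ic.intervalIntegrable_mul hle hP.intervalIntegrable_id_mul_f
    refine (j1.sub j2).congr fun θ _ => ?_
    ring
  have z1 : ∫ θ in P.lo..P.hi, P.ironed a θ * P.f θ = 0 := by nlinarith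
  have z2 : ∫ θ in P.lo..P.hi, (P.workload (P.ironed a) u θ - θ * P.ironed a θ) * P.f θ = 0 := by
    nlinarith
  have a1 := ae_eq_zero_of_integral_eq_zero_Ioo hle i1 (fun θ hθ =>
    mul_nonneg (hI.a_nonneg θ (Ioo_subset_Icc_self hθ)) (hP.f_pos θ (Ioo_subset_Icc_self hθ)).le) z1
  have a2 := ae_eq_zero_of_integral_eq_zero_Ioo hle i2 (fun θ hθ =>
    mul_nonneg (by linarith [hO.nn θ (Ioo_subset_Icc_self hθ)])
      (hP.f_pos θ (Ioo_subset_Icc_self hθ)).le) z2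
  -- A single type with neither task is enough: its workload is zero and workloads do not decrease
  -- from `u`, so `u = 0`, and then `a ≤ u / lo` kills `a`.
  obtain ⟨θ, hθ, e1, e2⟩ := exists_mem_Ioo_of_ae hP.lt
    (Q := fun θ => P.ironed a θ * P.f θ = 0 ∧
      (P.workload (P.ironed a) u θ - θ * P.ironed a θ) * P.f θ = 0) (by
      filter_upwards [a1, a2] with θ h1 h2 hθ using ⟨h1 hθ, h2 hθ⟩)
  have hθ' := Ioo_subset_Icc_self hθ
  have hf := (hP.f_pos θ hθ').ne'
  have e3 := (mul_eq_zero.1 e1).resolve_right hf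
  have e4 := (mul_eq_zero.1 e2).resolve_right hf
  rw [e3, mul_zero, sub_zero] at e4
  have e5 : 0 ≤ P.workload (P.ironed a) u θ - P.workload (P.ironed a) u P.lo := by
    have := hP.le_workload_sub hI.ic u hP.lo_mem hθ' hθ'.1
    rwa [e3, zero_mul] at this
  rw [workload_lo, e4] at e5
  have hu : u = 0 := le_antisymm (by linarith) h.1.u_nonneg
  subst hu
  exact ⟨rfl, fun θ hθ => h.1.eq_zero hP hθ⟩

end Regular
end InnerProgram

namespace InnerProgram
namespace Regular

variable {P : InnerProgram}

/-! ### The maximizers of `𝒲` -/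

theorem isCompact_argmaxW (hP : P.Regular) : IsCompact P.argmaxW ∧ P.argmaxW.Nonempty := by
  obtain ⟨c, hc, hmax⟩ := isCompact_Icc.exists_isMaxOn ⟨P.lo, hP.lo_mem⟩ hP.continuousOn_calW
  have heq : P.argmaxW = P.types ∩ P.calW ⁻¹' Ici (P.calW c) := by
    ext θ
    constructor
    · exact fun h => ⟨h.1, h.2 hc⟩
    · exact fun h => ⟨h.1, isMaxOn_iff.2 fun z hz => (isMaxOn_iff.1 hmax z hz).trans h.2⟩
  refine ⟨?_, c, hc, hmax⟩
  rw [heq]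
  exact isCompact_Icc.of_isClosed_subset
    (hP.continuousOn_calW.preimage_isClosed_of_isClosed isClosed_Icc isClosed_Ici)
    inter_subset_left

theorem starLow_mem_argmaxW (hP : P.Regular) : P.starLow ∈ P.argmaxW :=
  hP.isCompact_argmaxW.1.sInf_mem hP.isCompact_argmaxW.2

theorem starHigh_mem_argmaxW (hP : P.Regular) : P.starHigh ∈ P.argmaxW :=
  hP.isCompact_argmaxW.1.sSup_mem hP.isCompact_argmaxW.2

theorem starLow_mem (hP : P.Regular) : P.starLow ∈ P.types := hP.starLow_mem_argmaxW.1

theorem starHigh_mem (hP : P.Regular) : P.starHigh ∈ P.types := hP.starHigh_mem_argmaxW.1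

theorem starLow_le_starHigh (hP : P.Regular) : P.starLow ≤ P.starHigh :=
  csInf_le hP.isCompact_argmaxW.1.bddBelow hP.starHigh_mem_argmaxW

theorem calWbar_le_of_argmaxW {c z : ℝ} (hc : c ∈ P.argmaxW) (hz : z ∈ P.types) :
    P.calWbar z ≤ P.calW c := by
  have := concaveEnvelope_le_affine (G := P.calW) (σ := 0) (m := P.calW c)
    (fun z hz => by simpa using hc.2 hz) hz
  simpa [calWbar, types] using this

theorem calWbar_eq_of_argmaxW (hP : P.Regular) {c : ℝ} (hc : c ∈ P.argmaxW) :
    P.calWbar c = P.calW c :=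
  le_antisymm (calWbar_le_of_argmaxW hc hc.1) (hP.calW_le_calWbar hc.1)

theorem calWbar_le_starLow (hP : P.Regular) {z : ℝ} (hz : z ∈ P.types) :
    P.calWbar z ≤ P.calWbar P.starLow := by
  rw [hP.calWbar_eq_of_argmaxW hP.starLow_mem_argmaxW]
  exact calWbar_le_of_argmaxW hP.starLow_mem_argmaxW hz

theorem calWbar_starHigh (hP : P.Regular) : P.calWbar P.starHigh = P.calWbar P.starLow := by
  refine le_antisymm (hP.calWbar_le_starLow hP.starHigh_mem) ?_
  rw [hP.calWbar_eq_of_argmaxW hP.starHigh_mem_argmaxW]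
  exact calWbar_le_of_argmaxW hP.starHigh_mem_argmaxW hP.starLow_mem

theorem calW_lt_of_notMem (hP : P.Regular) {z : ℝ} (hz : z ∈ P.types) (h : z ∉ P.argmaxW) :
    P.calW z < P.calWbar P.starLow := by
  rw [hP.calWbar_eq_of_argmaxW hP.starLow_mem_argmaxW]
  refine lt_of_le_of_ne (hP.starLow_mem_argmaxW.2 hz) fun he => h ⟨hz, isMaxOn_iff.2 fun y hy => ?_⟩
  rw [he]
  exact hP.starLow_mem_argmaxW.2 hy

/-- Before `starLow` the function `𝒲` stays strictly below its maximum, so the horizontal line at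
the maximum can be tilted. Thus the envelope creates no earlier maximizer. -/
theorem calWbar_lt_of_lt_starLow (hP : P.Regular) {z : ℝ} (hz : P.lo ≤ z) (hlt : z < P.starLow) :
    P.calWbar z < P.calWbar P.starLow := by
  obtain ⟨c, hc⟩ := nonempty_Ioo.2 hlt
  have hhi := hP.starLow_mem.2
  have := concaveEnvelope_lt_affine_left (σ := 0) (m := P.calWbar P.starLow) (c := c) (x := z)
    hP.continuousOn_calW ⟨hz.trans hc.1.le, hc.2.le.trans hhi⟩
    (fun y hy => by simpa using (hP.calW_le_calWbar hy).trans (hP.calWbar_le_starLow hy))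
    (fun y hy => by
      have := hP.calW_lt_of_notMem ⟨hy.1, hy.2.trans (hc.2.le.trans hhi)⟩ fun hm =>
        absurd (csInf_le hP.isCompact_argmaxW.1.bddBelow hm) (hy.2.trans_lt hc.2).not_ge
      simpa using this) ⟨hz, hc.1⟩
  simpa [calWbar, types] using this

theorem calWbar_lt_of_starHigh_lt (hP : P.Regular) {z : ℝ} (hz : z ≤ P.hi)
    (hlt : P.starHigh < z) : P.calWbar z < P.calWbar P.starLow := by
  obtain ⟨c, hc⟩ := nonempty_Ioo.2 hlt
  have hlo := hP.starHigh_mem.1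
  have := concaveEnvelope_lt_affine_right (σ := 0) (m := P.calWbar P.starLow) (c := c) (x := z)
    hP.continuousOn_calW ⟨hlo.trans hc.1.le, hc.2.le.trans hz⟩
    (fun y hy => by simpa using (hP.calW_le_calWbar hy).trans (hP.calWbar_le_starLow hy))
    (fun y hy => by
      have := hP.calW_lt_of_notMem ⟨(hlo.trans hc.1.le).trans hy.1, hy.2⟩ fun hm =>
        absurd (le_csSup hP.isCompact_argmaxW.1.bddAbove hm) (hc.1.trans_le hy.1).not_ge
      simpa using this) ⟨hc.2, hz⟩
  simpa [calWbar, types] using this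

theorem Wbar_pos (hP : P.Regular) {z : ℝ} (hz : z ∈ Ioo P.lo P.starLow) : 0 < P.Wbar z := by
  have h1 := hP.calWbar_le_tangent ⟨hz.1, hz.2.trans_le hP.starLow_mem.2⟩ hP.starLow_mem
  have h2 := hP.calWbar_lt_of_lt_starLow hz.1.le hz.2
  exact pos_of_mul_pos_left (by linarith) (sub_nonneg.2 hz.2.le)

theorem Wbar_nonpos (hP : P.Regular) {z : ℝ} (hz : z ∈ Ioo P.starLow P.hi) : P.Wbar z ≤ 0 := by
  have hzI : z ∈ Ioo P.lo P.hi := ⟨hP.starLow_mem.1.trans_lt hz.1, hz.2⟩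
  have h1 := hP.calWbar_le_tangent hzI hP.starLow_mem
  have h2 := hP.calWbar_le_starLow (Ioo_subset_Icc_self hzI)
  exact nonpos_of_mul_nonpos_left (b := z - P.starLow) (by linarith) (sub_pos.2 hz.1)

theorem Wbar_neg (hP : P.Regular) {z : ℝ} (hz : z ∈ Ioo P.starHigh P.hi) : P.Wbar z < 0 := by
  have hs := hP.starLow_le_starHigh.trans_lt hz.1
  have hzI : z ∈ Ioo P.lo P.hi := ⟨hP.starHigh_mem.1.trans_lt hz.1, hz.2⟩
  have h1 := hP.calWbar_le_tangent hzI hP.starLow_mem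
  have h2 := hP.calWbar_lt_of_starHigh_lt hz.2.le hz.1
  exact neg_of_mul_neg_left (b := z - P.starLow) (by linarith) (sub_nonneg.2 hs.le)

theorem Wbar_eq_zero (hP : P.Regular) {z : ℝ} (hz : z ∈ Ioc P.starLow P.starHigh) :
    P.Wbar z = 0 := by
  refine Wbar_eq_of_affine (x := P.starLow) (y := P.starHigh) (σ := 0)
    (m := P.calWbar P.starLow) (fun y hy => ?_) hz
  rw [zero_mul, zero_add]
  have hyI : y ∈ P.types := ⟨hP.starLow_mem.1.trans hy.1, hy.2.trans hP.starHigh_mem.2⟩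
  refine le_antisymm (hP.calWbar_le_starLow hyI) ?_
  have := hP.concaveOn_calWbar.min_le_of_mem_Icc hP.starLow_mem hP.starHigh_mem hy
  rwa [hP.calWbar_starHigh, min_self] at this

theorem calWbar_starLow_nonneg (hP : P.Regular) : 0 ≤ P.calWbar P.starLow := by
  rw [← hP.calWbar_lo]
  exact hP.calWbar_le_starLow hP.lo_mem

theorem le_calWbar_starLow (hP : P.Regular) : P.wA - P.wB * P.lo ≤ P.calWbar P.starLow := by
  rw [← hP.calWbar_hi]
  exact hP.calWbar_le_starLow hP.hi_mem

/-- The maximum is at least the end values `0` and `wA - wB * lo`; one of them suffices, depending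
on the sign of `wB`. -/
theorem calWbar_starLow_add_pos (hP : P.Regular) (h : ¬ (P.wA ≤ 0 ∧ P.wB ≤ 0)) :
    0 < P.calWbar P.starLow + P.wB * P.lo := by
  have h1 := hP.calWbar_starLow_nonneg
  have h2 := hP.le_calWbar_starLow
  by_cases hB : P.wB ≤ 0
  · have hA : 0 < P.wA := not_le.1 fun hA => h ⟨hA, hB⟩
    linarith
  · have := mul_pos (not_le.1 hB) hP.lo_pos
    linarith

/-! ### The tangent gap -/

/-- Up to the constant `wB * lo`, the gap is minus the intercept at `0` of the tangent to `𝒲̄`. As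
types are positive, the intercept rises when the point of tangency moves right. -/
theorem antitoneOn_tangentGap (hP : P.Regular) : AntitoneOn P.tangentGap (Ioo P.lo P.hi) := by
  intro x hx y hy hxy
  have h1 := hP.calWbar_le_tangent hy (Ioo_subset_Icc_self hx)
  have h2 := hP.antitoneOn_Wbar hx hy hxy
  have h3 : 0 ≤ x * (P.Wbar x - P.Wbar y) :=
    mul_nonneg (hP.lo_pos.trans hx.1).le (sub_nonneg.2 h2)
  rw [tangentGap, tangentGap]
  linarith

theorem bddAbove_sharpHigh (hP : P.Regular) :
    BddAbove ({θ | θ ∈ Ioo P.lo P.hi ∧ 0 ≤ P.tangentGap θ} ∪ {P.lo}) :=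
  ⟨P.hi, by rintro z (hz | rfl); exacts [hz.1.2.le, hP.lt.le]⟩

theorem bddBelow_sharpLow (hP : P.Regular) :
    BddBelow ({θ | θ ∈ Ioo P.lo P.hi ∧ P.tangentGap θ ≤ 0} ∪ {P.hi}) :=
  ⟨P.lo, by rintro z (hz | rfl); exacts [hz.1.1.le, hP.lt.le]⟩

theorem le_sharpHigh (hP : P.Regular) {z : ℝ} (hz : z ∈ Ioo P.lo P.hi)
    (h : 0 ≤ P.tangentGap z) : z ≤ P.sharpHigh := le_csSup hP.bddAbove_sharpHigh (Or.inl ⟨hz, h⟩)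

theorem sharpLow_le (hP : P.Regular) {z : ℝ} (hz : z ∈ Ioo P.lo P.hi)
    (h : P.tangentGap z ≤ 0) : P.sharpLow ≤ z := csInf_le hP.bddBelow_sharpLow (Or.inl ⟨hz, h⟩)

theorem tangentGap_nonneg_of_lt (hP : P.Regular) {z : ℝ} (hz : P.lo < z)
    (h : z < P.sharpHigh) : 0 ≤ P.tangentGap z := by
  obtain ⟨y, hy | rfl, hzy⟩ := exists_lt_of_lt_csSup ⟨P.lo, by simp⟩ h
  · exact hy.2.trans (hP.antitoneOn_tangentGap ⟨hz, hzy.trans hy.1.2⟩ hy.1 hzy.le)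
  · exact absurd hz hzy.not_gt

theorem tangentGap_nonpos_of_lt (hP : P.Regular) {z : ℝ} (hz : z < P.hi)
    (h : P.sharpLow < z) : P.tangentGap z ≤ 0 := by
  obtain ⟨y, hy | rfl, hyz⟩ := exists_lt_of_csInf_lt ⟨P.hi, by simp⟩ h
  · exact (hP.antitoneOn_tangentGap hy.1 ⟨hy.1.1.trans hyz, hz⟩ hyz.le).trans hy.2
  · exact absurd hz hyz.not_gt

theorem sharpLow_le_sharpHigh (hP : P.Regular) : P.sharpLow ≤ P.sharpHigh := by
  by_contra! hcon
  have h1 : P.lo ≤ P.sharpHigh := le_csSup hP.bddAbove_sharpHigh (by simp)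
  have h2 : P.sharpLow ≤ P.hi := csInf_le hP.bddBelow_sharpLow (by simp)
  obtain ⟨z, hz⟩ := nonempty_Ioo.2 hcon
  have hzI : z ∈ Ioo P.lo P.hi := ⟨h1.trans_lt hz.1, hz.2.trans_le h2⟩
  rcases le_total 0 (P.tangentGap z) with h | h
  · exact absurd (hP.le_sharpHigh hzI h) hz.1.not_ge
  · exact absurd (hP.sharpLow_le hzI h) hz.2.not_ge

/-- A tangent after `starLow` has non-positive slope and lies above the maximum at `starLow`. Its
intercept at `0` is then at least the maximum, which exceeds `-wB * lo`. -/
theorem sharpHigh_le_starLow (hP : P.Regular) (h : ¬ (P.wA ≤ 0 ∧ P.wB ≤ 0)) :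
    P.sharpHigh ≤ P.starLow := by
  have hM := hP.calWbar_starLow_add_pos h
  refine csSup_le ⟨P.lo, by simp⟩ ?_
  rintro z (⟨hz, hz0⟩ | rfl)
  · by_contra! hcon
    have h1 := hP.Wbar_nonpos ⟨hcon, hz.2⟩
    have h2 := hP.calWbar_le_tangent hz hP.starLow_mem
    have h3 : P.starLow * P.Wbar z ≤ 0 :=
      mul_nonpos_of_nonneg_of_nonpos (hP.lo_pos.le.trans hP.starLow_mem.1) h1
    rw [tangentGap] at hz0
    linarith
  · exact hP.starLow_mem.1

/-! ### The reservation workload -/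

theorem Rext_of_le {θ : ℝ} (h : θ ≤ P.hi) : P.Rext θ = P.R θ := by rw [Rext, min_eq_left h]

theorem min_mem (hP : P.Regular) {θ : ℝ} (h : P.lo ≤ θ) : min θ P.hi ∈ P.types :=
  ⟨le_min h hP.lt.le, min_le_right _ _⟩

theorem monotoneOn_Rext (hP : P.Regular) : MonotoneOn P.Rext (Ici P.lo) :=
  fun _ hx _ hy hxy => hP.R_mono (hP.min_mem hx) (hP.min_mem hy) (min_le_min_right _ hxy)

/-- A constant continuation stays concave because `R` is non-decreasing. It makes `hi` an interior
point, so continuity and one-sided derivatives are available there. -/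
theorem concaveOn_Rext (hP : P.Regular) : ConcaveOn ℝ (Ici P.lo) P.Rext := by
  refine ⟨convex_Ici _, fun x hx y hy a b ha hb hab => ?_⟩
  have hx' := hP.min_mem hx
  have hy' := hP.min_mem hy
  refine (hP.R_concave.2 hx' hy' ha hb hab).trans (hP.R_mono ?_ (hP.min_mem ?_) ?_)
  · exact convex_Icc _ _ hx' hy' ha hb hab
  · exact convex_Ici _ hx hy ha hb hab
  · refine le_min ?_ ((convex_Icc _ _ hx' hy' ha hb hab).2)
    simp only [smul_eq_mul]
    gcongr <;> exact min_le_left _ _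

theorem Rext_lo (hP : P.Regular) : P.Rext P.lo = P.R P.lo := Rext_of_le hP.lt.le

theorem Rext_le (hP : P.Regular) {θ : ℝ} (h : P.lo ≤ θ) : P.Rext θ ≤ P.R P.hi :=
  hP.R_mono (hP.min_mem h) hP.hi_mem (min_le_right _ _)

theorem continuousOn_Rext_Ioi (hP : P.Regular) : ContinuousOn P.Rext (Ioi P.lo) := by
  have := hP.concaveOn_Rext.continuousOn_interior
  rwa [interior_Ici] at this

theorem interior_Ici_lo {θ : ℝ} (h : P.lo < θ) : θ ∈ interior (Ici P.lo) := by
  rwa [interior_Ici]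

theorem leftDeriv_Rext {θ : ℝ} (h : θ ≤ P.hi) : leftDeriv P.Rext θ = leftDeriv P.R θ :=
  derivWithin_congr (fun _ hz => Rext_of_le (hz.le.trans h)) (Rext_of_le h)

theorem leftDeriv_Rext_nonneg (hP : P.Regular) {θ : ℝ} (h : P.lo < θ) :
    0 ≤ leftDeriv P.Rext θ := by
  have h1 := hP.concaveOn_Rext.le_add_leftDeriv_mul (interior_Ici_lo h)
    (show θ + 1 ∈ Ici P.lo from h.le.trans (by linarith))
  have h2 := hP.monotoneOn_Rext (show θ ∈ Ici P.lo from h.le)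
    (show θ + 1 ∈ Ici P.lo from h.le.trans (by linarith)) (by linarith)
  linarith

theorem _root_.ConcaveOn.lt_of_lt_of_le_line {S : Set ℝ} {K : ℝ → ℝ} (hK : ConcaveOn ℝ S K)
    {ρ x y z : ℝ} (hx : x ∈ S) (hy : y ∈ S) (hKx : ρ * x < K x) (hKy : ρ * y ≤ K y)
    (hxz : x ≤ z) (hzy : z < y) : ρ * z < K z := by
  have hxy : 0 < y - x := by linarith
  have h := hK.2 hx hy (div_nonneg (sub_nonneg.2 hzy.le) hxy.le)
    (div_nonneg (sub_nonneg.2 hxz) hxy.le) (by field_simp; ring)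
  simp only [smul_eq_mul] at h
  have e1 : (y - z) / (y - x) * x + (z - x) / (y - x) * y = z := by field_simp; ring
  have e2 : (y - z) / (y - x) * (ρ * x) + (z - x) / (y - x) * (ρ * y) = ρ * z := by
    field_simp; ring
  rw [e1] at h
  have h1 : (y - z) / (y - x) * (ρ * x) < (y - z) / (y - x) * K x :=
    mul_lt_mul_of_pos_left hKx (div_pos (sub_pos.2 hzy) hxy)
  have h2 : (z - x) / (y - x) * (ρ * y) ≤ (z - x) / (y - x) * K y :=
    mul_le_mul_of_nonneg_left hKy (div_nonneg (sub_nonneg.2 hxz) hxy.le)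
  linarith

/-- The last crossing of `R` with the ray of slope `ρ`; it exists because `R` is bounded and the ray
is not. At the supremum, one inequality comes from monotonicity and points to the right. The other
comes from continuity, or at `lo` from `hρR`, since `R` may jump up just after `lo`. -/
theorem isGreatest_cutoff (hP : P.Regular) {ρ : ℝ} (hρ : 0 < ρ) (hρR : ρ * P.lo ≤ P.R P.lo) :
    ∃ t, IsGreatest {θ | P.lo ≤ θ ∧ ρ ≤ P.Rext θ / θ} t ∧ P.Rext t = ρ * t := by
  set A := {θ | P.lo ≤ θ ∧ ρ ≤ P.Rext θ / θ} with hA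
  have hmem : ∀ θ, θ ∈ A ↔ P.lo ≤ θ ∧ ρ * θ ≤ P.Rext θ := by
    intro θ
    constructor
    · rintro ⟨h1, h2⟩
      exact ⟨h1, (le_div_iff₀ (hP.lo_pos.trans_le h1)).1 h2⟩
    · rintro ⟨h1, h2⟩
      exact ⟨h1, (le_div_iff₀ (hP.lo_pos.trans_le h1)).2 h2⟩
  have hlo : P.lo ∈ A := (hmem _).2 ⟨le_rfl, by rwa [hP.Rext_lo]⟩
  have hbdd : BddAbove A := by
    refine ⟨P.R P.hi / ρ, fun θ hθ => ?_⟩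
    obtain ⟨h1, h2⟩ := (hmem θ).1 hθ
    rw [le_div_iff₀ hρ]
    linarith [hP.Rext_le h1]
  have hle : P.lo ≤ sSup A := le_csSup hbdd hlo
  have hgt : ∀ θ, sSup A < θ → P.Rext θ < ρ * θ := fun θ hθ => by
    by_contra! hcon
    exact absurd (le_csSup hbdd ((hmem θ).2 ⟨hle.trans hθ.le, hcon⟩)) hθ.not_ge
  have hup : P.Rext (sSup A) ≤ ρ * sSup A := by
    have hlim : Filter.Tendsto (fun θ => ρ * θ) (nhdsWithin (sSup A) (Ioi (sSup A)))
        (nhds (ρ * sSup A)) :=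
      ((continuous_const.mul continuous_id).tendsto _).mono_left nhdsWithin_le_nhds
    refine ge_of_tendsto hlim ?_
    filter_upwards [self_mem_nhdsWithin] with θ hθ
    exact (hP.monotoneOn_Rext hle (hle.trans (le_of_lt hθ)) (le_of_lt hθ)).trans (hgt θ hθ).le
  have hmemS : ρ * sSup A ≤ P.Rext (sSup A) := by
    rcases hle.eq_or_lt with h | h
    · rw [← h, hP.Rext_lo]
      exact hρR
    · have hcont := hP.continuousOn_Rext_Ioi.continuousAt (Ioi_mem_nhds h)
      have hfreq : ∃ᶠ θ in nhds (sSup A), ρ * θ ≤ P.Rext θ :=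
        (isLUB_csSup ⟨_, hlo⟩ hbdd).frequently_mem ⟨_, hlo⟩ |>.filter_mono nhdsWithin_le_nhds
          |>.mono fun θ hθ => ((hmem θ).1 hθ).2
      by_contra! hcon
      have : ∀ᶠ θ in nhds (sSup A), P.Rext θ < ρ * θ :=
        hcont.eventually_lt (continuous_const.mul continuous_id).continuousAt hcon
      exact hfreq (this.mono fun θ hθ => not_le.2 hθ)
  exact ⟨sSup A, ⟨(hmem _).2 ⟨hle, hmemS⟩, fun θ hθ => le_csSup hbdd hθ⟩, le_antisymm hup hmemS⟩

/-! ### Rays from the origin that cross `R` at or after `check` -/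

section Check

variable {t θ : ℝ}

theorem check_spec (hP : P.Regular) (hR : 0 < P.R P.lo) :
    IsGreatest {θ | P.lo ≤ θ ∧ P.R P.lo / P.lo ≤ P.Rext θ / θ} P.check ∧
      P.Rext P.check = P.R P.lo / P.lo * P.check := by
  obtain ⟨t, ht, ht'⟩ := hP.isGreatest_cutoff (div_pos hR hP.lo_pos)
    (div_mul_cancel₀ _ hP.lo_pos.ne').le
  have : P.check = t := ht.csSup_eq
  rw [this]
  exact ⟨ht, ht'⟩

theorem lo_le_check (hP : P.Regular) (hR : 0 < P.R P.lo) : P.lo ≤ P.check :=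
  (hP.check_spec hR).1.1.1

theorem le_check (hP : P.Regular) (hR : 0 < P.R P.lo) (hθ : P.lo ≤ θ)
    (h : P.R P.lo / P.lo * θ ≤ P.Rext θ) : θ ≤ P.check :=
  (hP.check_spec hR).1.2 ⟨hθ, (le_div_iff₀ (hP.lo_pos.trans_le hθ)).2 h⟩

theorem pos_of_check_le (hP : P.Regular) (hR : 0 < P.R P.lo) (ht : P.check ≤ t) : 0 < t :=
  hP.lo_pos.trans_le ((hP.lo_le_check hR).trans ht)

theorem Rext_pos (hP : P.Regular) (hR : 0 < P.R P.lo) (hθ : P.lo ≤ θ) : 0 < P.Rext θ :=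
  (hP.Rext_lo ▸ hR : 0 < P.Rext P.lo).trans_le (hP.monotoneOn_Rext self_mem_Ici hθ hθ)

theorem ratio_pos (hP : P.Regular) (hR : 0 < P.R P.lo) (ht : P.check ≤ t) : 0 < P.Rext t / t :=
  div_pos (hP.Rext_pos hR ((hP.lo_le_check hR).trans ht)) (hP.pos_of_check_le hR ht)

theorem ratio_mul (hP : P.Regular) (hR : 0 < P.R P.lo) (ht : P.check ≤ t) :
    P.Rext t / t * t = P.Rext t := div_mul_cancel₀ _ (hP.pos_of_check_le hR ht).ne'

theorem ratio_lt (hP : P.Regular) (hR : 0 < P.R P.lo) (ht : P.check < t) :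
    P.Rext t / t < P.R P.lo / P.lo := by
  rw [div_lt_iff₀ (hP.pos_of_check_le hR ht.le)]
  by_contra! hcon
  exact absurd (hP.le_check hR ((hP.lo_le_check hR).trans ht.le) hcon) ht.not_ge

theorem ratio_check (hP : P.Regular) (hR : 0 < P.R P.lo) :
    P.Rext P.check / P.check = P.R P.lo / P.lo := by
  rw [(hP.check_spec hR).2, mul_div_cancel_right₀ _ (hP.pos_of_check_le hR le_rfl).ne']

theorem ratio_mul_lo_lt (hP : P.Regular) (hR : 0 < P.R P.lo) (ht : P.check < t) :
    P.Rext t / t * P.lo < P.Rext P.lo := by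
  rw [hP.Rext_lo]
  exact (lt_div_iff₀ hP.lo_pos).1 (hP.ratio_lt hR ht)

theorem ratio_mul_lt (hP : P.Regular) (hR : 0 < P.R P.lo) (ht : P.check < t) (hθ : P.lo ≤ θ)
    (hθt : θ < t) : P.Rext t / t * θ < P.Rext θ :=
  hP.concaveOn_Rext.lt_of_lt_of_le_line self_mem_Ici ((hP.lo_le_check hR).trans ht.le)
    (hP.ratio_mul_lo_lt hR ht) (hP.ratio_mul hR ht.le).le hθ hθt

/-- For `t > check` the ray through `(t, R t)` is strictly below `R` at `lo`. If it were met again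
after `t`, concavity would put it strictly below `R` at `t` itself. -/
theorem lt_ratio_mul (hP : P.Regular) (hR : 0 < P.R P.lo) (ht : P.check ≤ t) (hθt : t < θ) :
    P.Rext θ < P.Rext t / t * θ := by
  rcases ht.eq_or_lt with rfl | h
  · rw [hP.ratio_check hR]
    by_contra! hcon
    exact absurd (hP.le_check hR ((hP.lo_le_check hR).trans hθt.le) hcon) hθt.not_ge
  · by_contra! hcon
    have hlo := (hP.lo_le_check hR).trans ht
    have := hP.concaveOn_Rext.lt_of_lt_of_le_line self_mem_Ici (hlo.trans hθt.le)
      (hP.ratio_mul_lo_lt hR h) hcon hlo hθt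
    rw [hP.ratio_mul hR ht] at this
    exact lt_irrefl _ this

theorem ratio_mul_le (hP : P.Regular) (hR : 0 < P.R P.lo) (ht : P.check ≤ t) (hθ : P.lo ≤ θ)
    (hθt : θ ≤ t) : P.Rext t / t * θ ≤ P.Rext θ := by
  by_contra! hcon
  have hlt : θ < t := lt_of_le_of_ne hθt (by
    rintro rfl; rw [hP.ratio_mul hR ht] at hcon; exact lt_irrefl _ hcon)
  rcases ht.eq_or_lt with rfl | h
  · have h1 : P.lo < θ := by
      refine lt_of_le_of_ne hθ ?_
      rintro rfl
      rw [hP.ratio_check hR, div_mul_cancel₀ _ hP.lo_pos.ne', hP.Rext_lo] at hcon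
      exact lt_irrefl _ hcon
    have hc := hP.concaveOn_Rext.2 (x := P.lo) self_mem_Ici (y := P.check)
      (hP.lo_le_check hR)
    have hd : 0 < P.check - P.lo := by linarith
    have h := hc (div_nonneg (sub_nonneg.2 hlt.le) hd.le) (div_nonneg (sub_nonneg.2 hθ) hd.le)
      (by field_simp; ring)
    simp only [smul_eq_mul] at h
    have e1 : (P.check - θ) / (P.check - P.lo) * P.lo + (θ - P.lo) / (P.check - P.lo) * P.check = θ
      := by field_simp; ring
    have e2 : P.Rext P.lo = P.Rext P.check / P.check * P.lo := by
      rw [hP.ratio_check hR, div_mul_cancel₀ _ hP.lo_pos.ne', hP.Rext_lo]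
    have e3 := (hP.ratio_mul hR ht).symm
    rw [e1, e2] at h
    set ρ := P.Rext P.check / P.check
    rw [e3] at h
    have e4 : (P.check - θ) / (P.check - P.lo) * (ρ * P.lo) +
        (θ - P.lo) / (P.check - P.lo) * (ρ * P.check) = ρ * θ := by field_simp; ring
    linarith
  · exact absurd (hP.ratio_mul_lt hR h hθ hlt) hcon.not_gt

/-- Translates the `u` of a solution into a cutoff, with `ρ = u / lo`. -/
theorem exists_ratio_eq (hP : P.Regular) (hR : 0 < P.R P.lo) {ρ : ℝ} (hρ : 0 < ρ)
    (hρR : ρ ≤ P.R P.lo / P.lo) : ∃ t, P.check ≤ t ∧ P.Rext t / t = ρ := by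
  obtain ⟨t, ht, ht'⟩ := hP.isGreatest_cutoff hρ ((le_div_iff₀ hP.lo_pos).1 hρR)
  have hc := hP.check_spec hR
  refine ⟨t, ht.2 ⟨hc.1.1.1, hρR.trans hc.1.1.2⟩, ?_⟩
  rw [ht', mul_div_cancel_right₀ _ (hP.lo_pos.trans_le ht.1.1).ne']

theorem eq_check_of_ratio_eq (hP : P.Regular) (hR : 0 < P.R P.lo) (ht : P.check ≤ t)
    (h : P.Rext t / t = P.R P.lo / P.lo) : t = P.check := by
  rcases ht.eq_or_lt with rfl | hlt
  · rfl
  · exact absurd h (hP.ratio_lt hR hlt).ne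

/-- The only possible jump is just after `lo`. It matters only if `t = check = lo`, and then `R`
lies below the ray through `(lo, R lo)`, which excludes it. -/
theorem continuousOn_Rext (hP : P.Regular) (hR : 0 < P.R P.lo) (ht : P.check ≤ t) :
    ContinuousOn P.Rext (Ici t) := by
  have hlo := (hP.lo_le_check hR).trans ht
  rcases hlo.eq_or_lt with h | h
  · subst h
    have hc : P.check = P.lo := le_antisymm ht (hP.lo_le_check hR)
    intro θ hθ
    rcases (mem_Ici.1 hθ).eq_or_lt with rfl | hlt
    · refine continuousWithinAt_of_squeeze (G := fun _ => P.Rext P.lo) (fun ε hε => ?_)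
        (fun z hz => hP.monotoneOn_Rext self_mem_Ici hz hz) continuousWithinAt_const rfl
      refine ⟨P.R P.lo / P.lo, fun z hz => ?_⟩
      have hz' : P.lo ≤ z := hz
      rw [abs_of_nonneg (sub_nonneg.2 hz'), hP.Rext_lo]
      rcases hz'.eq_or_lt with rfl | hlt
      · rw [hP.Rext_lo]; simp [hε.le]
      · have := hP.lt_ratio_mul hR ht hlt
        rw [hP.Rext_lo] at this
        have e : P.R P.lo / P.lo * P.lo = P.R P.lo := div_mul_cancel₀ _ hP.lo_pos.ne'
        linarith
    · exact (hP.continuousOn_Rext_Ioi.continuousAt (Ioi_mem_nhds hlt)).continuousWithinAt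
  · exact hP.continuousOn_Rext_Ioi.mono (Ici_subset_Ioi.2 h)

theorem leftDeriv_Rext_le (hP : P.Regular) (hR : 0 < P.R P.lo) (ht : P.check ≤ t) (hθ : t < θ) :
    leftDeriv P.Rext θ ≤ P.Rext t / t := by
  have hlo := (hP.lo_le_check hR).trans ht
  have h1 := hP.concaveOn_Rext.leftDeriv_mul_le hlo (interior_Ici_lo (hlo.trans_lt hθ)) hθ
  have h2 := hP.lt_ratio_mul hR ht hθ
  have h3 := hP.ratio_mul hR ht
  exact le_of_mul_le_mul_right (by linarith) (sub_pos.2 hθ)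

/-- The fundamental theorem of calculus for the reservation workload after a cutoff. -/
theorem integral_leftDeriv_Rext (hP : P.Regular) (hR : 0 < P.R P.lo) (ht : P.check ≤ t)
    {p q : ℝ} (hp : t ≤ p) (hpq : p ≤ q) :
    IntervalIntegrable (leftDeriv P.Rext) volume p q ∧
      ∫ z in p..q, leftDeriv P.Rext z = P.Rext q - P.Rext p := by
  have hlo := (hP.lo_le_check hR).trans ht
  have hK : ConcaveOn ℝ (Icc p q) P.Rext :=
    hP.concaveOn_Rext.subset (fun z hz => hlo.trans (hp.trans hz.1)) (convex_Icc p q)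
  have hc : ContinuousOn P.Rext (Icc p q) :=
    (hP.continuousOn_Rext hR ht).mono fun z hz => hp.trans hz.1
  exact ⟨hK.intervalIntegrable_leftDeriv hpq hc, hK.integral_leftDeriv hpq hc⟩

end Check

end Regular
end InnerProgram

namespace InnerProgram

/-! ### Multipliers -/

/-- The marginal value of the initial slope of the workload at the multiplier `τ`. -/
def slopeValue (P : InnerProgram) (t τ : ℝ) : ℝ :=
  P.calWbar (min t P.starLow) - τ * min t P.starLow + P.wB * P.lo

/-- The level cuts of `W̄` between the cutoff `t` and `starLow`. -/
def cut (P : InnerProgram) (t : ℝ) : ℝ → ℝ := levelCut (min t P.starLow) P.starLow P.Wbar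

/-- `τ` is a multiplier that certifies the optimality of the cutoff `t`. -/
structure IsMultiplier (P : InnerProgram) (t τ : ℝ) : Prop where
  nonneg : 0 ≤ τ
  le_Wbar : ∀ z ∈ Ioo P.lo (min t P.starLow), τ ≤ P.Wbar z
  Wbar_le : ∀ z ∈ Ioo (min t P.starLow) P.hi, P.Wbar z ≤ τ
  le_starLow : 0 < τ → t ≤ P.starLow
  slopeValue_nonneg : 0 ≤ P.slopeValue t τ
  eq_check : 0 < P.slopeValue t τ → t = P.check
  pos : 0 < τ ∨ 0 < P.slopeValue t τ

/-- The upper bound on the relaxed program given by a multiplier. -/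
def dualValue (P : InnerProgram) (t τ : ℝ) : ℝ :=
  P.R P.lo / P.lo * P.slopeValue t τ + ∫ s in 0..τ, P.Rext (P.cut t s)

/-- The part of the threshold form that concerns types up to `starLow`. -/
structure IsThresholdBelow (P : InnerProgram) (t : ℝ) (a : ℝ → ℝ) (u : ℝ) : Prop where
  u_eq : u = P.Rext t / t * P.lo
  initial : ∀ θ ∈ Icc P.lo (min t P.starLow), a θ = P.Rext t / t
  middle : ∀ θ ∈ Ioc t P.starLow, a θ = leftDeriv P.Rext θ

namespace Regular

variable {P : InnerProgram} {t τ u : ℝ} {a : ℝ → ℝ}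

/-- Up to `sharpHigh`, `τ` is chosen so that `slopeValue` vanishes. Otherwise `t` is the corner
`check`, `slopeValue` is positive, and `τ` is `W̄ t` before `starLow` and `0` from there on. -/
theorem exists_isMultiplier (hP : P.Regular) (hR : 0 < P.R P.lo)
    (hpos : ¬ (P.wA ≤ 0 ∧ P.wB ≤ 0)) (ht : t ∈ P.cutoffs) : ∃ τ, P.IsMultiplier t τ := by
  have hM := hP.calWbar_starLow_add_pos hpos
  have hct : P.check ≤ t := (le_max_left _ _).trans ht.1
  have hlo := (hP.lo_le_check hR).trans hct
  have htpos := hP.pos_of_check_le hR hct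
  have hshs := hP.sharpHigh_le_starLow hpos
  have hs := hP.starLow_mem
  by_cases h1 : t ≤ P.sharpHigh
  · have h2 : P.sharpLow ≤ t := (le_max_right _ _).trans ht.1
    have hts := h1.trans hshs
    have hmin : min t P.starLow = t := min_eq_left hts
    have htI : t ∈ P.types := ⟨hlo, hts.trans hs.2⟩
    -- The slope of the line through `(0, -wB * lo)` and `(t, 𝒲̄ t)`. The signs of `tangentGap` on
    -- the two sides of `t` make it a supporting line.
    set τ := (P.wB * P.lo + P.calWbar t) / t with hτ
    have hτt : τ * t = P.wB * P.lo + P.calWbar t := div_mul_cancel₀ _ htpos.ne'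
    have hright : ∀ z ∈ Ioo t P.hi, P.Wbar z ≤ τ := by
      intro z hz
      have hsub : Ioo t z ⊆ P.types := fun y hy => ⟨hlo.trans hy.1.le, hy.2.le.trans hz.2.le⟩
      have hlim : Filter.Tendsto (fun y => P.wB * P.lo + P.calWbar y) (nhdsWithin t (Ioo t z))
          (nhds (P.wB * P.lo + P.calWbar t)) :=
        ((hP.continuousOn_calWbar t htI).mono hsub).const_add _
      have hlim2 : Filter.Tendsto (fun y => P.Wbar z * y) (nhdsWithin t (Ioo t z))
          (nhds (P.Wbar z * t)) :=
        ((continuous_const.mul continuous_id).tendsto t).mono_left nhdsWithin_le_nhds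
      have hne : (nhdsWithin t (Ioo t z)).NeBot := by
        rw [nhdsWithin_Ioo_eq_nhdsGT hz.1]
        infer_instance
      -- The sign of `tangentGap` is known only strictly after `t`, so the inequality at `t` is a
      -- limit from the right.
      have hle : P.Wbar z * t ≤ P.wB * P.lo + P.calWbar t := by
        refine le_of_tendsto_of_tendsto hlim2 hlim ?_
        filter_upwards [self_mem_nhdsWithin] with y hy
        have hyI : y ∈ Ioo P.lo P.hi := ⟨hlo.trans_lt hy.1, hy.2.trans hz.2⟩
        have h3 := hP.tangentGap_nonpos_of_lt hyI.2 (h2.trans_lt hy.1)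
        have h4 := hP.antitoneOn_Wbar hyI ⟨hyI.1.trans hy.2, hz.2⟩ hy.2.le
        rw [tangentGap] at h3
        have h5 := mul_le_mul_of_nonneg_left h4 (hP.lo_pos.trans hyI.1).le
        linarith
      rw [← hτt] at hle
      exact le_of_mul_le_mul_right hle htpos
    have hτpos : 0 < τ := by
      rcases hts.eq_or_lt with h | h
      · refine div_pos ?_ htpos
        rw [h]
        linarith
      · obtain ⟨z, hz⟩ := nonempty_Ioo.2 h
        exact (hP.Wbar_pos ⟨hlo.trans_lt hz.1, hz.2⟩).trans_le
          (hright z ⟨hz.1, hz.2.trans_le hs.2⟩)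
    have hκ : P.slopeValue t τ = 0 := by
      rw [slopeValue, hmin, hτt]
      ring
    refine ⟨τ, hτpos.le, fun z hz => ?_, by rwa [hmin], fun _ => hts, hκ.ge,
      fun h => absurd hκ h.ne', Or.inl hτpos⟩
    rw [hmin] at hz
    have hzI : z ∈ Ioo P.lo P.hi := ⟨hz.1, hz.2.trans_le htI.2⟩
    have h3 := hP.tangentGap_nonneg_of_lt hz.1 (hz.2.trans_le h1)
    have h4 := hP.calWbar_le_tangent hzI htI
    rw [tangentGap] at h3
    refine le_of_mul_le_mul_right ?_ htpos
    linarith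
  · have hlt := not_le.1 h1
    have htc : t = P.check := le_antisymm ((le_max_iff.1 ht.2).resolve_right h1) hct
    rcases lt_or_ge t P.starLow with h2 | h2
    · have hmin : min t P.starLow = t := min_eq_left h2.le
      have htI : t ∈ Ioo P.lo P.hi :=
        ⟨(le_csSup hP.bddAbove_sharpHigh (by simp)).trans_lt hlt, h2.trans_le hs.2⟩
      have hκ : 0 < P.slopeValue t (P.Wbar t) := by
        have : P.tangentGap t < 0 := by
          by_contra! hcon
          exact h1 (hP.le_sharpHigh htI hcon)
        rw [tangentGap] at this
        rw [slopeValue, hmin]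
        linarith
      refine ⟨P.Wbar t, (hP.Wbar_pos ⟨htI.1, h2⟩).le, fun z hz => ?_, fun z hz => ?_,
        fun _ => h2.le, hκ.le, fun _ => htc, Or.inr hκ⟩
      · rw [hmin] at hz
        exact hP.antitoneOn_Wbar ⟨hz.1, hz.2.trans htI.2⟩ htI hz.2.le
      · rw [hmin] at hz
        exact hP.antitoneOn_Wbar htI ⟨htI.1.trans hz.1, hz.2⟩ hz.1.le
    · have hmin : min t P.starLow = P.starLow := min_eq_right h2
      have hκ : 0 < P.slopeValue t 0 := by
        rw [slopeValue, hmin]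
        linarith
      refine ⟨0, le_rfl, fun z hz => ?_, fun z hz => ?_, fun h => absurd h (lt_irrefl _), hκ.le,
        fun _ => htc, Or.inr hκ⟩
      · rw [hmin] at hz
        exact (hP.Wbar_pos hz).le
      · rw [hmin] at hz
        exact hP.Wbar_nonpos hz

theorem min_starLow_mem (hP : P.Regular) (ht : P.lo ≤ t) : min t P.starLow ∈ P.types :=
  ⟨le_min ht hP.starLow_mem.1, (min_le_right _ _).trans hP.starLow_mem.2⟩

theorem cut_mem : ∀ {s : ℝ}, P.cut t s ∈ Icc (min t P.starLow) P.starLow :=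
  levelCut_mem (min_le_right _ _)

theorem cut_mem_types (hP : P.Regular) (ht : P.lo ≤ t) (s : ℝ) : P.cut t s ∈ P.types :=
  Icc_subset_Icc (hP.min_starLow_mem ht).1 hP.starLow_mem.2 cut_mem

theorem intervalIntegrable_comp_cut (hP : P.Regular) (ht : P.lo ≤ t) {K : ℝ → ℝ}
    (hK : MonotoneOn K P.types) : IntervalIntegrable (fun s => K (P.cut t s)) volume 0 τ := by
  refine AntitoneOn.intervalIntegrable fun s _ s' _ hs => ?_
  exact hK (hP.cut_mem_types ht s') (hP.cut_mem_types ht s)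
    (antitone_levelCut (min_le_right _ _) hs)

theorem _root_.InnerProgram.RelaxedFeasible.monotoneOn_workload (h : P.RelaxedFeasible a u)
    (hP : P.Regular) : MonotoneOn (P.workload a u) P.types := fun x hx y hy hxy => by
  have := hP.le_workload_sub h.ic u hx hy hxy
  have := mul_nonneg (h.a_nonneg y hy) (sub_nonneg.2 hxy)
  linarith

theorem monotoneOn_Rext_types (hP : P.Regular) : MonotoneOn P.Rext P.types :=
  hP.monotoneOn_Rext.mono fun _ hx => hx.1

/-- The objective of a feasible allocation in terms of a multiplier. -/
theorem objective_eq (hP : P.Regular) (ht : P.lo ≤ t) (hm : P.IsMultiplier t τ)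
    (h : P.RelaxedFeasible a u) :
    P.objective P.Wbar a u = u / P.lo * P.slopeValue t τ
      + (∫ s in 0..τ, P.workload a u (P.cut t s))
      - (∫ z in P.lo..min t P.starLow, (u / P.lo - a z) * (P.Wbar z - τ))
      - ∫ z in P.starLow..P.hi, a z * (-P.Wbar z) := by
  have hp := hP.min_starLow_mem ht
  have hs := hP.starLow_mem
  have hps : min t P.starLow ≤ P.starLow := min_le_right _ _
  set p := min t P.starLow with hpdef
  have hw {x y : ℝ} (hx : x ∈ P.types) (hy : y ∈ P.types) := hP.intervalIntegrable_Wbar hx hy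
  have haw : IntervalIntegrable (fun z => a z * P.Wbar z) volume P.lo P.hi :=
    h.ic.intervalIntegrable_mul hP.lt.le (hw hP.lo_mem hP.hi_mem)
  have i1 : IntervalIntegrable (fun z => a z * P.Wbar z) volume P.lo p :=
    haw.mono_set (hP.uIcc_subset hP.lo_mem hp)
  have i2 : IntervalIntegrable (fun z => a z * P.Wbar z) volume p P.starLow :=
    haw.mono_set (hP.uIcc_subset hp hs)
  have i3 : IntervalIntegrable (fun z => a z * P.Wbar z) volume P.starLow P.hi :=
    haw.mono_set (hP.uIcc_subset hs hP.hi_mem)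
  have e1 : ∫ z in P.lo..P.hi, a z * P.Wbar z = (∫ z in P.lo..p, a z * P.Wbar z) +
      (∫ z in p..P.starLow, a z * P.Wbar z) + ∫ z in P.starLow..P.hi, a z * P.Wbar z := by
    rw [intervalIntegral.integral_add_adjacent_intervals i1 i2,
      intervalIntegral.integral_add_adjacent_intervals (i1.trans i2) i3]
  have j1 := hw hP.lo_mem hp
  have j2 := h.intervalIntegrable hP hP.lo_mem hp
  have haI := h.intervalIntegrable hP hP.lo_mem hP.hi_mem
  -- Before the cutoff, `a * W̄ = u / lo * (W̄ - τ) - (u / lo - a) * (W̄ - τ) + τ * a`. The last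
  -- term integrates to an increment of the workload and cancels against the layer cake that
  -- follows.
  have e2 : ∫ z in P.lo..p, (u / P.lo - a z) * (P.Wbar z - τ) =
      u / P.lo * (P.calWbar p - τ * (p - P.lo)) - (∫ z in P.lo..p, a z * P.Wbar z) +
        τ * (P.workload a u p - u) := by
    have : ∫ z in P.lo..p, (u / P.lo - a z) * (P.Wbar z - τ) =
        ∫ z in P.lo..p, (u / P.lo * (P.Wbar z - τ) - a z * P.Wbar z + τ * a z) :=
      intervalIntegral.integral_congr fun z _ => by ring
    rw [this, intervalIntegral.integral_add
      (((j1.sub intervalIntegrable_const).const_mul _).sub i1) (j2.const_mul _),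
      intervalIntegral.integral_sub ((j1.sub intervalIntegrable_const).const_mul _) i1,
      intervalIntegral.integral_const_mul, intervalIntegral.integral_const_mul,
      intervalIntegral.integral_sub j1 intervalIntegrable_const, hP.integral_Wbar hP.lo_mem hp hp.1,
      hP.calWbar_lo, intervalIntegral.integral_const, ← hP.workload_sub haI u hP.lo_mem hp,
      workload_lo, smul_eq_mul]
    ring
  have hWI : Ioo p P.starLow ⊆ Ioo P.lo P.hi := Ioo_subset_Ioo hp.1 hs.2
  -- Here the weight `W̄`, with values in `[0, τ]`, is sliced into levels, and the primitive of `a`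
  -- is evaluated at its cuts.
  have e3 := integral_mul_antitone hps hm.nonneg (hP.antitoneOn_Wbar.mono hWI)
    (fun x hx => ⟨(hP.Wbar_pos ⟨(hWI hx).1, hx.2⟩).le, hm.Wbar_le x ⟨hx.1, (hWI hx).2⟩⟩)
    (h.intervalIntegrable hP hp hs)
  have e4 : ∀ s, ∫ z in p..levelCut p P.starLow P.Wbar s, a z =
      P.workload a u (P.cut t s) - P.workload a u p := fun s =>
    (hP.workload_sub haI u hp (hP.cut_mem_types ht s)).symm
  simp only [e4] at e3
  rw [intervalIntegral.integral_sub (hP.intervalIntegrable_comp_cut ht (h.monotoneOn_workload hP))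
    intervalIntegrable_const, intervalIntegral.integral_const, sub_zero, smul_eq_mul] at e3
  have e5 : ∫ z in P.starLow..P.hi, a z * (-P.Wbar z) =
      -∫ z in P.starLow..P.hi, a z * P.Wbar z := by
    rw [← intervalIntegral.integral_neg]
    exact intervalIntegral.integral_congr fun z _ => by ring
  rw [objective, e1, e2, e3, e5, slopeValue, ← hpdef]
  have hlo := hP.lo_pos.ne'
  field_simp
  ring

end Regular
end InnerProgram

/-! ### Weak duality and complementary slackness -/

namespace InnerProgram
namespace Regular

variable {P : InnerProgram} {t τ u : ℝ} {a : ℝ → ℝ}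

theorem slope_slack_nonneg (hP : P.Regular) (hm : P.IsMultiplier t τ)
    (h : P.RelaxedFeasible a u) : 0 ≤ (P.R P.lo / P.lo - u / P.lo) * P.slopeValue t τ :=
  mul_nonneg (sub_nonneg.2 (div_le_div_of_nonneg_right (h.u_le hP) hP.lo_pos.le))
    hm.slopeValue_nonneg

theorem workload_slack_nonneg (h : P.RelaxedFeasible a u) {θ : ℝ}
    (hθ : θ ∈ P.types) : 0 ≤ P.Rext θ - P.workload a u θ := by
  rw [Rext_of_le hθ.2]
  exact sub_nonneg.2 (h.ir θ hθ)

theorem initial_slack_nonneg (hP : P.Regular) (ht : P.lo ≤ t) (hm : P.IsMultiplier t τ)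
    (h : P.RelaxedFeasible a u) {z : ℝ} (hz : z ∈ Ioo P.lo (min t P.starLow)) :
    0 ≤ (u / P.lo - a z) * (P.Wbar z - τ) :=
  mul_nonneg (sub_nonneg.2 (h.le_div hP ⟨hz.1.le, hz.2.le.trans (hP.min_starLow_mem ht).2⟩))
    (sub_nonneg.2 (hm.le_Wbar z hz))

theorem final_slack_nonneg (hP : P.Regular) (h : P.RelaxedFeasible a u) {z : ℝ}
    (hz : z ∈ Ioo P.starLow P.hi) : 0 ≤ a z * (-P.Wbar z) :=
  mul_nonneg (h.a_nonneg z ⟨hP.starLow_mem.1.trans hz.1.le, hz.2.le⟩)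
    (neg_nonneg.2 (hP.Wbar_nonpos hz))

theorem intervalIntegrable_workload_slack (hP : P.Regular) (ht : P.lo ≤ t)
    (h : P.RelaxedFeasible a u) :
    IntervalIntegrable (fun s => P.Rext (P.cut t s) - P.workload a u (P.cut t s)) volume 0 τ :=
  (hP.intervalIntegrable_comp_cut ht hP.monotoneOn_Rext_types).sub
    (hP.intervalIntegrable_comp_cut ht (h.monotoneOn_workload hP))

/-- The duality gap, term by term: the slacks of `u ≤ R lo`, of the workload below `R`, of `a ≤ u /
lo` and of `a ≥ 0`, each weighted by a non-negative multiplier. -/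
theorem dualValue_sub_objective (hP : P.Regular) (ht : P.lo ≤ t) (hm : P.IsMultiplier t τ)
    (h : P.RelaxedFeasible a u) :
    P.dualValue t τ - P.objective P.Wbar a u = (P.R P.lo / P.lo - u / P.lo) * P.slopeValue t τ
      + (∫ s in 0..τ, (P.Rext (P.cut t s) - P.workload a u (P.cut t s)))
      + (∫ z in P.lo..min t P.starLow, (u / P.lo - a z) * (P.Wbar z - τ))
      + ∫ z in P.starLow..P.hi, a z * (-P.Wbar z) := by
  rw [dualValue, hP.objective_eq ht hm h, intervalIntegral.integral_sub
    (hP.intervalIntegrable_comp_cut ht hP.monotoneOn_Rext_types)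
    (hP.intervalIntegrable_comp_cut ht (h.monotoneOn_workload hP))]
  ring

theorem integral_slacks_nonneg (hP : P.Regular) (ht : P.lo ≤ t) (hm : P.IsMultiplier t τ)
    (h : P.RelaxedFeasible a u) :
    0 ≤ (∫ s in 0..τ, (P.Rext (P.cut t s) - P.workload a u (P.cut t s))) ∧
    0 ≤ (∫ z in P.lo..min t P.starLow, (u / P.lo - a z) * (P.Wbar z - τ)) ∧
    0 ≤ ∫ z in P.starLow..P.hi, a z * (-P.Wbar z) :=
  ⟨integral_nonneg_Ioo hm.nonneg fun s _ => workload_slack_nonneg h (hP.cut_mem_types ht s),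
    integral_nonneg_Ioo (hP.min_starLow_mem ht).1 fun _ hz => hP.initial_slack_nonneg ht hm h hz,
    integral_nonneg_Ioo hP.starLow_mem.2 fun _ hz => hP.final_slack_nonneg h hz⟩

theorem objective_le_dualValue (hP : P.Regular) (ht : P.lo ≤ t) (hm : P.IsMultiplier t τ)
    (h : P.RelaxedFeasible a u) : P.objective P.Wbar a u ≤ P.dualValue t τ := by
  obtain ⟨h1, h2, h3⟩ := hP.integral_slacks_nonneg ht hm h
  have := hP.dualValue_sub_objective ht hm h
  have := hP.slope_slack_nonneg hm h
  linarith

/-- Complementary slackness. -/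
theorem slackness (hP : P.Regular) (ht : P.lo ≤ t) (hm : P.IsMultiplier t τ)
    (h : P.RelaxedFeasible a u) (heq : P.objective P.Wbar a u = P.dualValue t τ) :
    (0 < P.slopeValue t τ → u = P.R P.lo) ∧
    (∀ᵐ s, s ∈ Ioo 0 τ → P.workload a u (P.cut t s) = P.Rext (P.cut t s)) ∧
    (∀ᵐ z, z ∈ Ioo P.lo (min t P.starLow) → τ < P.Wbar z → a z = u / P.lo) ∧
    (∀ᵐ z, z ∈ Ioo P.starLow P.hi → P.Wbar z < 0 → a z = 0) := by
  obtain ⟨h1, h2, h3⟩ := hP.integral_slacks_nonneg ht hm h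
  have h4 := hP.dualValue_sub_objective ht hm h
  have h5 := hP.slope_slack_nonneg hm h
  rw [heq, sub_self] at h4
  have hp := hP.min_starLow_mem ht
  refine ⟨fun hκ => ?_, ?_, ?_, ?_⟩
  · have h6 : (P.R P.lo / P.lo - u / P.lo) * P.slopeValue t τ = 0 := by linarith
    have h7 := (mul_eq_zero.1 h6).resolve_right hκ.ne'
    rw [← sub_div, div_eq_zero_iff] at h7
    linarith [h7.resolve_right hP.lo_pos.ne']
  · have := ae_eq_zero_of_integral_eq_zero_Ioo hm.nonneg
      (hP.intervalIntegrable_workload_slack ht h)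
      (fun s _ => workload_slack_nonneg h (hP.cut_mem_types ht s)) (by linarith)
    filter_upwards [this] with s hs hsI
    linarith [hs hsI]
  · have hint : IntervalIntegrable (fun z => (u / P.lo - a z) * (P.Wbar z - τ)) volume P.lo
        (min t P.starLow) := by
      have hb : AntitoneOn (fun z => a z - u / P.lo) (Icc P.lo (min t P.starLow)) :=
        fun x hx y hy hxy => sub_le_sub_right (h.ic ⟨hx.1, hx.2.trans hp.2⟩
          ⟨hy.1, hy.2.trans hp.2⟩ hxy) _
      refine (hb.intervalIntegrable_mul hp.1 ((hP.intervalIntegrable_Wbar hP.lo_mem hp).sub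
        (intervalIntegrable_const (c := τ)))).neg.congr fun z _ => ?_
      simp only [Pi.neg_apply]
      ring
    have := ae_eq_zero_of_integral_eq_zero_Ioo hp.1 hint
      (fun z hz => hP.initial_slack_nonneg ht hm h hz) (by linarith)
    filter_upwards [this] with z hz hzI hτ
    have := (mul_eq_zero.1 (hz hzI)).resolve_right (sub_pos.2 hτ).ne'
    linarith
  · have hs := hP.starLow_mem
    have hint : IntervalIntegrable (fun z => a z * (-P.Wbar z)) volume P.starLow P.hi :=
      AntitoneOn.intervalIntegrable_mul hs.2 (h.ic.mono (Icc_subset_Icc_left hs.1))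
        (hP.intervalIntegrable_Wbar hs hP.hi_mem).neg
    have := ae_eq_zero_of_integral_eq_zero_Ioo hs.2 hint
      (fun z hz => hP.final_slack_nonneg h hz) (by linarith)
    filter_upwards [this] with z hz hzI hw
    exact (mul_eq_zero.1 (hz hzI)).resolve_right (neg_pos.2 hw).ne'

/-- Excludes solutions with `u = 0`, whose value is `0`. -/
theorem dualValue_pos (hP : P.Regular) (hR : 0 < P.R P.lo) (ht : P.lo ≤ t)
    (hm : P.IsMultiplier t τ) : 0 < P.dualValue t τ := by
  have h1 : 0 < P.R P.lo / P.lo := div_pos hR hP.lo_pos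
  have h2 : τ * P.R P.lo ≤ ∫ s in 0..τ, P.Rext (P.cut t s) := by
    have := intervalIntegral.integral_mono_on hm.nonneg (intervalIntegrable_const (c := P.R P.lo))
      (hP.intervalIntegrable_comp_cut ht hP.monotoneOn_Rext_types) fun s _ => by
        rw [← hP.Rext_lo]
        exact hP.monotoneOn_Rext_types hP.lo_mem (hP.cut_mem_types ht s) (hP.cut_mem_types ht s).1
    simpa using this
  rw [dualValue]
  rcases hm.pos with h | h
  · have := mul_pos h hR
    have := mul_nonneg h1.le hm.slopeValue_nonneg
    linarith
  · have := mul_pos h1 h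
    have := mul_nonneg hm.nonneg hR.le
    linarith

/-! ### Threshold forms -/

theorem _root_.InnerProgram.ThresholdForm.below (hP : P.Regular)
    (h : P.ThresholdForm t a u) : P.IsThresholdBelow t a u := by
  have hu : u = P.Rext t / t * P.lo := by rw [h.u_eq]; ring
  refine ⟨hu, fun θ hθ => ?_, fun θ hθ => ?_⟩
  · rw [h.initial θ hθ, hu, mul_div_cancel_right₀ _ hP.lo_pos.ne']
  · rw [h.middle θ hθ, leftDeriv_Rext (hθ.2.trans hP.starLow_mem.2)]

section Below

theorem workload_initial (h : P.IsThresholdBelow t a u) {θ : ℝ}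
    (hθ : θ ∈ Icc P.lo (min t P.starLow)) : P.workload a u θ = P.Rext t / t * θ := by
  rw [workload, integral_congr_Ioo hθ.1 (g := fun _ => P.Rext t / t)
    fun z hz => h.initial z ⟨hz.1.le, hz.2.le.trans hθ.2⟩, intervalIntegral.integral_const, h.u_eq,
    smul_eq_mul]
  ring

theorem intervalIntegrable_below (hP : P.Regular) (hR : 0 < P.R P.lo) (ht : P.check ≤ t)
    (h : P.IsThresholdBelow t a u) : IntervalIntegrable a volume P.lo P.starLow := by
  have hlo := (hP.lo_le_check hR).trans ht
  have hp := hP.min_starLow_mem hlo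
  have h1 : IntervalIntegrable a volume P.lo (min t P.starLow) := by
    refine IntervalIntegrable.congr (f := fun _ => P.Rext t / t) (fun z hz => ?_)
      intervalIntegrable_const
    rw [uIoc_of_le hp.1] at hz
    exact (h.initial z ⟨hz.1.le, hz.2⟩).symm
  refine h1.trans ?_
  rcases le_total t P.starLow with hts | hts
  · rw [min_eq_left hts]
    refine IntervalIntegrable.congr (f := leftDeriv P.Rext) (fun z hz => ?_)
      (hP.integral_leftDeriv_Rext hR ht le_rfl hts).1
    rw [uIoc_of_le hts] at hz
    exact (h.middle z hz).symm
  · rw [min_eq_right hts]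

theorem workload_middle (hP : P.Regular) (hR : 0 < P.R P.lo) (ht : P.check ≤ t)
    (h : P.IsThresholdBelow t a u) {θ : ℝ} (hθ : θ ∈ Icc t P.starLow) :
    P.workload a u θ = P.Rext θ := by
  have hlo := (hP.lo_le_check hR).trans ht
  have hts := hθ.1.trans hθ.2
  have hI := hP.intervalIntegrable_below hR ht h
  have h0 := workload_initial h (θ := t) ⟨hlo, le_min le_rfl hts⟩
  rw [hP.ratio_mul hR ht] at h0
  have h1 : IntervalIntegrable a volume P.lo t := hI.mono_set (by
    rw [uIcc_of_le hlo, uIcc_of_le (hlo.trans hts)]; exact Icc_subset_Icc_right hts)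
  have h2 : IntervalIntegrable a volume t θ := hI.mono_set (by
    rw [uIcc_of_le hθ.1, uIcc_of_le (hlo.trans hts)]; exact Icc_subset_Icc hlo hθ.2)
  have h3 : ∫ z in t..θ, a z = P.Rext θ - P.Rext t := by
    rw [← (hP.integral_leftDeriv_Rext hR ht le_rfl hθ.1).2]
    exact integral_congr_Ioo hθ.1 fun z hz => h.middle z ⟨hz.1, hz.2.le.trans hθ.2⟩
  rw [workload, ← intervalIntegral.integral_add_adjacent_intervals h1 h2, h3]
  rw [workload] at h0
  linarith

/-- The workload follows the ray up to `t` and `R` afterwards, and `t` is where the ray passes above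
`R`. So it is the largest workload that both bounds permit for this `u`. -/
theorem workload_below (hP : P.Regular) (hR : 0 < P.R P.lo) (ht : P.check ≤ t)
    (h : P.IsThresholdBelow t a u) {θ : ℝ} (hθ : θ ∈ Icc P.lo P.starLow) :
    P.workload a u θ = min (P.Rext t / t * θ) (P.Rext θ) := by
  rcases le_total θ t with hts | hts
  · rw [workload_initial h ⟨hθ.1, le_min hts hθ.2⟩, min_eq_left]
    exact hP.ratio_mul_le hR ht hθ.1 hts
  · rw [hP.workload_middle hR ht h ⟨hts, hθ.2⟩, min_eq_right]
    rcases hts.eq_or_lt with h1 | h1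
    · rw [← h1, hP.ratio_mul hR ht]
    · exact (hP.lt_ratio_mul hR ht h1).le

theorem workload_below_le (hP : P.Regular) (hR : 0 < P.R P.lo) (ht : P.check ≤ t)
    (h : P.IsThresholdBelow t a u) {θ : ℝ} (hθ : θ ∈ Icc P.lo P.starLow) :
    P.workload a u θ ≤ P.R θ := by
  rw [← Rext_of_le (hθ.2.trans hP.starLow_mem.2), hP.workload_below hR ht h hθ]
  exact min_le_right _ _

theorem antitoneOn_below (hP : P.Regular) (hR : 0 < P.R P.lo) (ht : P.check ≤ t)
    (h : P.IsThresholdBelow t a u) : AntitoneOn a (Icc P.lo P.starLow) := by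
  have hlo := (hP.lo_le_check hR).trans ht
  intro x hx y hy hxy
  rcases le_or_gt y t with h1 | h1
  · rw [h.initial x ⟨hx.1, le_min (hxy.trans h1) hx.2⟩, h.initial y ⟨hy.1, le_min h1 hy.2⟩]
  · rw [h.middle y ⟨h1, hy.2⟩]
    rcases le_or_gt x t with h2 | h2
    · rw [h.initial x ⟨hx.1, le_min h2 hx.2⟩]
      exact hP.leftDeriv_Rext_le hR ht h1
    · rw [h.middle x ⟨h2, hx.2⟩]
      exact hP.concaveOn_Rext.antitoneOn_leftDeriv (interior_Ici_lo (hlo.trans_lt h2))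
        (interior_Ici_lo (hlo.trans_lt h1)) hxy

theorem below_nonneg (hP : P.Regular) (hR : 0 < P.R P.lo) (ht : P.check ≤ t)
    (h : P.IsThresholdBelow t a u) {θ : ℝ} (hθ : θ ∈ Icc P.lo P.starLow) : 0 ≤ a θ := by
  rcases le_or_gt θ t with h1 | h1
  · rw [h.initial θ ⟨hθ.1, le_min h1 hθ.2⟩]
    exact (hP.ratio_pos hR ht).le
  · rw [h.middle θ ⟨h1, hθ.2⟩]
    exact hP.leftDeriv_Rext_nonneg (((hP.lo_le_check hR).trans ht).trans_lt h1)

end Below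

theorem _root_.InnerProgram.ThresholdForm.relaxedFeasible (h : P.ThresholdForm t a u)
    (hP : P.Regular) (hR : 0 < P.R P.lo) (ht : P.check ≤ t) : P.RelaxedFeasible a u := by
  have hb := h.below hP
  have hlo := (hP.lo_le_check hR).trans ht
  have hs := hP.starLow_mem
  have hs' := hP.starHigh_mem
  have hss := hP.starLow_le_starHigh
  have hnn : ∀ θ ∈ P.types, 0 ≤ a θ := fun θ hθ => by
    rcases le_or_gt θ P.starLow with h1 | h1
    · exact hP.below_nonneg hR ht hb ⟨hθ.1, h1⟩
    rcases le_or_gt θ P.starHigh with h2 | h2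
    · exact h.free_nonneg θ ⟨h1, h2⟩
    · exact (h.final θ ⟨h2, hθ.2⟩).ge
  have hanti : AntitoneOn a P.types := by
    have h1 := (hP.antitoneOn_below hR ht hb).union_right h.free_antitone
      (isGreatest_Icc hs.1) (isLeast_Icc hss)
    rw [Icc_union_Icc_eq_Icc hs.1 hss] at h1
    have h2 : AntitoneOn a (Icc P.starHigh P.hi) := by
      intro x hx y hy hxy
      rcases hxy.eq_or_lt with rfl | hlt
      · rfl
      · rw [h.final y ⟨hx.1.trans_lt hlt, hy.2⟩]
        exact hnn x ⟨hs'.1.trans hx.1, hx.2⟩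
    have h3 := h1.union_right h2 (isGreatest_Icc hs'.1) (isLeast_Icc hs'.2)
    rwa [Icc_union_Icc_eq_Icc hs'.1 hs'.2] at h3
  have hirHigh : ∀ θ ∈ Icc P.lo P.starHigh, P.workload a u θ ≤ P.R θ := fun θ hθ => by
    rcases le_or_gt θ P.starLow with h1 | h1
    · exact hP.workload_below_le hR ht hb ⟨hθ.1, h1⟩
    · exact h.free_ir θ ⟨h1, hθ.2⟩
  refine ⟨hnn, ?_, hanti, fun θ hθ => ?_, ?_⟩
  · rw [hb.u_eq]
    exact mul_nonneg (hP.ratio_pos hR ht).le hP.lo_pos.le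
  · rcases le_or_gt θ P.starHigh with h1 | h1
    · exact hirHigh θ ⟨hθ.1, h1⟩
    -- After `starHigh` the workload is constant while `R` does not decrease.
    · have e := hP.workload_sub
        (hP.intervalIntegrable_of_antitoneOn hanti hP.lo_mem hP.hi_mem) u hs' hθ
      rw [integral_congr_Ioo h1.le (g := fun _ => (0 : ℝ))
        fun z hz => h.final z ⟨hz.1, hz.2.le.trans hθ.2⟩, intervalIntegral.integral_zero] at e
      have h2 := hirHigh _ (right_mem_Icc.2 hs'.1)
      have h3 := hP.R_mono hs' hθ h1.le
      linarith
  · rw [hb.initial P.lo ⟨le_rfl, le_min hlo hs.1⟩, hb.u_eq]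
    simp

/-- After `starLow`, a threshold form contributes nothing to the relaxed objective. -/
theorem _root_.InnerProgram.ThresholdForm.mul_Wbar_eq_zero (h : P.ThresholdForm t a u)
    (hP : P.Regular) {z : ℝ} (hz : z ∈ Ioo P.starLow P.hi) : a z * P.Wbar z = 0 := by
  rcases le_or_gt z P.starHigh with h1 | h1
  · rw [hP.Wbar_eq_zero ⟨hz.1, h1⟩, mul_zero]
  · rw [h.final z ⟨h1, hz.2.le⟩, zero_mul]

theorem _root_.InnerProgram.ThresholdForm.objective_eq_cutoffObjective
    (h : P.ThresholdForm t a u) (hP : P.Regular) (hR : 0 < P.R P.lo) (ht : P.check ≤ t) :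
    P.objective P.Wbar a u = P.cutoffObjective t := by
  have hf := h.relaxedFeasible hP hR ht
  have hb := h.below hP
  have hlo := (hP.lo_le_check hR).trans ht
  have hp := hP.min_starLow_mem hlo
  have hs := hP.starLow_mem
  have haw : IntervalIntegrable (fun z => a z * P.Wbar z) volume P.lo P.hi :=
    hf.ic.intervalIntegrable_mul hP.lt.le (hP.intervalIntegrable_Wbar hP.lo_mem hP.hi_mem)
  have i1 := haw.mono_set (hP.uIcc_subset hP.lo_mem hp)
  have i2 := haw.mono_set (hP.uIcc_subset hp hs)
  have i3 := haw.mono_set (hP.uIcc_subset hs hP.hi_mem)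
  have e1 : ∫ z in P.lo..min t P.starLow, a z * P.Wbar z =
      P.Rext t / t * P.calWbar (min t P.starLow) := by
    rw [integral_congr_Ioo hp.1 (g := fun z => P.Rext t / t * P.Wbar z)
      fun z hz => by rw [hb.initial z ⟨hz.1.le, hz.2.le⟩], intervalIntegral.integral_const_mul,
      hP.integral_Wbar hP.lo_mem hp hp.1, hP.calWbar_lo, sub_zero]
  have e2 : ∫ z in (min t P.starLow)..P.starLow, a z * P.Wbar z =
      ∫ z in (min t P.starLow)..P.starLow, P.Wbar z * leftDeriv P.R z := by
    refine integral_congr_Ioo (min_le_right _ _) fun z hz => ?_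
    have htz : t < z := (min_lt_iff.1 hz.1).resolve_right hz.2.not_gt
    rw [h.middle z ⟨htz, hz.2.le⟩, mul_comm]
  have e3 : ∫ z in P.starLow..P.hi, a z * P.Wbar z = 0 := by
    rw [integral_congr_Ioo hs.2 (g := fun _ => (0 : ℝ)) fun z hz => h.mul_Wbar_eq_zero hP hz,
      intervalIntegral.integral_zero]
  rw [objective, ← intervalIntegral.integral_add_adjacent_intervals (i1.trans i2) i3,
    ← intervalIntegral.integral_add_adjacent_intervals i1 i2, e1, e2, e3, cutoffObjective, hb.u_eq]
  ring

/-- All four slacks vanish: a positive `slopeValue` forces `t = check`, where `u = R lo`; the cuts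
lie in `[t, starLow]`, where the workload equals `R`; initially `a = u / lo`; and `a * W̄ = 0` after
`starLow`. -/
theorem _root_.InnerProgram.ThresholdForm.objective_eq_dualValue
    (h : P.ThresholdForm t a u) (hP : P.Regular) (hR : 0 < P.R P.lo) (ht : P.check ≤ t)
    (hm : P.IsMultiplier t τ) : P.objective P.Wbar a u = P.dualValue t τ := by
  have hf := h.relaxedFeasible hP hR ht
  have hb := h.below hP
  have hlo := (hP.lo_le_check hR).trans ht
  have hp := hP.min_starLow_mem hlo
  have hs := hP.starLow_mem
  have hu : u / P.lo = P.Rext t / t := by rw [hb.u_eq, mul_div_cancel_right₀ _ hP.lo_pos.ne']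
  have e1 : (P.R P.lo / P.lo - u / P.lo) * P.slopeValue t τ = 0 := by
    rcases hm.slopeValue_nonneg.eq_or_lt with h1 | h1
    · rw [← h1, mul_zero]
    · rw [hu, hm.eq_check h1, hP.ratio_check hR, sub_self, zero_mul]
  have e2 : ∫ s in 0..τ, (P.Rext (P.cut t s) - P.workload a u (P.cut t s)) = 0 := by
    rcases hm.nonneg.eq_or_lt with h1 | h1
    · rw [← h1, intervalIntegral.integral_same]
    · have hts := hm.le_starLow h1
      rw [integral_congr_Ioo h1.le (g := fun _ => (0 : ℝ)) fun s _ => ?_,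
        intervalIntegral.integral_zero]
      have hc := cut_mem (P := P) (t := t) (s := s)
      rw [min_eq_left hts] at hc
      rw [hP.workload_middle hR ht hb hc, sub_self]
  have e3 : ∫ z in P.lo..min t P.starLow, (u / P.lo - a z) * (P.Wbar z - τ) = 0 := by
    rw [integral_congr_Ioo hp.1 (g := fun _ => (0 : ℝ)) fun z hz => by
      rw [hb.initial z ⟨hz.1.le, hz.2.le⟩, hu, sub_self, zero_mul], intervalIntegral.integral_zero]
  have e4 : ∫ z in P.starLow..P.hi, a z * (-P.Wbar z) = 0 := by
    rw [integral_congr_Ioo hs.2 (g := fun _ => (0 : ℝ)) fun z hz => by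
      rw [mul_neg, h.mul_Wbar_eq_zero hP hz, neg_zero], intervalIntegral.integral_zero]
  have := hP.dualValue_sub_objective hlo hm hf
  rw [e1, e2, e3, e4] at this
  linarith

theorem check_le_of_mem_cutoffs (ht : t ∈ P.cutoffs) : P.check ≤ t :=
  (le_max_left _ _).trans ht.1

theorem _root_.InnerProgram.ThresholdForm.isRelaxedSolution (h : P.ThresholdForm t a u)
    (hP : P.Regular) (hR : 0 < P.R P.lo) (hpos : ¬ (P.wA ≤ 0 ∧ P.wB ≤ 0)) (ht : t ∈ P.cutoffs) :
    P.IsRelaxedSolution a u := by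
  obtain ⟨τ, hm⟩ := hP.exists_isMultiplier hR hpos ht
  have hct := check_le_of_mem_cutoffs ht
  refine ⟨h.relaxedFeasible hP hR hct, fun a' u' h' => ?_⟩
  rw [h.objective_eq_dualValue hP hR hct hm]
  exact hP.objective_le_dualValue ((hP.lo_le_check hR).trans hct) hm h'

/-! ### Existence of threshold forms and the value of the relaxed program -/

/-- The threshold form with cutoff `t`, continued by `c` after `starLow`. -/
def _root_.InnerProgram.thresholdAlloc (P : InnerProgram) (t : ℝ) (c : ℝ → ℝ) (θ : ℝ) : ℝ :=
  if P.starLow < θ then c θ else if t < θ then leftDeriv P.R θ else P.Rext t / t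

theorem thresholdAlloc_of_gt (c : ℝ → ℝ) {θ : ℝ} (hθ : P.starLow < θ) :
    P.thresholdAlloc t c θ = c θ := by rw [thresholdAlloc, if_pos hθ]

theorem thresholdAlloc_below (hP : P.Regular) (t : ℝ) (c : ℝ → ℝ) :
    P.IsThresholdBelow t (P.thresholdAlloc t c) (P.Rext t / t * P.lo) := by
  refine ⟨rfl, fun θ hθ => ?_, fun θ hθ => ?_⟩
  · rw [thresholdAlloc, if_neg (hθ.2.trans (min_le_right _ _)).not_gt,
      if_neg (hθ.2.trans (min_le_left _ _)).not_gt]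
  · rw [thresholdAlloc, if_neg hθ.2.not_gt, if_pos hθ.1,
      leftDeriv_Rext (hθ.2.trans hP.starLow_mem.2)]

theorem workload_thresholdAlloc (hP : P.Regular) (hR : 0 < P.R P.lo) (ht : P.check ≤ t)
    {c : ℝ → ℝ} (hc : IntervalIntegrable c volume P.starLow P.hi) {θ : ℝ}
    (hθ : θ ∈ Icc P.starLow P.hi) :
    P.workload (P.thresholdAlloc t c) (P.Rext t / t * P.lo) θ =
      min (P.Rext t / t * P.starLow) (P.Rext P.starLow) + ∫ z in P.starLow..θ, c z := by
  have hb := hP.thresholdAlloc_below t c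
  have hcθ : IntervalIntegrable c volume P.starLow θ := hc.mono_set (by
    rw [uIcc_of_le hθ.1, uIcc_of_le (hθ.1.trans hθ.2)]; exact Icc_subset_Icc_right hθ.2)
  have h2 : IntervalIntegrable (P.thresholdAlloc t c) volume P.starLow θ := by
    refine hcθ.congr fun z hz => ?_
    rw [uIoc_of_le hθ.1] at hz
    exact (thresholdAlloc_of_gt c hz.1).symm
  rw [← hP.workload_below hR ht hb (right_mem_Icc.2 hP.starLow_mem.1), workload, workload,
    ← intervalIntegral.integral_add_adjacent_intervals (hP.intervalIntegrable_below hR ht hb) h2,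
    integral_congr_Ioo hθ.1 (g := c) fun z hz => thresholdAlloc_of_gt c hz.1, add_assoc]

theorem thresholdForm_thresholdAlloc (hP : P.Regular) (hR : 0 < P.R P.lo) (ht : P.check ≤ t)
    {c : ℝ → ℝ} (hc : IntervalIntegrable c volume P.starLow P.hi)
    (hanti : AntitoneOn c (Ioc P.starLow P.starHigh))
    (hnn : ∀ θ ∈ Ioc P.starLow P.starHigh, 0 ≤ c θ)
    (hstar : ∀ θ ∈ Ioc P.starLow P.starHigh, c θ ≤ P.thresholdAlloc t c P.starLow)
    (hir : ∀ θ ∈ Ioc P.starLow P.starHigh,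
      min (P.Rext t / t * P.starLow) (P.Rext P.starLow) + (∫ z in P.starLow..θ, c z) ≤ P.R θ)
    (hfin : ∀ θ ∈ Ioc P.starHigh P.hi, c θ = 0) :
    P.ThresholdForm t (P.thresholdAlloc t c) (P.Rext t / t * P.lo) := by
  have hb := hP.thresholdAlloc_below t c
  refine ⟨by ring, fun θ hθ => ?_, fun θ hθ => ?_, fun x hx y hy hxy => ?_, fun θ hθ => ?_,
    fun θ hθ => ?_, fun θ hθ => ?_⟩
  · rw [hb.initial θ hθ, mul_div_cancel_right₀ _ hP.lo_pos.ne']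
  · rw [hb.middle θ hθ, leftDeriv_Rext (hθ.2.trans hP.starLow_mem.2)]
  · rcases hx.1.eq_or_lt with rfl | h1
    · rcases hxy.eq_or_lt with rfl | h2
      · rfl
      · rw [thresholdAlloc_of_gt c h2]
        exact hstar y ⟨h2, hy.2⟩
    · rw [thresholdAlloc_of_gt c h1, thresholdAlloc_of_gt c (h1.trans_le hxy)]
      exact hanti ⟨h1, hx.2⟩ ⟨h1.trans_le hxy, hy.2⟩ hxy
  · rw [thresholdAlloc_of_gt c hθ.1]
    exact hnn θ hθ
  · rw [hP.workload_thresholdAlloc hR ht hc ⟨hθ.1.le, hθ.2.trans hP.starHigh_mem.2⟩]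
    exact hir θ hθ
  · rw [thresholdAlloc_of_gt c (hP.starLow_le_starHigh.trans_lt hθ.1)]
    exact hfin θ hθ

theorem exists_thresholdForm (hP : P.Regular) (hR : 0 < P.R P.lo) (ht : P.check ≤ t) :
    ∃ a u, P.ThresholdForm t a u := by
  have hs := hP.starLow_mem
  refine ⟨_, _, hP.thresholdForm_thresholdAlloc hR ht (c := fun _ => 0) intervalIntegrable_const
    antitoneOn_const (fun _ _ => le_rfl)
    (fun _ _ => hP.below_nonneg hR ht (hP.thresholdAlloc_below t _) ⟨hs.1, le_rfl⟩)
    (fun θ hθ => ?_) fun _ _ => rfl⟩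
  rw [intervalIntegral.integral_zero, add_zero]
  refine (min_le_right _ _).trans ?_
  rw [Rext_of_le hs.2]
  exact hP.R_mono hs ⟨hs.1.trans hθ.1.le, hθ.2.trans hP.starHigh_mem.2⟩ hθ.1.le

theorem max_mem_cutoffs (hP : P.Regular) : max P.check P.sharpHigh ∈ P.cutoffs :=
  ⟨max_le_max_left _ hP.sharpLow_le_sharpHigh, le_rfl⟩

theorem isGreatest_cutoffObjective (hP : P.Regular) (hR : 0 < P.R P.lo)
    (hpos : ¬ (P.wA ≤ 0 ∧ P.wB ≤ 0)) (ht : t ∈ P.cutoffs) :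
    IsGreatest P.relaxedValues (P.cutoffObjective t) := by
  have hct := check_le_of_mem_cutoffs ht
  obtain ⟨a, u, h⟩ := hP.exists_thresholdForm hR hct
  have hsol := h.isRelaxedSolution hP hR hpos ht
  rw [← h.objective_eq_cutoffObjective hP hR hct]
  exact ⟨⟨a, u, hsol.1, rfl⟩, by rintro _ ⟨a', u', h', rfl⟩; exact hsol.2 a' u' h'⟩

/-- Here `u ≤ R lo = 0`, and `a ≤ u / lo` leaves only the zero allocation. -/
theorem isGreatest_relaxedValues_zero_of_R_lo_eq_zero (hP : P.Regular) (hR : P.R P.lo = 0) :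
    IsGreatest P.relaxedValues 0 := by
  refine ⟨⟨_, _, hP.zero_feasible, (objective_zero _).symm⟩, ?_⟩
  rintro _ ⟨a, u, h, rfl⟩
  have hu : u = 0 := le_antisymm (hR ▸ h.u_le hP) h.u_nonneg
  subst hu
  rw [objective, integral_congr_Ioo hP.lt.le (g := fun _ => (0 : ℝ)) fun z hz => by
    rw [h.eq_zero hP (Ioo_subset_Icc_self hz), zero_mul]]
  simp

theorem exists_isGreatest_relaxedValues (hP : P.Regular) : ∃ v, IsGreatest P.relaxedValues v := by
  rcases hP.R_nonneg.eq_or_lt with hR | hR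
  · exact ⟨0, hP.isGreatest_relaxedValues_zero_of_R_lo_eq_zero hR.symm⟩
  by_cases hpos : P.wA ≤ 0 ∧ P.wB ≤ 0
  · exact ⟨0, hP.isGreatest_relaxedValues_zero hpos.1 hpos.2⟩
  · exact ⟨_, hP.isGreatest_cutoffObjective hR hpos hP.max_mem_cutoffs⟩

/-- Every value of `cutoffObjective` from `check` on is the value of a threshold form, hence
non-positive. At a cutoff beyond `starLow` it is a positive ratio times `𝒲̄ starLow + wB * lo`,
which is non-negative once one weight vanishes. -/
theorem isMaxOn_cutoffObjective (hP : P.Regular) (hA : P.wA ≤ 0) (hB : P.wB ≤ 0)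
    (h0 : P.wA = 0 ∨ P.wB = 0) (hR : 0 < P.R P.lo) (ht : max P.check P.starLow ≤ t) :
    IsMaxOn P.cutoffObjective (Ici P.check) t := by
  obtain ⟨h1, h2⟩ := max_le_iff.1 ht
  refine isMaxOn_iff.2 fun t' ht' => ?_
  obtain ⟨a, u, h⟩ := hP.exists_thresholdForm hR ht'
  have h3 := hP.objective_nonpos hA hB (h.relaxedFeasible hP hR ht')
  rw [h.objective_eq_cutoffObjective hP hR ht'] at h3
  refine h3.trans ?_
  have h4 : 0 ≤ P.calWbar P.starLow + P.wB * P.lo := by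
    rcases h0 with h0 | h0
    · have := hP.le_calWbar_starLow
      linarith
    · rw [h0, zero_mul, add_zero]
      exact hP.calWbar_starLow_nonneg
  have h5 := mul_nonneg (hP.ratio_pos hR h1).le h4
  rw [cutoffObjective, min_eq_right h2, intervalIntegral.integral_same]
  linarith

end Regular
end InnerProgram

namespace InnerProgram
namespace Regular

variable {P : InnerProgram} {t τ u : ℝ} {a : ℝ → ℝ}

/-! ### Intervals on which the envelope is affine -/

theorem isOpen_locallyAffine : IsOpen {θ | P.LocallyAffine θ} := by
  rw [isOpen_iff_mem_nhds]
  rintro θ ⟨x, y, m, c, h1, h2, h3, h4, h5⟩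
  filter_upwards [Ioo_mem_nhds h2 h3] with z hz using ⟨x, y, m, c, h1, hz.1, hz.2, h4, h5⟩

theorem lo_not_locallyAffine : ¬ P.LocallyAffine P.lo := by
  rintro ⟨x, y, m, c, h1, h2, -⟩
  exact absurd h1 h2.not_ge

/-- An affine piece around `starLow` would rise strictly before it, so it would exceed the maximum
after it. Hence no affine piece straddles `starLow`. -/
theorem starLow_not_locallyAffine (hP : P.Regular) : ¬ P.LocallyAffine P.starLow := by
  rintro ⟨x, y, m, c, h1, h2, h3, h4, h5⟩
  have e1 := h5 x ⟨le_rfl, (h2.trans h3).le⟩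
  have e2 := h5 y ⟨(h2.trans h3).le, le_rfl⟩
  have e3 := h5 P.starLow ⟨h2.le, h3.le⟩
  have h6 := hP.calWbar_lt_of_lt_starLow h1 h2
  have h7 := hP.calWbar_le_starLow (z := y) ⟨h1.trans (h2.trans h3).le, h4⟩
  rw [e1, e3] at h6
  rw [e2, e3] at h7
  have hm : 0 < m := pos_of_mul_pos_left (b := P.starLow - x) (by linarith) (sub_pos.2 h2).le
  nlinarith

theorem Wbar_eq_of_locallyAffine {x y : ℝ} (h : ∀ z ∈ Ioo x y, P.LocallyAffine z) :
    ∃ σ, ∀ z ∈ Ioo x y, P.Wbar z = σ := by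
  have hder : ∀ z ∈ Ioo x y, HasDerivAt P.Wbar 0 z := fun z hz => by
    obtain ⟨x', y', m, c, h1, h2, h3, h4, h5⟩ := h z hz
    refine (hasDerivAt_const z m).congr_of_eventuallyEq ?_
    filter_upwards [Ioo_mem_nhds h2 h3] with v hv using Wbar_eq_of_affine h5 ⟨hv.1, hv.2.le⟩
  rcases (Ioo x y).eq_empty_or_nonempty with he | ⟨v, hv⟩
  · exact ⟨0, by simp [he]⟩
  · exact ⟨P.Wbar v, fun z hz => isOpen_Ioo.is_const_of_deriv_eq_zero isPreconnected_Ioo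
      (fun z hz => (hder z hz).differentiableAt.differentiableWithinAt)
      (fun z hz => (hder z hz).deriv) hz hv⟩

theorem calWbar_eq_of_Wbar_eq (hP : P.Regular) {x y σ : ℝ} (hx : x ∈ P.types) (hy : y ∈ P.types)
    (hxy : x ≤ y) (h : ∀ z ∈ Ioo x y, P.Wbar z = σ) :
    P.calWbar y = P.calWbar x + σ * (y - x) := by
  have := hP.integral_Wbar hx hy hxy
  rw [integral_congr_Ioo hxy h, intervalIntegral.integral_const, smul_eq_mul] at this
  linarith

theorem Wbar_eq_of_le (hP : P.Regular) {x y z : ℝ} (hx : x ∈ Ioo P.lo P.hi)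
    (hy : y ∈ Ioo P.lo P.hi) (h : P.Wbar x ≤ P.Wbar y) (hz : z ∈ Ioo x y) :
    P.Wbar z = P.Wbar x := by
  have hzI : z ∈ Ioo P.lo P.hi := ⟨hx.1.trans hz.1, hz.2.trans hy.2⟩
  exact le_antisymm (hP.antitoneOn_Wbar hx hzI hz.1.le)
    (h.trans (hP.antitoneOn_Wbar hzI hy hz.2.le))

/-- An antitone `W̄` with `W̄ x ≤ W̄ y` is constant in between. In contrapositive form: across a
point that is not interior to an affine piece, `W̄` drops strictly. -/
theorem locallyAffine_of_Wbar_le (hP : P.Regular) {x y θ : ℝ} (hx : x ∈ Ioo P.lo P.hi)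
    (hy : y ∈ Ioo P.lo P.hi) (h : P.Wbar x ≤ P.Wbar y) (hxθ : x < θ) (hθy : θ < y) :
    P.LocallyAffine θ := by
  refine ⟨x, y, P.Wbar x, P.calWbar x - P.Wbar x * x, hx.1.le, hxθ, hθy, hy.2.le, fun z hz => ?_⟩
  have := hP.calWbar_eq_of_Wbar_eq (Ioo_subset_Icc_self hx)
    ⟨hx.1.le.trans hz.1, hz.2.trans hy.2.le⟩ hz.1
    (fun v hv => hP.Wbar_eq_of_le hx hy h ⟨hv.1, hv.2.trans_le hz.2⟩)
  linarith

/-! ### Redistribution inside affine intervals -/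

/-- On each component of the affine set `W̄` is constant and `a`, `a₀` have equal integrals, as the
end points are not locally affine. So the objectives agree. -/
theorem isRelaxedSolution_of_redistribution (hP : P.Regular) {a₀ : ℝ → ℝ}
    (h : P.RelaxedFeasible a u) (h₀ : P.IsRelaxedSolution a₀ u)
    (hfin : ∀ θ ∈ Ioc P.starLow P.hi, a θ = a₀ θ)
    (hU : ∀ θ ∈ Icc P.lo P.starLow, ¬ P.LocallyAffine θ →
      P.workload a u θ = P.workload a₀ u θ)
    (hae : ∀ᵐ θ, θ ∈ Icc P.lo P.starLow → ¬ P.LocallyAffine θ → a θ = a₀ θ) :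
    P.IsRelaxedSolution a u := by
  refine ⟨h, fun a' u' h' => (h₀.2 a' u' h').trans (le_of_eq ?_)⟩
  have hs := hP.starLow_mem
  have hw := hP.intervalIntegrable_Wbar hP.lo_mem hP.hi_mem
  have i1 := h.ic.intervalIntegrable_mul hP.lt.le hw
  have i2 := h₀.1.ic.intervalIntegrable_mul hP.lt.le hw
  have key : ∫ z in P.lo..P.starLow, (a z * P.Wbar z - a₀ z * P.Wbar z) = 0 := by
    refine integral_eq_zero_of_components isOpen_locallyAffine hs.1 lo_not_locallyAffine
      hP.starLow_not_locallyAffine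
      ((i1.sub i2).mono_set (hP.uIcc_subset hP.lo_mem hs)) ?_ fun x y hx hxy hy hxyO hxO hyO => ?_
    · filter_upwards [hae] with z hz hzI hzO
      rw [hz (Ioo_subset_Icc_self hzI) hzO, sub_self]
    · obtain ⟨σ, hσ⟩ := Wbar_eq_of_locallyAffine hxyO
      have hxI : x ∈ Icc P.lo P.starLow := ⟨hx, hxy.le.trans hy⟩
      have hyI : y ∈ Icc P.lo P.starLow := ⟨hx.trans hxy.le, hy⟩
      have hxT : x ∈ P.types := ⟨hx, hxI.2.trans hs.2⟩
      have hyT : y ∈ P.types := ⟨hyI.1, hy.trans hs.2⟩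
      rw [integral_congr_Ioo hxy.le (g := fun z => (a z - a₀ z) * σ)
        (fun z hz => by rw [hσ z hz]; ring), intervalIntegral.integral_mul_const,
        intervalIntegral.integral_sub (h.intervalIntegrable hP hxT hyT)
          (h₀.1.intervalIntegrable hP hxT hyT),
        ← hP.workload_sub (h.intervalIntegrable hP hP.lo_mem hP.hi_mem) u hxT hyT,
        ← hP.workload_sub (h₀.1.intervalIntegrable hP hP.lo_mem hP.hi_mem) u hxT hyT,
        hU x hxI hxO, hU y hyI hyO, sub_self, zero_mul]
  have key2 : ∫ z in P.starLow..P.hi, (a z * P.Wbar z - a₀ z * P.Wbar z) = 0 := by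
    rw [integral_congr_Ioo hs.2 (g := fun _ => (0 : ℝ)) fun z hz => by
      rw [hfin z ⟨hz.1, hz.2.le⟩, sub_self], intervalIntegral.integral_zero]
  have := intervalIntegral.integral_add_adjacent_intervals
    ((i1.sub i2).mono_set (hP.uIcc_subset hP.lo_mem hs))
    ((i1.sub i2).mono_set (hP.uIcc_subset hs hP.hi_mem))
  rw [key, key2, intervalIntegral.integral_sub i1 i2] at this
  rw [objective, objective]
  linarith

/-! ### Necessary conditions -/

theorem objective_eq_dualValue_of_isRelaxedSolution (hP : P.Regular) (hR : 0 < P.R P.lo)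
    (ht : P.check ≤ t) (hm : P.IsMultiplier t τ) (h : P.IsRelaxedSolution a u) :
    P.objective P.Wbar a u = P.dualValue t τ := by
  obtain ⟨a', u', h'⟩ := hP.exists_thresholdForm hR ht
  refine le_antisymm (hP.objective_le_dualValue ((hP.lo_le_check hR).trans ht) hm h.1) ?_
  rw [← h'.objective_eq_dualValue hP hR ht hm]
  exact h.2 a' u' (h'.relaxedFeasible hP hR ht)

theorem u_pos_of_isRelaxedSolution (hP : P.Regular) (hR : 0 < P.R P.lo)
    (hpos : ¬ (P.wA ≤ 0 ∧ P.wB ≤ 0)) (h : P.IsRelaxedSolution a u) : 0 < u := by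
  have ht := hP.max_mem_cutoffs
  have hct := check_le_of_mem_cutoffs ht
  obtain ⟨τ, hm⟩ := hP.exists_isMultiplier hR hpos ht
  have h1 := hP.objective_eq_dualValue_of_isRelaxedSolution hR hct hm h
  have h2 := hP.dualValue_pos hR ((hP.lo_le_check hR).trans hct) hm
  refine lt_of_le_of_ne h.1.u_nonneg ?_
  rintro rfl
  rw [← h1, objective, integral_congr_Ioo hP.lt.le (g := fun _ => (0 : ℝ)) fun z hz => by
    rw [h.1.eq_zero hP (Ioo_subset_Icc_self hz), zero_mul]] at h2
  simp at h2

theorem workload_eq_of_ae (hP : P.Regular) {θ : ℝ} (hθ : θ ∈ P.types)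
    (hae : ∀ᵐ z, z ∈ Ioo P.lo θ → a z = u / P.lo) : P.workload a u θ = u / P.lo * θ := by
  rw [workload, intervalIntegral.integral_of_le hθ.1, ← restrict_Ioo_eq_restrict_Ioc,
    setIntegral_congr_ae measurableSet_Ioo hae, restrict_Ioo_eq_restrict_Ioc,
    ← intervalIntegral.integral_of_le hθ.1, intervalIntegral.integral_const, smul_eq_mul]
  have := hP.lo_pos.ne'
  field_simp
  ring

/-- If `W̄ = τ` from `z` to `t`, the tangent at `z` is the line of slope `τ` through `(t, 𝒲̄ t)`.
With `slopeValue = 0` this makes `z` a zero of `tangentGap`, against the extremality of `sharpLow`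
or `sharpHigh`. -/
theorem tangentGap_eq_of_slopeValue (hP : P.Regular) {z : ℝ} (hts : t ≤ P.starLow)
    (ht : t ∈ P.types) (hz : z ∈ P.types) (hτ : P.Wbar z = τ)
    (h : ∀ y ∈ Ioo (min z t) (max z t), P.Wbar y = τ) :
    P.tangentGap z = -P.slopeValue t τ := by
  rw [tangentGap, slopeValue, min_eq_left hts, hτ]
  rcases le_total z t with h1 | h1
  · rw [min_eq_left h1, max_eq_right h1] at h
    rw [hP.calWbar_eq_of_Wbar_eq hz ht h1 h]
    ring
  · rw [min_eq_right h1, max_eq_left h1] at h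
    rw [hP.calWbar_eq_of_Wbar_eq ht hz h1 h]
    ring

/-- The cutoff that corresponds to a solution is an optimal one. -/
theorem mem_cutoffs_of_isRelaxedSolution (hP : P.Regular) (hR : 0 < P.R P.lo)
    (hpos : ¬ (P.wA ≤ 0 ∧ P.wB ≤ 0)) (h : P.IsRelaxedSolution a u) (ht : P.check ≤ t)
    (hu : P.Rext t / t = u / P.lo) : t ∈ P.cutoffs := by
  have hs := hP.starLow_mem
  constructor
  -- Test against the smallest optimal cutoff `q`, which is then `sharpLow`. Its minimality gives
  -- `W̄ > τ` before `q`, so `a = u / lo` there. The workload at `q` is thus on the ray through `(t,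
  -- R t)`, which is above `R` after `t`.
  · by_contra! hcon
    set q := max P.check P.sharpLow with hq
    have hqc : q ∈ P.cutoffs := ⟨le_rfl, max_le_max_left _ hP.sharpLow_le_sharpHigh⟩
    have hcq : P.check < q := ht.trans_lt hcon
    have hqs : q = P.sharpLow := by
      rcases le_total P.sharpLow P.check with h1 | h1
      · rw [hq, max_eq_left h1] at hcq
        exact absurd hcq (lt_irrefl _)
      · rw [hq, max_eq_right h1]
    obtain ⟨τ, hm⟩ := hP.exists_isMultiplier hR hpos hqc
    have hloq := (hP.lo_le_check hR).trans hcq.le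
    have hκ : P.slopeValue q τ = 0 := by
      by_contra hne
      exact hcq.ne' (hm.eq_check (lt_of_le_of_ne hm.slopeValue_nonneg (Ne.symm hne)))
    have hτ : 0 < τ := hm.pos.resolve_right hκ.not_gt
    have hqstar := hm.le_starLow hτ
    have hqT : q ∈ P.types := ⟨hloq, hqstar.trans hs.2⟩
    have hmin : min q P.starLow = q := min_eq_left hqstar
    obtain ⟨-, -, hs3, -⟩ := hP.slackness hloq hm h.1
      (hP.objective_eq_dualValue_of_isRelaxedSolution hR hcq.le hm h)
    rw [hmin] at hs3
    have hlt : ∀ z ∈ Ioo P.lo q, τ < P.Wbar z := fun z hz => by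
      have hzI : z ∈ Ioo P.lo P.hi := ⟨hz.1, hz.2.trans_le hqT.2⟩
      refine lt_of_le_of_ne (hm.le_Wbar z (by rwa [hmin])) fun he => ?_
      have := hP.tangentGap_eq_of_slopeValue hqstar hqT (Ioo_subset_Icc_self hzI) he.symm
        fun y hy => by
          rw [min_eq_left hz.2.le, max_eq_right hz.2.le] at hy
          have hyI : y ∈ Ioo P.lo P.hi := ⟨hz.1.trans hy.1, hy.2.trans_le hqT.2⟩
          refine le_antisymm ?_ (hm.le_Wbar y (by rw [hmin]; exact ⟨hyI.1, hy.2⟩))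
          rw [he]
          exact hP.antitoneOn_Wbar hzI hyI hy.1.le
      rw [hκ, neg_zero] at this
      exact absurd (hP.sharpLow_le hzI this.le) (hqs ▸ hz.2).not_ge
    have hUq := hP.workload_eq_of_ae (a := a) (u := u) hqT (by
      filter_upwards [hs3] with z hz hzI using hz hzI (hlt z hzI))
    have h1 := h.1.ir q hqT
    rw [hUq, ← Rext_of_le hqT.2, ← hu] at h1
    exact absurd (hP.lt_ratio_mul hR ht hcon) h1.not_gt
  -- Test against the largest optimal cutoff `q`. Before `t` the ray bounding the workload is
  -- strictly below `R`, so the binding cuts all lie at or after `t`. This means `W̄ = τ` between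
  -- `q` and `t`, which gives a zero of `tangentGap` after `sharpHigh`.
  · by_contra! hcon
    set q := max P.check P.sharpHigh with hq
    have hqc : q ∈ P.cutoffs := hP.max_mem_cutoffs
    have hcq : P.check ≤ q := le_max_left _ _
    obtain ⟨τ, hm⟩ := hP.exists_isMultiplier hR hpos hqc
    have hloq := (hP.lo_le_check hR).trans hcq
    obtain ⟨hs1, hs2, -, -⟩ := hP.slackness hloq hm h.1
      (hP.objective_eq_dualValue_of_isRelaxedSolution hR hcq hm h)
    have hκ : P.slopeValue q τ = 0 := by
      by_contra hne
      have h1 := hs1 (lt_of_le_of_ne hm.slopeValue_nonneg (Ne.symm hne))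
      rw [h1] at hu
      rw [hP.eq_check_of_ratio_eq hR ht hu] at hcon
      exact absurd hcq hcon.not_ge
    have hτ : 0 < τ := hm.pos.resolve_right hκ.not_gt
    have hqstar := hm.le_starLow hτ
    have hqT : q ∈ P.types := ⟨hloq, hqstar.trans hs.2⟩
    have hmin : min q P.starLow = q := min_eq_left hqstar
    have hcut : ∀ᵐ s, s ∈ Ioo 0 τ → t ≤ P.cut q s := by
      filter_upwards [hs2] with s hs hsI
      by_contra! hlt
      have hc := hP.cut_mem_types hloq s
      have h1 := hP.ratio_mul_lt hR (hcq.trans_lt hcon) hc.1 hlt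
      have h2 := h.1.workload_le hP hc
      rw [hs hsI, ← hu] at h2
      exact absurd h1 h2.not_gt
    have hts : t ≤ P.starLow := by
      obtain ⟨s, -, hts⟩ := exists_mem_Ioo_of_ae hτ hcut
      exact hts.trans cut_mem.2
    obtain ⟨z, hz⟩ := nonempty_Ioo.2 hcon
    have hzs : z < P.starLow := hz.2.trans_le hts
    have hzI : z ∈ Ioo P.lo P.hi := ⟨hloq.trans_lt hz.1, hzs.trans_le hs.2⟩
    have hWz : P.Wbar z = τ := by
      refine le_antisymm (hm.Wbar_le z (by rw [hmin]; exact ⟨hz.1, hzI.2⟩)) ?_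
      by_contra! hlt
      have hw0 := hP.Wbar_pos ⟨hzI.1, hzs⟩
      obtain ⟨s, hsI, hts'⟩ := exists_mem_Ioo_of_ae hlt (Q := fun s => t ≤ P.cut q s) (by
        filter_upwards [hcut] with s hs hsI using hs ⟨hw0.trans hsI.1, hsI.2⟩)
      have h1 : P.cut q s ≤ z := by
        refine levelCut_le_of_le (hP.antitoneOn_Wbar.mono ?_) ?_ hsI.1.le
        · rw [hmin]
          exact Ioo_subset_Ioo hloq hs.2
        · rw [hmin]
          exact ⟨hz.1, hzs⟩
      exact absurd (hts'.trans h1) hz.2.not_ge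
    have := hP.tangentGap_eq_of_slopeValue hqstar hqT (Ioo_subset_Icc_self hzI) hWz
      fun y hy => by
        rw [min_eq_right hz.1.le, max_eq_left hz.1.le] at hy
        have hyI : y ∈ Ioo P.lo P.hi := ⟨hloq.trans_lt hy.1, hy.2.trans hzI.2⟩
        refine le_antisymm (hm.Wbar_le y (by rw [hmin]; exact ⟨hy.1, hyI.2⟩)) ?_
        rw [← hWz]
        exact hP.antitoneOn_Wbar hyI hzI hy.2.le
    rw [hκ, neg_zero] at this
    exact absurd ((hP.le_sharpHigh hzI this.ge).trans (le_max_right _ _)) hz.1.not_ge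

/-- As `W̄` drops strictly across `θ`, an interval of levels has cuts arbitrarily close to `θ`, and
at almost all of them the constraint binds. Continuity carries equality to `θ`. At `θ = t` the
levels are capped by `τ`, and `hkey` supplies the drop. -/
theorem workload_eq_Rext_of_slackness (hP : P.Regular) (hR : 0 < P.R P.lo) (ht : P.check ≤ t)
    (hm : P.IsMultiplier t τ) (h : P.RelaxedFeasible a u)
    (hae : ∀ᵐ s, s ∈ Ioo 0 τ → P.workload a u (P.cut t s) = P.Rext (P.cut t s))
    {θ : ℝ} (hθ : θ ∈ Icc t P.starLow) (haff : ¬ P.LocallyAffine θ)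
    (hkey : θ = t → 0 < τ ∧ ∀ y ∈ Ioo t P.starLow, P.Wbar y < τ) :
    P.workload a u θ = P.Rext θ := by
  have hlo := (hP.lo_le_check hR).trans ht
  have hs := hP.starLow_mem
  have hts := hθ.1.trans hθ.2
  have hmin : min t P.starLow = t := min_eq_left hts
  have hsub : Icc t P.starLow ⊆ P.types := Icc_subset_Icc hlo hs.2
  have hsubo : Ioo t P.starLow ⊆ Ioo P.lo P.hi := Ioo_subset_Ioo hlo hs.2
  have hanti : AntitoneOn P.Wbar (Ioo (min t P.starLow) P.starLow) := by
    rw [hmin]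
    exact hP.antitoneOn_Wbar.mono hsubo
  have hcutI : ∀ s, P.cut t s ∈ Icc t P.starLow := fun s => by
    have := cut_mem (P := P) (t := t) (s := s)
    rwa [hmin] at this
  have hcont : ContinuousOn (fun x => P.workload a u x - P.Rext x) (Icc t P.starLow) :=
    ((hP.continuousOn_workload (h.intervalIntegrable hP hP.lo_mem hP.hi_mem) u).mono hsub).sub
      ((hP.continuousOn_Rext hR ht).mono fun x hx => hx.1)
  have hclosed : IsClosed (Icc t P.starLow ∩
      (fun x => P.workload a u x - P.Rext x) ⁻¹' {0}) :=
    hcont.preimage_isClosed_of_isClosed isClosed_Icc isClosed_singleton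
  suffices hmem : θ ∈ Icc t P.starLow ∩ (fun x => P.workload a u x - P.Rext x) ⁻¹' {0} from
    sub_eq_zero.1 hmem.2
  rw [← hclosed.closure_eq, Metric.mem_closure_iff]
  intro ε hε
  -- Levels above `s₁` have cuts before `θ + ε`; those below the `s₂` chosen next have cuts after `θ
  -- - ε`.
  obtain ⟨y, s₁, hyε, hs₁, hcy, hy⟩ : ∃ y s₁, y < θ + ε ∧ 0 ≤ s₁ ∧ (∀ s, s₁ < s → P.cut t s ≤ y) ∧
      ((θ = P.starLow ∧ s₁ = 0) ∨ (y ∈ Ioo θ P.starLow ∧ s₁ = P.Wbar y)) := by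
    rcases hθ.2.eq_or_lt with h1 | h1
    · exact ⟨θ, 0, by linarith, le_rfl, fun s _ => h1 ▸ (hcutI s).2, Or.inl ⟨h1, rfl⟩⟩
    · obtain ⟨y, hy⟩ := nonempty_Ioo.2 (lt_min h1 (lt_add_of_pos_right θ hε))
      have hyI : y ∈ Ioo θ P.starLow := ⟨hy.1, hy.2.trans_le (min_le_left _ _)⟩
      have hyI' : y ∈ Ioo t P.starLow := ⟨hθ.1.trans_lt hyI.1, hyI.2⟩
      refine ⟨y, P.Wbar y, hy.2.trans_le (min_le_right _ _),
        (hP.Wbar_pos ⟨(hsubo hyI').1, hyI.2⟩).le, fun s hs' => ?_, Or.inr ⟨hyI, rfl⟩⟩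
      exact levelCut_le_of_le hanti (by rwa [hmin]) hs'.le
  obtain ⟨z, s₂, hzε, hs₂, hcz, hz⟩ : ∃ z s₂, θ - ε < z ∧ s₂ ≤ τ ∧ (∀ s, s < s₂ → z ≤ P.cut t s) ∧
      ((θ = t ∧ s₂ = τ) ∨ (z ∈ Ioo t θ ∧ s₂ = P.Wbar z)) := by
    rcases hθ.1.eq_or_lt with h1 | h1
    · exact ⟨θ, τ, by linarith, le_rfl, fun s _ => h1 ▸ (hcutI s).1, Or.inl ⟨h1.symm, rfl⟩⟩
    · obtain ⟨z, hz⟩ := nonempty_Ioo.2 (max_lt h1 (sub_lt_self θ hε))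
      have hzI : z ∈ Ioo t θ := ⟨(le_max_left _ _).trans_lt hz.1, hz.2⟩
      have hzI' : z ∈ Ioo t P.starLow := ⟨hzI.1, hzI.2.trans_le hθ.2⟩
      refine ⟨z, P.Wbar z, (le_max_right _ _).trans_lt hz.1, hm.Wbar_le z
        (by rw [hmin]; exact ⟨hzI.1, (hsubo hzI').2⟩), fun s hs' => ?_, Or.inr ⟨hzI, rfl⟩⟩
      exact le_levelCut (min_le_right _ _) (by rwa [hmin]) hs'
  have hlt : s₁ < s₂ := by
    rcases hy with ⟨h1, rfl⟩ | ⟨h1, rfl⟩ <;> rcases hz with ⟨h2, rfl⟩ | ⟨h2, rfl⟩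
    · exact (hkey h2).1
    · exact hP.Wbar_pos ⟨hlo.trans_lt h2.1, h2.2.trans_le hθ.2⟩
    · exact (hkey h2).2 y ⟨h2 ▸ h1.1, h1.2⟩
    · by_contra! hcon
      exact haff (hP.locallyAffine_of_Wbar_le (hsubo ⟨h2.1, h2.2.trans_le hθ.2⟩)
        (hsubo ⟨hθ.1.trans_lt h1.1, h1.2⟩) hcon h2.2 h1.1)
  obtain ⟨s, hsI, hsU⟩ := exists_mem_Ioo_of_ae hlt
    (Q := fun s => P.workload a u (P.cut t s) = P.Rext (P.cut t s)) (by
      filter_upwards [hae] with s hs' hsI using hs' ⟨hs₁.trans_lt hsI.1, hsI.2.trans_le hs₂⟩)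
  refine ⟨P.cut t s, ⟨hcutI s, sub_eq_zero.2 hsU⟩, ?_⟩
  rw [Real.dist_eq, abs_lt]
  have h1 := hcy s hsI.1
  have h2 := hcz s hsI.2
  constructor <;> linarith

/-- A solution has the workload of the threshold form wherever the envelope is not affine. -/
theorem workload_eq_min (hP : P.Regular) (hR : 0 < P.R P.lo)
    (hpos : ¬ (P.wA ≤ 0 ∧ P.wB ≤ 0)) (h : P.IsRelaxedSolution a u) (ht : t ∈ P.cutoffs)
    (hu : P.Rext t / t = u / P.lo) {θ : ℝ} (hθ : θ ∈ Icc P.lo P.starLow)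
    (haff : ¬ P.LocallyAffine θ) :
    P.workload a u θ = min (P.Rext t / t * θ) (P.Rext θ) := by
  have hct := check_le_of_mem_cutoffs ht
  have hs := hP.starLow_mem
  have hθT : θ ∈ P.types := ⟨hθ.1, hθ.2.trans hs.2⟩
  have hle1 := h.1.workload_le hP hθT
  have hle2 := h.1.ir θ hθT
  rw [← hu] at hle1
  rw [← Rext_of_le hθT.2] at hle2
  suffices hor : P.workload a u θ = P.Rext t / t * θ ∨ P.workload a u θ = P.Rext θ by
    rcases hor with h1 | h1
    · rw [min_eq_left (h1 ▸ hle2), h1]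
    · rw [min_eq_right (h1 ▸ hle1), h1]
  obtain ⟨τ, hm⟩ := hP.exists_isMultiplier hR hpos ht
  have hlo := (hP.lo_le_check hR).trans hct
  obtain ⟨-, hs2, hs3, -⟩ := hP.slackness hlo hm h.1
    (hP.objective_eq_dualValue_of_isRelaxedSolution hR hct hm h)
  rcases le_or_gt θ (min t P.starLow) with h1 | h1
  -- If `W̄` exceeds `τ` throughout, slackness gives `a = u / lo` and the ray binds. Otherwise `W̄ =
  -- τ` from some `z < θ` up to `t`, so a `θ` outside affine interiors must be `t`, where `R` binds.
  · by_cases hall : ∀ z ∈ Ioo P.lo θ, τ < P.Wbar z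
    · left
      rw [hu]
      refine hP.workload_eq_of_ae hθT ?_
      filter_upwards [hs3] with z hz hzI using hz ⟨hzI.1, hzI.2.trans_le h1⟩ (hall z hzI)
    · right
      push Not at hall
      obtain ⟨z, hz, hzτ⟩ := hall
      have hzI : z ∈ Ioo P.lo P.hi := ⟨hz.1, hz.2.trans_le hθT.2⟩
      have hτ : 0 < τ := (hP.Wbar_pos ⟨hz.1, hz.2.trans_le hθ.2⟩).trans_le hzτ
      have hts := hm.le_starLow hτ
      have hmin : min t P.starLow = t := min_eq_left hts
      rw [hmin] at h1
      have hθt : θ = t := by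
        refine le_antisymm h1 ?_
        by_contra! hlt
        obtain ⟨y, hy⟩ := nonempty_Ioo.2 hlt
        have hyI : y ∈ Ioo P.lo P.hi := ⟨hθ.1.trans_lt hy.1, hy.2.trans_le (hts.trans hs.2)⟩
        exact haff (hP.locallyAffine_of_Wbar_le hzI hyI
          (hzτ.trans (hm.le_Wbar y (by rw [hmin]; exact ⟨hyI.1, hy.2⟩))) hz.2 hy.1)
      refine hP.workload_eq_Rext_of_slackness hR hct hm h.1 hs2 ⟨hθt.ge, hθ.2⟩ haff
        fun _ => ⟨hτ, fun y hy => ?_⟩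
      by_contra! hcon
      exact haff (hP.locallyAffine_of_Wbar_le hzI
        ⟨hlo.trans_lt hy.1, hy.2.trans_le hs.2⟩ (hzτ.trans hcon) hz.2 (hθt ▸ hy.1))
  · right
    have htθ : t < θ := (min_lt_iff.1 h1).resolve_right hθ.2.not_gt
    exact hP.workload_eq_Rext_of_slackness hR hct hm h.1 hs2 ⟨htθ.le, hθ.2⟩ haff
      fun he => absurd he htθ.ne'

/-- Slackness gives `a = 0` almost everywhere where `W̄ < 0`; monotonicity and non-negativity extend
it to every type. -/
theorem eq_zero_of_starHigh_lt (hP : P.Regular) (hR : 0 < P.R P.lo)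
    (hpos : ¬ (P.wA ≤ 0 ∧ P.wB ≤ 0)) (h : P.IsRelaxedSolution a u) {θ : ℝ}
    (hθ : θ ∈ Ioc P.starHigh P.hi) : a θ = 0 := by
  have ht := hP.max_mem_cutoffs
  have hct := check_le_of_mem_cutoffs ht
  obtain ⟨τ, hm⟩ := hP.exists_isMultiplier hR hpos ht
  obtain ⟨-, -, -, hs4⟩ := hP.slackness ((hP.lo_le_check hR).trans hct) hm h.1
    (hP.objective_eq_dualValue_of_isRelaxedSolution hR hct hm h)
  have hlo := hP.starHigh_mem.1
  have hθT : θ ∈ P.types := ⟨hlo.trans hθ.1.le, hθ.2⟩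
  obtain ⟨z, hz, hz0⟩ := exists_mem_Ioo_of_ae hθ.1 (Q := fun z => a z = 0) (by
    filter_upwards [hs4] with z hz hzI
    have hzI' : z ∈ Ioo P.starHigh P.hi := ⟨hzI.1, hzI.2.trans_le hθ.2⟩
    exact hz ⟨hP.starLow_le_starHigh.trans_lt hzI.1, hzI'.2⟩ (hP.Wbar_neg hzI'))
  refine le_antisymm ?_ (h.1.a_nonneg θ hθT)
  rw [← hz0]
  exact h.1.ic ⟨hlo.trans hz.1.le, hz.2.le.trans hθ.2⟩ hθT hz.2.le

/-- A point where the workloads agree minimizes their difference, so the derivative `a₀ - a`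
vanishes there whenever both primitives are differentiable. -/
theorem ae_eq_of_workload (hP : P.Regular) {a₀ : ℝ → ℝ}
    (ha : IntervalIntegrable a volume P.lo P.starLow)
    (ha₀ : IntervalIntegrable a₀ volume P.lo P.starLow)
    (hle : ∀ θ ∈ Icc P.lo P.starLow, P.workload a u θ ≤ P.workload a₀ u θ) :
    ∀ᵐ θ, θ ∈ Icc P.lo P.starLow → P.workload a u θ = P.workload a₀ u θ → a θ = a₀ θ := by
  have hlo : P.lo ∈ uIcc P.lo P.starLow := left_mem_uIcc
  have hne (c : ℝ) : ∀ᵐ θ : ℝ, θ ≠ c := compl_mem_ae_iff.2 (measure_singleton c)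
  filter_upwards [ha.ae_hasDerivAt_integral, ha₀.ae_hasDerivAt_integral, hne P.lo, hne P.starLow]
    with θ h1 h2 h3 h4 hθ heq
  have hθ' : θ ∈ uIcc P.lo P.starLow := by rwa [uIcc_of_le hP.starLow_mem.1]
  have hd : HasDerivAt (fun x => P.workload a₀ u x - P.workload a u x) (a₀ θ - a θ) θ :=
    ((h2 hθ' _ hlo).const_add u).sub ((h1 hθ' _ hlo).const_add u)
  have hmin : IsLocalMin (fun x => P.workload a₀ u x - P.workload a u x) θ := by
    filter_upwards [Ioo_mem_nhds (lt_of_le_of_ne hθ.1 (Ne.symm h3)) (lt_of_le_of_ne hθ.2 h4)]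
      with x hx
    rw [heq, sub_self]
    exact sub_nonneg.2 (hle x (Ioo_subset_Icc_self hx))
  linarith [hmin.hasDerivAt_eq_zero hd]

theorem exists_thresholdForm_of_isRelaxedSolution (hP : P.Regular) (hR : 0 < P.R P.lo)
    (hpos : ¬ (P.wA ≤ 0 ∧ P.wB ≤ 0)) (h : P.IsRelaxedSolution a u) :
    ∃ t ∈ P.cutoffs, ∃ a₀, P.ThresholdForm t a₀ u ∧
      (∀ θ ∈ Ioc P.starLow P.hi, a θ = a₀ θ) ∧
      (∀ θ ∈ Icc P.lo P.starLow, ¬ P.LocallyAffine θ →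
        P.workload a u θ = P.workload a₀ u θ) ∧
      (∀ᵐ θ, θ ∈ Icc P.lo P.starLow → ¬ P.LocallyAffine θ → a θ = a₀ θ) := by
  have hu0 := hP.u_pos_of_isRelaxedSolution hR hpos h
  obtain ⟨t, hct, hu⟩ := hP.exists_ratio_eq hR (div_pos hu0 hP.lo_pos)
    (div_le_div_of_nonneg_right (h.1.u_le hP) hP.lo_pos.le)
  have ht := hP.mem_cutoffs_of_isRelaxedSolution hR hpos h hct hu
  have hs := hP.starLow_mem
  have hs' := hP.starHigh_mem
  have hueq : P.Rext t / t * P.lo = u := by rw [hu, div_mul_cancel₀ _ hP.lo_pos.ne']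
  have hb := hP.thresholdAlloc_below t a
  rw [hueq] at hb
  have hstar := hP.workload_eq_min hR hpos h ht hu (right_mem_Icc.2 hs.1)
    hP.starLow_not_locallyAffine
  have hT : ∀ θ ∈ Ioc P.starLow P.starHigh, θ ∈ P.types := fun θ hθ =>
    ⟨hs.1.trans hθ.1.le, hθ.2.trans hs'.2⟩
  have haI := h.1.intervalIntegrable hP hP.lo_mem hP.hi_mem
  -- The comparison allocation copies the solution itself after `starLow`.
  have hform := hP.thresholdForm_thresholdAlloc hR hct (c := a)
    (h.1.intervalIntegrable hP hs hP.hi_mem) (h.1.ic.mono hT)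
    (fun θ hθ => h.1.a_nonneg θ (hT θ hθ)) (fun θ hθ => ?_) (fun θ hθ => ?_)
    (fun θ hθ => hP.eq_zero_of_starHigh_lt hR hpos h hθ)
  · rw [hueq] at hform
    have hU : ∀ θ ∈ Icc P.lo P.starLow, ¬ P.LocallyAffine θ →
        P.workload a u θ = P.workload (P.thresholdAlloc t a) u θ := fun θ hθ haff => by
      rw [hP.workload_below hR hct hb hθ, hP.workload_eq_min hR hpos h ht hu hθ haff]
    refine ⟨t, ht, _, hform, fun θ hθ => (thresholdAlloc_of_gt a hθ.1).symm, hU, ?_⟩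
    filter_upwards [hP.ae_eq_of_workload (h.1.intervalIntegrable hP hP.lo_mem hs)
      (hP.intervalIntegrable_below hR hct hb) fun θ hθ => by
        have hθT : θ ∈ P.types := ⟨hθ.1, hθ.2.trans hs.2⟩
        rw [hP.workload_below hR hct hb hθ]
        refine le_min ?_ ?_
        · rw [hu]
          exact h.1.workload_le hP hθT
        · rw [Rext_of_le hθT.2]
          exact h.1.ir θ hθT] with θ hθ hθI haff using hθ hθI (hU θ hθI haff)
  · rcases le_or_gt P.starLow t with h1 | h1
    · rw [hb.initial _ ⟨hs.1, le_min h1 le_rfl⟩, hu]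
      exact h.1.le_div hP (hT θ hθ)
    · rw [hb.middle _ ⟨h1, le_rfl⟩]
      -- Since `R` binds at `starLow`, later values of `a` are bounded by slopes of chords of `R`
      -- from `starLow`, hence by the left derivative there.
      rw [min_eq_right (hP.lt_ratio_mul hR hct h1).le] at hstar
      have h2 := hP.le_workload_sub h.1.ic u hs (hT θ hθ) hθ.1.le
      have h3 := h.1.ir θ (hT θ hθ)
      rw [← Rext_of_le (hT θ hθ).2] at h3
      have hlo := ((hP.lo_le_check hR).trans hct).trans_lt h1
      have h4 := hP.concaveOn_Rext.le_add_leftDeriv_mul (interior_Ici_lo hlo)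
        (show θ ∈ Ici P.lo from (hT θ hθ).1)
      exact le_of_mul_le_mul_right (by linarith) (sub_pos.2 hθ.1)
  · rw [← hstar, ← hP.workload_sub haI u hs (hT θ hθ)]
    linarith [h.1.ir θ (hT θ hθ)]

end Regular
end InnerProgram

end

/-! ### The theorem -/

theorem mainTheorem3 (P : InnerProgram)
    (hlo : 0 < P.lo) (hlt : P.lo < P.hi)
    (hf_pos : ∀ θ ∈ P.types, 0 < P.f θ)
    (hf_int : IntervalIntegrable P.f volume P.lo P.hi)
    (hf_one : (∫ θ in P.lo..P.hi, P.f θ) = 1)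
    (hR_concave : ConcaveOn ℝ P.types P.R)
    (hR_mono : MonotoneOn P.R P.types)
    (hR_nonneg : 0 ≤ P.R P.lo) :
    -- the original program, the relaxed program and the support function have the same value
    (∃ v, IsGreatest P.originalValues v ∧ IsGreatest P.relaxedValues v ∧
      IsGreatest P.supportValues v) ∧
    -- the relaxed program when both weights are non-positive
    (P.wA ≤ 0 ∧ P.wB ≤ 0 →
      IsGreatest P.relaxedValues 0 ∧
      P.IsRelaxedSolution (fun _ => 0) 0 ∧
      (P.wA < 0 ∧ P.wB < 0 →
        ∀ a u, P.IsRelaxedSolution a u → u = 0 ∧ ∀ θ ∈ P.types, a θ = 0) ∧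
      ((P.wA = 0 ∨ P.wB = 0) → 0 < P.R P.lo →
        ∀ t, max P.check P.starLow ≤ t → IsMaxOn P.cutoffObjective (Ici P.check) t)) ∧
    -- the relaxed program when some weight is positive
    (¬ (P.wA ≤ 0 ∧ P.wB ≤ 0) →
      P.sharpHigh ≤ P.starLow ∧
      (0 < P.R P.lo →
        IsGreatest P.relaxedValues
          (P.Rext (max P.check P.sharpHigh) / max P.check P.sharpHigh
              * (P.calWbar (min (max P.check P.sharpHigh) P.starLow) + P.wB * P.lo)
            + ∫ z in (min (max P.check P.sharpHigh) P.starLow)..P.starLow,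
                P.Wbar z * leftDeriv P.R z) ∧
        (∀ t ∈ P.cutoffs, ∀ a u, P.ThresholdForm t a u → P.IsRelaxedSolution a u) ∧
        (∀ a u, P.IsRelaxedSolution a u ↔
          P.RelaxedFeasible a u ∧ ∃ t ∈ P.cutoffs, ∃ a₀, P.ThresholdForm t a₀ u ∧
            (∀ θ ∈ Ioc P.starLow P.hi, a θ = a₀ θ) ∧
            (∀ θ ∈ Icc P.lo P.starLow, ¬ P.LocallyAffine θ →
              P.workload a u θ = P.workload a₀ u θ) ∧
            (∀ᵐ θ, θ ∈ Icc P.lo P.starLow → ¬ P.LocallyAffine θ → a θ = a₀ θ)))) ∧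
    -- ironing a solution of the relaxed program solves the original program
    (∀ a u, P.IsRelaxedSolution a u → P.IsOriginalSolution (P.ironed a) u) := by
  have hP : P.Regular := ⟨hlo, hlt, hf_pos, hf_int, hf_one, hR_concave, hR_mono, hR_nonneg⟩
  refine ⟨?_, ?_, ?_, fun a u h => hP.isOriginalSolution_ironed h⟩
  · obtain ⟨v, hv⟩ := hP.exists_isGreatest_relaxedValues
    have ho := hP.isGreatest_originalValues hv
    exact ⟨v, ho, hv, by rw [hP.supportValues_eq]; exact ho⟩
  · rintro ⟨hA, hB⟩
    exact ⟨hP.isGreatest_relaxedValues_zero hA hB, hP.isRelaxedSolution_zero hA hB,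
      fun h a u hs => hP.eq_zero_of_isRelaxedSolution h.1 h.2 hs,
      fun h0 hR t ht => hP.isMaxOn_cutoffObjective hA hB h0 hR ht⟩
  · intro hpos
    refine ⟨hP.sharpHigh_le_starLow hpos, fun hR => ⟨?_,
      fun t ht a u h => h.isRelaxedSolution hP hR hpos ht, fun a u =>
        ⟨fun h => ⟨h.1, hP.exists_thresholdForm_of_isRelaxedSolution hR hpos h⟩, ?_⟩⟩⟩
    · convert hP.isGreatest_cutoffObjective hR hpos hP.max_mem_cutoffs using 1
      rw [InnerProgram.cutoffObjective]; ring
    · rintro ⟨hf, t, ht, a₀, h₀, h1, h2, h3⟩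
      exact hP.isRelaxedSolution_of_redistribution hf (h₀.isRelaxedSolution hP hR hpos ht) h1 h2 h3
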